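/- Let $\mathrm G=(\mathbb Z\times\mathbb R)\cup(\mathbb R\times\mathbb Z)\subset\mathbb R^2$ be the integer grid, with the distance $\mathsf d(a,b)=\|a-b\|_\infty$ and the measure $\mathfrak m=\mathcal H^1_{\mathsf d}$. Let $\mathrm X=\mathrm G\times[0,1]$, with the distance $\mathsf d_{\mathrm X}((a,t),(b,s))=\sqrt{\mathsf d(a,b)^2+|t-s|^2}$ and the product measure $\mathfrak m_{\mathrm X}=\mathfrak m\otimes\mathcal L^1|_{[0,1]}$. Then $(\mathrm X,\mathsf d_{\mathrm X},\mathfrak m_{\mathrm X})$ is a metric measure space (complete, separable, with a Borel measure that is finite on bounded sets) which is infinitesimally Hilbertian (its Sobolev space $H^{1,2}$, defined by $L^2$-relaxation of $\int \mathrm{lip}(f)^2$ from boundedly-supported Lipschitz functions, is a Hilbert space), $\mathfrak m_{\mathrm X}$-rectifiable, $2$-Ahlfors regular, and a PI space (doubling, with a weak $(1,2)$-Poincaré inequality). Moreover, it has a unique pmGH-asymptotic cone, namely the pointed space $(\mathbb R^2,\|\cdot\|_\infty,\tfrac14\mathcal L^2,0)$: for every $p\in\mathrm X$ and all radii $R_k\nearrow+\infty$,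 the rescaled spaces $$\big(\mathrm X,\ \mathsf d_{\mathrm X}/R_k,\ \mathfrak m_{\mathrm X}/\mathfrak m_{\mathrm X}(B_{R_k}(p)),\ p\big)$$ converge to it in the pointed measured Gromov–Hausdorff sense, and every pmGH-asymptotic cone of $(\mathrm X,\mathsf d_{\mathrm X},\mathfrak m_{\mathrm X})$ is isomorphic to it (by an isometric bijection preserving base point and measure). This asymptotic cone is infinitesimally non-Hilbertian: its space $H^{1,2}$ is not a Hilbert space. -/

import Mathlib

open MeasureTheory Filter Topology
open scoped NNReal ENNReal

noncomputable section

namespace MetricMeasure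

/-! ### Metric measure spaces -/

section General

universe u

variable {X : Type u} [MetricSpace X] [MeasurableSpace X] [BorelSpace X]

/-- `(X, d, μ)` is a metric measure space: `(X, d)` is complete and separable, and the Borel
measure `μ` is finite on bounded sets. -/
structure IsMetricMeasureSpace (μ : Measure X) : Prop where
  complete : CompleteSpace X
  separable : TopologicalSpace.SeparableSpace X
  boundedly_finite : ∀ s : Set X, Bornology.IsBounded s → μ s < ∞

/-- Boundedly-supported Lipschitz functions. -/
def IsBddSuppLipschitz (f : X → ℝ) : Prop :=
  (∃ K : ℝ≥0, LipschitzWith K f) ∧ Bornology.IsBounded (Function.support f)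

/-- The slope `lip f (x) = limsup_{y → x} |f y - f x| / d(y, x)`, where `y ≠ x`. At an isolated
point the punctured neighbourhood filter is trivial and the value is `0`. -/
def lipSlope (f : X → ℝ) (x : X) : ℝ≥0∞ :=
  limsup (fun y => edist (f y) (f x) / edist y x) (𝓝[≠] x)

/-- The energy `∫ lip(f)² dμ`. -/
def slopeEnergy (μ : Measure X) (f : X → ℝ) : ℝ≥0∞ :=
  ∫⁻ x, lipSlope f x ^ 2 ∂μ

/-- `u` is a sequence of boundedly-supported Lipschitz functions converging to `f` in `L²(μ)`. -/
def IsApproximation (μ : Measure X) (f : Lp ℝ 2 μ) (u : ℕ → X → ℝ) : Prop :=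
  (∀ n, IsBddSuppLipschitz (u n)) ∧
    Tendsto (fun n => eLpNorm (fun x => u n x - f x) 2 μ) atTop (𝓝 0)

/-- The functions in `L²(μ)` that belong to the Sobolev space `H^{1,2}`. -/
def sobolevSet (μ : Measure X) : Set (Lp ℝ 2 μ) :=
  {f | ∃ u : ℕ → X → ℝ, IsApproximation μ f u ∧ (⨆ n, slopeEnergy μ (u n)) < ∞}

/-- The relaxed energy: the infimum of `liminf ∫ lip(uₙ)² dμ` over all sequences `uₙ → f`. -/
def cheegerEnergy (μ : Measure X) (f : Lp ℝ 2 μ) : ℝ≥0∞ :=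
  ⨅ (u : ℕ → X → ℝ) (_ : IsApproximation μ f u),
    liminf (fun n => slopeEnergy μ (u n)) atTop

/-- The Sobolev norm, meant for elements of `sobolevSet μ` (where the energy is finite). -/
def sobolevNorm (μ : Measure X) (f : Lp ℝ 2 μ) : ℝ :=
  √(‖f‖ ^ 2 + (cheegerEnergy μ f).toReal)

/-- Infinitesimal Hilbertianity: the Sobolev space `H^{1,2}`, with its Sobolev norm and the linear
structure of `L²`, is a Hilbert space. That is, a Hilbert space `H` is identified with it
by a linear bijection `ι` that preserves the norms. -/
def IsInfinitesimallyHilbertian (μ : Measure X) : Prop :=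
  ∃ (H : Type u) (_ : NormedAddCommGroup H) (_ : InnerProductSpace ℝ H)
    (ι : H →ₗ[ℝ] Lp ℝ 2 μ),
    CompleteSpace H ∧ Function.Injective ι ∧ Set.range ι = sobolevSet μ ∧
      ∀ h : H, ‖h‖ = sobolevNorm μ (ι h)

/-- The doubling condition. -/
def IsDoubling (μ : Measure X) : Prop :=
  ∃ C : ℝ, 1 ≤ C ∧ ∀ (x : X) (r : ℝ), 0 < r →
    μ (Metric.ball x (2 * r)) ≤ ENNReal.ofReal C * μ (Metric.ball x r)

/-- `k`-Ahlfors regularity. -/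
def IsAhlforsRegular (k : ℝ) (μ : Measure X) : Prop :=
  ∃ α : ℝ, 1 ≤ α ∧ ∀ (x : X) (r : ℝ), 0 < r →
    ENNReal.ofReal r < Metric.ediam (Set.univ : Set X) →
    ENNReal.ofReal (α⁻¹ * r ^ k) ≤ μ (Metric.ball x r) ∧
      μ (Metric.ball x r) ≤ ENNReal.ofReal (α * r ^ k)

/-- The weak `(1,2)`-Poincaré inequality. -/
def SupportsWeakPoincare (μ : Measure X) : Prop :=
  ∃ C l : ℝ, 0 < C ∧ 1 ≤ l ∧ ∀ f : X → ℝ, IsBddSuppLipschitz f → ∀ (x : X) (r : ℝ), 0 < r →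
    ENNReal.ofReal
        (⨍ y in Metric.ball x r, |f y - ⨍ z in Metric.ball x r, f z ∂μ| ∂μ) ≤
      ENNReal.ofReal (C * r) *
        (⨍⁻ y in Metric.ball x (l * r), lipSlope f y ^ 2 ∂μ) ^ (1 / 2 : ℝ)

/-- PI spaces: doubling spaces supporting a weak `(1,2)`-Poincaré inequality. -/
def IsPI (μ : Measure X) : Prop :=
  IsDoubling μ ∧ SupportsWeakPoincare μ

/-- `(U, φ)` is an `n`-chart: `U` is Borel, `μ|_U ≪ ℋⁿ`, and `φ : U → ℝⁿ` is biLipschitz with its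
image. -/
def IsChart (μ : Measure X) (n : ℕ) (U : Set X) (φ : U → EuclideanSpace ℝ (Fin n)) : Prop :=
  MeasurableSet U ∧ μ.restrict U ≪ Measure.hausdorffMeasure (n : ℝ) ∧
    (∃ K : ℝ≥0, LipschitzWith K φ) ∧ ∃ K : ℝ≥0, AntilipschitzWith K φ

/-- `μ`-rectifiability: there is a countable atlas whose domains form a Borel partition of `X` up
to `μ`-null sets. Dimensions of the charts may vary. -/
def IsRectifiable (μ : Measure X) : Prop :=
  ∃ (n : ℕ → ℕ) (U : ℕ → Set X) (φ : ∀ i, U i → EuclideanSpace ℝ (Fin (n i))),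
    (∀ i, IsChart μ (n i) (U i) (φ i)) ∧ Pairwise (Function.onFun Disjoint U) ∧
      μ (⋃ i, U i)ᶜ = 0

end General

/-! ### Asymptotic cones -/

section Cones

universe u v

variable {X : Type u} [MetricSpace X] [MeasurableSpace X] [BorelSpace X]
  {Y : Type v} [MetricSpace Y] [MeasurableSpace Y] [BorelSpace Y]

/-- `(Y, d, ν, q)` is a pointed metric measure space. -/
def IsPointedMetricMeasureSpace (ν : Measure Y) (q : Y) : Prop :=
  IsMetricMeasureSpace ν ∧ q ∈ ν.support

/-- Pointed measured Gromov–Hausdorff convergence of the rescaled spaces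
`(X, d / rad k, μ / μ(B_{rad k}(p)), p)` to `(Y, d, ν, q)`. The Borel maps
`B_{R rad k}(p) → Y` are written as Borel maps on `X` of which only the restriction to
the ball is used. -/
def RescalingsConverge (μ : Measure X) (p : X) (rad : ℕ → ℝ) (ν : Measure Y) (q : Y) : Prop :=
  ∀ ε : ℝ, 0 < ε → ε < 1 → ∀ᵐ R : ℝ ∂volume, 1 < R →
    ∃ (k₀ : ℕ) (ψ : ℕ → X → Y),
      (∀ k, k₀ ≤ k → Measurable (ψ k) ∧ ψ k p = q ∧
        (∀ x ∈ Metric.ball p (R * rad k), ∀ y ∈ Metric.ball p (R * rad k),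
          |dist x y - rad k * dist (ψ k x) (ψ k y)| ≤ ε * rad k) ∧
        Metric.ball q (R - ε) ⊆
          Metric.thickening ε (ψ k '' Metric.ball p (R * rad k))) ∧
      ∀ f : Y → ℝ, Continuous f → (∃ C, ∀ y, |f y| ≤ C) →
        Bornology.IsBounded (Function.support f) →
        Tendsto
          (fun k => ∫ y, f y ∂((μ (Metric.ball p (rad k)))⁻¹ •
            (μ.restrict (Metric.ball p (R * rad k))).map (ψ k)))
          atTop (𝓝 (∫ y, f y ∂(ν.restrict (Metric.ball q R))))

/-- The pointed metric measure space `(Y, d, ν, q)` is a pmGH-asymptotic cone of `(X, d, μ)`. -/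
def IsAsymptoticCone (μ : Measure X) (ν : Measure Y) (q : Y) : Prop :=
  IsPointedMetricMeasureSpace ν q ∧
    ∃ rad : ℕ → ℝ, Monotone rad ∧ Tendsto rad atTop atTop ∧
      ∃ p ∈ μ.support, RescalingsConverge μ p rad ν q

/-- Isomorphism of pointed metric measure spaces. -/
def PointedIsomorphic {Y₁ : Type u} [MetricSpace Y₁] [MeasurableSpace Y₁]
    {Y₂ : Type v} [MetricSpace Y₂] [MeasurableSpace Y₂]
    (ν₁ : Measure Y₁) (q₁ : Y₁) (ν₂ : Measure Y₂) (q₂ : Y₂) : Prop :=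
  ∃ i : Y₁ ≃ᵢ Y₂, i q₁ = q₂ ∧ ν₁.map i = ν₂

end Cones

/-! ### The grid, its product with the unit interval, and the limit plane -/

/-- The grid `(ℤ × ℝ) ∪ (ℝ × ℤ)` in the plane. -/
def gridSet : Set (ℝ × ℝ) :=
  {a | (∃ n : ℤ, a.1 = n) ∨ ∃ n : ℤ, a.2 = n}

/-- The grid as a metric space; the distance on `ℝ × ℝ` is induced by the sup norm. -/
abbrev Grid : Type := gridSet

/-- The one-dimensional Hausdorff measure of the grid. -/
def gridMeasure : Measure Grid := Measure.hausdorffMeasure 1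

/-- The product of the grid and `[0,1]` with the distance `√(d(a,b)² + |t-s|²)`. -/
abbrev GridStrip : Type := WithLp 2 (Grid × Set.Icc (0 : ℝ) 1)

/-- The product of the Hausdorff measure of the grid and the Lebesgue measure of `[0,1]`. -/
def gridStripMeasure : Measure GridStrip :=
  (gridMeasure.prod (volume : Measure (Set.Icc (0 : ℝ) 1))).map (WithLp.toLp 2)

/-- A quarter of the Lebesgue measure of the plane `(ℝ², ‖·‖_∞)`. -/
def planeMeasure : Measure (ℝ × ℝ) := (4 : ℝ≥0∞)⁻¹ • volume

end MetricMeasure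

end

open MetricMeasure

noncomputable section

namespace MetricMeasure

set_option linter.unusedSectionVars false

universe u v

/-! ### The slope -/

section Slope

variable {X : Type u} [MetricSpace X] {Y : Type v} [MetricSpace Y]

/-! Over a single grid line the sup distance is the usual distance, so the part of the space above
that line is a flat Euclidean strip, and the crossings of the lines are negligible. The
infinitesimal structure is therefore Euclidean, while at large scales only the sup distance of the
plane survives.

Hilbertianity. Near almost every point the slope equals that of a function on the Euclidean plane
(`lipSlope_strip_eq`), hence by Rademacher the norm of a differential, which satisfies the
parallelogram law. Integrating gives the law for the slope energy of Lipschitz functions; it passes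
to the relaxed energy through near-optimal competitors, and lower semicontinuity makes the Sobolev
norm complete (`isInfinitesimallyHilbertian_of_parallelogram`).

Measure and Poincaré. Since the integer part pushes Lebesgue measure to counting measure, the family
of all horizontal lines, and likewise that of all vertical ones, is an image of the Lebesgue plane
(`gridMeasure_eq`). Ball volumes become products, which yields Ahlfors regularity and doubling. For
Poincaré, a row and a column that both meet a sup-ball cross inside it, so the oscillation between
them is controlled by integrals of the slope along the two segments (`lintegral_row_col_le`,
`grid_poincare`); the interval factor adds one more segment (`stripBox_poincare`).

Asymptotic cone. Forgetting the interval changes distances by at most 1, and the parametrizations of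
rows and columns, once rescaled, converge uniformly to the identity and to the coordinate swap. Each
family contributes one copy of Lebesgue measure, so balls of radius `ρ` have mass about `2 · 4 ρ²`,
and the normalized limit is `2 / 8 = 1 / 4` of Lebesgue measure. Any other cone is a limit of the
same balls through other almost isometries; an ultralimit compares the two
(`exists_isometryEquiv_of_common_approximation`), and test functions identify the measures.

The cone is not Hilbertian. The norm dual to the sup norm is the maximum of the values on `(1, 1)`
and `(1, -1)`. Two long ridges, one depending essentially on `x + y` and the other on `x - y`, have
at their crossing differentials `A`, `B` with `‖A ± B‖ = ‖A‖ = ‖B‖ = 2`, so the parallelogram law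
fails there by a definite amount, which beats the cost of cutting off the ridges
(`slopeEnergy_linearRidge_add_lt`). The relaxed energy of each ridge is bounded below by a
directional derivative, through integration by parts (`lintegral_lineDeriv_sq_le_cheegerEnergy`). -/

theorem lipSlope_le_of_eventually {f : X → ℝ} {x : X} {c : ℝ≥0∞}
    (h : ∀ᶠ y in 𝓝 x, edist (f y) (f x) ≤ c * edist y x) : lipSlope f x ≤ c := by
  refine limsup_le_of_le (by isBoundedDefault) ?_
  filter_upwards [h.filter_mono nhdsWithin_le_nhds] with y hy using ENNReal.div_le_of_le_mul hy

theorem eventually_of_lipSlope_lt {f : X → ℝ} {x : X} {c : ℝ≥0∞} (h : lipSlope f x < c) :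
    ∀ᶠ y in 𝓝 x, edist (f y) (f x) ≤ c * edist y x := by
  have h1 := eventually_lt_of_limsup_lt h
  rw [eventually_nhdsWithin_iff] at h1
  filter_upwards [h1] with y hy
  rcases eq_or_ne y x with rfl | hne
  · simp
  · have h2 := (hy hne).le
    rwa [ENNReal.div_le_iff (by simpa using hne) (edist_ne_top _ _)] at h2

/-- The transfer tool for slopes: applied to a chart and to its local inverse it gives equality of
slopes, and applied to a curve it bounds one-variable derivatives. -/
theorem lipSlope_comp_le {f : Y → ℝ} {φ : X → Y} {x : X}
    (h : ∀ᶠ y in 𝓝 x, edist (φ y) (φ x) ≤ edist y x) :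
    lipSlope (f ∘ φ) x ≤ lipSlope f (φ x) := by
  refine le_of_forall_gt fun c hc => ?_
  obtain ⟨c', hc', hc'c⟩ := exists_between hc
  refine lt_of_le_of_lt ?_ hc'c
  have hcont : Tendsto φ (𝓝 x) (𝓝 (φ x)) := by
    rw [tendsto_iff_edist_tendsto_0]
    refine tendsto_of_tendsto_of_tendsto_of_le_of_le' tendsto_const_nhds
      (tendsto_iff_edist_tendsto_0.1 (tendsto_id (x := 𝓝 x))) (by simp) h
  refine lipSlope_le_of_eventually ?_
  filter_upwards [hcont.eventually (eventually_of_lipSlope_lt hc'), h] with y h1 h2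
  exact h1.trans (by gcongr)

theorem lipSlope_congr {f g : X → ℝ} {x : X} (h : f =ᶠ[𝓝 x] g) : lipSlope f x = lipSlope g x := by
  refine limsup_congr ?_
  filter_upwards [h.filter_mono nhdsWithin_le_nhds] with y hy
  rw [hy, h.self_of_nhds]

theorem lipSlope_le_of_lipschitz {f : X → ℝ} {K : ℝ≥0} (h : LipschitzWith K f) (x : X) :
    lipSlope f x ≤ K :=
  lipSlope_le_of_eventually (Eventually.of_forall fun y => h y x)

theorem lipSlope_add_le (f g : X → ℝ) (x : X) :
    lipSlope (f + g) x ≤ lipSlope f x + lipSlope g x := by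
  refine ENNReal.le_of_forall_pos_le_add fun ε hε hfin => ?_
  obtain ⟨hf, hg⟩ := ENNReal.add_lt_top.1 hfin
  have hε2 : (ε : ℝ≥0∞) / 2 ≠ 0 := by simp [hε.ne']
  refine lipSlope_le_of_eventually ?_
  filter_upwards [eventually_of_lipSlope_lt (ENNReal.lt_add_right hf.ne hε2),
    eventually_of_lipSlope_lt (ENNReal.lt_add_right hg.ne hε2)] with y h1 h2
  calc edist ((f + g) y) ((f + g) x) ≤ edist (f y) (f x) + edist (g y) (g x) :=
        edist_add_add_le _ _ _ _
    _ ≤ _ := add_le_add h1 h2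
    _ = (lipSlope f x + lipSlope g x + (ε / 2 + ε / 2)) * edist y x := by ring
    _ = _ := by rw [ENNReal.add_halves]

theorem lipSlope_smul_le (c : ℝ) (f : X → ℝ) (x : X) :
    lipSlope (c • f) x ≤ ‖c‖ₑ * lipSlope f x := by
  rcases eq_or_ne (lipSlope f x) ∞ with hf | hf
  · rcases eq_or_ne c 0 with rfl | hc
    · refine (lipSlope_le_of_eventually (c := 0) (by simp)).trans (by simp)
    · rw [hf, ENNReal.mul_top (by simpa using hc)]; exact le_top
  refine ENNReal.le_of_forall_pos_le_add fun ε hε _ => ?_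
  have hpos : (ε : ℝ≥0∞) / (‖c‖ₑ + 1) ≠ 0 := by
    simp [ENNReal.div_eq_zero_iff, hε.ne']
  refine lipSlope_le_of_eventually ?_
  filter_upwards [eventually_of_lipSlope_lt (ENNReal.lt_add_right hf hpos)] with y h1
  have h3 : ‖c‖ₑ * ((ε : ℝ≥0∞) / (‖c‖ₑ + 1)) ≤ ε := by
    rw [← mul_div_assoc, mul_comm]
    refine ENNReal.div_le_of_le_mul ?_
    gcongr
    exact le_self_add
  calc edist ((c • f) y) ((c • f) x) = ‖c‖ₑ * edist (f y) (f x) := by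
        simp [edist_eq_enorm_sub, ← mul_sub, enorm_mul]
    _ ≤ ‖c‖ₑ * ((lipSlope f x + ε / (‖c‖ₑ + 1)) * edist y x) := by gcongr
    _ = (‖c‖ₑ * lipSlope f x + ‖c‖ₑ * (ε / (‖c‖ₑ + 1))) * edist y x := by ring
    _ ≤ _ := by gcongr

/-- At a fixed radius the supremum of the difference quotients is lower semicontinuous in the
centre: a nearby centre still sees the same competitor `y`, and the quotient is continuous there
because `y` differs from the centre. The slope is a countable infimum of these. -/
theorem measurable_lipSlope [MeasurableSpace X] [BorelSpace X] {f : X → ℝ} (hf : Continuous f) :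
    Measurable (lipSlope f) := by
  have h1 : ∀ x, lipSlope f x = ⨅ n : ℕ, ⨆ y ∈ Metric.ball x (1 / ((n : ℝ) + 1)) ∩ {x}ᶜ,
      edist (f y) (f x) / edist y x := fun x => by
    have hb : (𝓝[≠] x).HasBasis (fun _ : ℕ => True)
        (fun n : ℕ => Metric.ball x (1 / ((n : ℝ) + 1)) ∩ {x}ᶜ) :=
      nhdsWithin_hasBasis Metric.nhds_basis_ball_inv_nat_succ _
    rw [lipSlope, hb.limsup_eq_iInf_iSup]
    simp
  rw [show lipSlope f = _ from funext h1]
  refine Measurable.iInf fun n => LowerSemicontinuous.measurable ?_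
  intro x c hc
  replace hc : c < ⨆ y ∈ Metric.ball x (1 / ((n : ℝ) + 1)) ∩ {x}ᶜ,
    edist (f y) (f x) / edist y x := hc
  rw [lt_iSup_iff] at hc
  obtain ⟨y, hc⟩ := hc
  rw [lt_iSup_iff] at hc
  obtain ⟨hy, hc⟩ := hc
  have hcont : ContinuousAt (fun x' => edist (f y) (f x') / edist y x') x := by
    refine ENNReal.Tendsto.div ?_ ?_ ?_ ?_
    · exact (continuous_const.edist hf).continuousAt
    · right; simpa using hy.2
    · exact (continuous_const.edist continuous_id).continuousAt
    · left; exact edist_ne_top _ _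
  have hopen : ∀ᶠ x' in 𝓝 x, y ∈ Metric.ball x' (1 / ((n : ℝ) + 1)) ∩ {x'}ᶜ := by
    have h2 : ∀ᶠ x' in 𝓝 x, dist y x' < 1 / ((n : ℝ) + 1) :=
      (continuous_const.dist continuous_id).continuousAt.eventually_lt continuousAt_const hy.1
    have h3 : ∀ᶠ x' in 𝓝 x, x' ≠ y := by
      have : x ≠ y := fun h => hy.2 h.symm
      exact isOpen_ne.mem_nhds this
    filter_upwards [h2, h3] with x' h4 h5 using ⟨h4, fun h => h5 h.symm⟩
  filter_upwards [hcont.eventually (lt_mem_nhds hc), hopen] with x' h4 h5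
  exact h4.trans_le (le_iSup₂_of_le y h5 le_rfl)

end Slope

/-! ### The relaxed energy -/

section Cheeger

variable {X : Type u} [MetricSpace X]

theorem IsBddSuppLipschitz.continuous {f : X → ℝ} (hf : IsBddSuppLipschitz f) : Continuous f :=
  hf.1.choose_spec.continuous

theorem IsBddSuppLipschitz.zero : IsBddSuppLipschitz (0 : X → ℝ) :=
  ⟨⟨0, LipschitzWith.const 0⟩, by simp [Function.support]⟩

theorem IsBddSuppLipschitz.add {f g : X → ℝ} (hf : IsBddSuppLipschitz f)
    (hg : IsBddSuppLipschitz g) : IsBddSuppLipschitz (f + g) := by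
  obtain ⟨⟨K, hK⟩, hfs⟩ := hf
  obtain ⟨⟨L, hL⟩, hgs⟩ := hg
  exact ⟨⟨K + L, hK.add hL⟩, (hfs.union hgs).subset (Function.support_add f g)⟩

theorem IsBddSuppLipschitz.smul {f : X → ℝ} (c : ℝ) (hf : IsBddSuppLipschitz f) :
    IsBddSuppLipschitz (c • f) := by
  obtain ⟨⟨K, hK⟩, hfs⟩ := hf
  refine ⟨⟨‖c‖₊ * K, (lipschitzWith_smul c).comp hK⟩,
    hfs.subset (Function.support_const_smul_subset c f)⟩

theorem IsBddSuppLipschitz.neg {f : X → ℝ} (hf : IsBddSuppLipschitz f) :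
    IsBddSuppLipschitz (-f) := by
  simpa using hf.smul (-1)

theorem IsBddSuppLipschitz.sub {f g : X → ℝ} (hf : IsBddSuppLipschitz f)
    (hg : IsBddSuppLipschitz g) : IsBddSuppLipschitz (f - g) := by
  simpa [sub_eq_add_neg] using hf.add hg.neg

variable [MeasurableSpace X] {μ : Measure X}

theorem exists_of_cheegerEnergy_lt {f : Lp ℝ 2 μ} {c ε : ℝ≥0∞} (h : cheegerEnergy μ f < c)
    (hε : 0 < ε) : ∃ u : X → ℝ, IsBddSuppLipschitz u ∧
      eLpNorm (fun x => u x - f x) 2 μ < ε ∧ slopeEnergy μ u < c := by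
  obtain ⟨u, h⟩ := iInf_lt_iff.1 h
  obtain ⟨hu, h⟩ := iInf_lt_iff.1 h
  have h1 := frequently_lt_of_liminf_lt (by isBoundedDefault) h
  obtain ⟨n, h2, h3⟩ := (h1.and_eventually (hu.2.eventually (gt_mem_nhds hε))).exists
  exact ⟨u n, hu.1 n, h3, h2⟩

theorem exists_sequence_of_forall_exists {f : Lp ℝ 2 μ} {c : ℝ≥0∞}
    (h : ∀ ε : ℝ≥0∞, 0 < ε → ∃ u : X → ℝ, IsBddSuppLipschitz u ∧
      eLpNorm (fun x => u x - f x) 2 μ < ε ∧ slopeEnergy μ u ≤ c) :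
    ∃ u : ℕ → X → ℝ, IsApproximation μ f u ∧ ∀ n, slopeEnergy μ (u n) ≤ c := by
  choose u hu using fun n : ℕ => h ((n : ℝ≥0∞) + 1)⁻¹ (by simp)
  refine ⟨u, ⟨fun n => (hu n).1, ?_⟩, fun n => (hu n).2.2⟩
  refine tendsto_of_tendsto_of_tendsto_of_le_of_le tendsto_const_nhds
    (ENNReal.tendsto_inv_nat_nhds_zero.comp (tendsto_add_atTop_nat 1)) (fun _ => bot_le) ?_
  intro n
  simpa using (hu n).2.1.le

/-- Replaces sequences by single competitors at each precision. With `exists_of_cheegerEnergy_lt` it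
makes the relaxed energy usable without any choice of approximating sequences. -/
theorem cheegerEnergy_le_of_forall_exists {f : Lp ℝ 2 μ} {c : ℝ≥0∞}
    (h : ∀ ε : ℝ≥0∞, 0 < ε → ∃ u : X → ℝ, IsBddSuppLipschitz u ∧
      eLpNorm (fun x => u x - f x) 2 μ < ε ∧ slopeEnergy μ u ≤ c) :
    cheegerEnergy μ f ≤ c := by
  obtain ⟨u, hu, hc⟩ := exists_sequence_of_forall_exists h
  refine (iInf₂_le u hu).trans ?_
  exact (liminf_le_liminf (Eventually.of_forall hc)).trans (by simp)

theorem exists_of_lt_cheegerEnergy {f : Lp ℝ 2 μ} {c : ℝ≥0∞} (h : c < cheegerEnergy μ f) :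
    ∃ ε : ℝ≥0∞, 0 < ε ∧ ∀ u : X → ℝ, IsBddSuppLipschitz u →
      eLpNorm (fun x => u x - f x) 2 μ < ε → c < slopeEnergy μ u := by
  by_contra! h'
  refine absurd (cheegerEnergy_le_of_forall_exists fun ε hε => ?_) (not_le.2 h)
  obtain ⟨u, h1, h2, h3⟩ := h' ε hε
  exact ⟨u, h1, h2, h3⟩

theorem mem_sobolevSet_iff {f : Lp ℝ 2 μ} : f ∈ sobolevSet μ ↔ cheegerEnergy μ f < ∞ := by
  constructor
  · rintro ⟨u, hu, hfin⟩
    refine lt_of_le_of_lt ((iInf₂_le u hu).trans ?_) hfin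
    exact liminf_le_of_le (by isBoundedDefault) fun b hb =>
      let ⟨n, hn⟩ := hb.exists; hn.trans (le_iSup (fun n => slopeEnergy μ (u n)) n)
  · intro h
    obtain ⟨c, hc, hc'⟩ := exists_between h
    obtain ⟨u, hu, hE⟩ := exists_sequence_of_forall_exists (f := f) (c := c) fun ε hε => by
      obtain ⟨u, h1, h2, h3⟩ := exists_of_cheegerEnergy_lt hc hε
      exact ⟨u, h1, h2, h3.le⟩
    exact ⟨u, hu, (iSup_le hE).trans_lt hc'⟩

theorem cheegerEnergy_le_slopeEnergy {f : Lp ℝ 2 μ} {u : X → ℝ} (hu : IsBddSuppLipschitz u)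
    (h : f =ᵐ[μ] u) : cheegerEnergy μ f ≤ slopeEnergy μ u := by
  refine cheegerEnergy_le_of_forall_exists fun ε hε => ⟨u, hu, ?_, le_rfl⟩
  have : (fun x => u x - f x) =ᵐ[μ] 0 := by
    filter_upwards [h] with x hx
    simp [hx]
  rw [eLpNorm_congr_ae this]
  simpa using hε

theorem slopeEnergy_zero : slopeEnergy μ (0 : X → ℝ) = 0 := by
  have : ∀ x : X, lipSlope (0 : X → ℝ) x = 0 := fun x =>
    le_antisymm (lipSlope_le_of_eventually (by simp)) bot_le
  simp [slopeEnergy, this]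

theorem cheegerEnergy_zero : cheegerEnergy μ (0 : Lp ℝ 2 μ) = 0 :=
  le_antisymm ((cheegerEnergy_le_slopeEnergy IsBddSuppLipschitz.zero (Lp.coeFn_zero _ _ _)).trans
    slopeEnergy_zero.le) bot_le

variable [BorelSpace X]

theorem IsBddSuppLipschitz.aestronglyMeasurable {u : X → ℝ} (hu : IsBddSuppLipschitz u) :
    AEStronglyMeasurable u μ :=
  hu.continuous.aestronglyMeasurable

theorem eLpNorm_add_sub_add_le {u v : X → ℝ} (hu : IsBddSuppLipschitz u)
    (hv : IsBddSuppLipschitz v) (f g : Lp ℝ 2 μ) :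
    eLpNorm (fun x => (u + v) x - (f + g : Lp ℝ 2 μ) x) 2 μ ≤
      eLpNorm (fun x => u x - f x) 2 μ + eLpNorm (fun x => v x - g x) 2 μ := by
  have h : (fun x => (u + v) x - (f + g : Lp ℝ 2 μ) x) =ᵐ[μ]
      (fun x => u x - f x) + (fun x => v x - g x) := by
    filter_upwards [Lp.coeFn_add f g] with x hx
    rw [hx]; simp only [Pi.add_apply]; ring
  rw [eLpNorm_congr_ae h]
  exact eLpNorm_add_le (hu.aestronglyMeasurable.sub (Lp.aestronglyMeasurable f))
    (hv.aestronglyMeasurable.sub (Lp.aestronglyMeasurable g)) (by norm_num)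

omit [MetricSpace X] [BorelSpace X] in
theorem eLpNorm_smul_sub_smul (c : ℝ) (u : X → ℝ) (f : Lp ℝ 2 μ) :
    eLpNorm (fun x => (c • u) x - (c • f : Lp ℝ 2 μ) x) 2 μ =
      ‖c‖ₑ * eLpNorm (fun x => u x - f x) 2 μ := by
  rw [← eLpNorm_const_smul]
  refine eLpNorm_congr_ae ?_
  filter_upwards [Lp.coeFn_smul c f] with x hx
  rw [hx]; simp only [Pi.smul_apply, smul_eq_mul]; ring

theorem eLpNorm_sub_sub_sub_le {u v : X → ℝ} (hu : IsBddSuppLipschitz u)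
    (hv : IsBddSuppLipschitz v) (f g : Lp ℝ 2 μ) :
    eLpNorm (fun x => (u - v) x - (f - g : Lp ℝ 2 μ) x) 2 μ ≤
      eLpNorm (fun x => u x - f x) 2 μ + eLpNorm (fun x => v x - g x) 2 μ := by
  have h := eLpNorm_add_sub_add_le hu hv.neg f (-g)
  have h2 := eLpNorm_smul_sub_smul (-1) v g
  simp only [neg_smul, one_smul, enorm_neg, enorm_one, one_mul] at h2
  rw [h2] at h
  simpa only [sub_eq_add_neg] using h

/-- Lower semicontinuity in `L²`: a near-optimal competitor for a close function is a competitor for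
`f`. -/
theorem cheegerEnergy_le_of_forall_near {f : Lp ℝ 2 μ} {c : ℝ≥0∞}
    (h : ∀ ε : ℝ≥0∞, 0 < ε → ∃ g : Lp ℝ 2 μ, eLpNorm (fun x => g x - f x) 2 μ < ε ∧
      cheegerEnergy μ g ≤ c) : cheegerEnergy μ f ≤ c := by
  refine le_of_forall_gt_imp_ge_of_dense fun c' hc' => ?_
  refine cheegerEnergy_le_of_forall_exists fun ε hε => ?_
  have hε2 : 0 < ε / 2 := ENNReal.half_pos hε.ne'
  obtain ⟨g, hg, hgc⟩ := h (ε / 2) hε2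
  obtain ⟨u, hu, hug, hE⟩ := exists_of_cheegerEnergy_lt (hgc.trans_lt hc') hε2
  refine ⟨u, hu, ?_, hE.le⟩
  have : (fun x => u x - f x) = (fun x => u x - g x) + (fun x => g x - f x) := by
    ext x; simp
  rw [this]
  refine (eLpNorm_add_le (hu.aestronglyMeasurable.sub (Lp.aestronglyMeasurable g))
    ((Lp.aestronglyMeasurable g).sub (Lp.aestronglyMeasurable f)) (by norm_num)).trans_lt ?_
  exact (ENNReal.add_lt_add hug hg).trans_eq (ENNReal.add_halves _)

omit [BorelSpace X] in
theorem slopeEnergy_smul_le (c : ℝ) (u : X → ℝ) :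
    slopeEnergy μ (c • u) ≤ ‖c‖ₑ ^ 2 * slopeEnergy μ u := by
  unfold slopeEnergy
  rw [← lintegral_const_mul' _ _ (by finiteness)]
  refine lintegral_mono fun x => ?_
  rw [← mul_pow]
  exact pow_le_pow_left' (lipSlope_smul_le c u x) 2

omit [BorelSpace X] in
theorem cheegerEnergy_smul_le (c : ℝ) (f : Lp ℝ 2 μ) :
    cheegerEnergy μ (c • f) ≤ ‖c‖ₑ ^ 2 * cheegerEnergy μ f := by
  rcases eq_or_ne c 0 with rfl | hc
  · simp [cheegerEnergy_zero]
  have hc0 : ‖c‖ₑ ≠ 0 := by simpa using hc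
  have hcT : ‖c‖ₑ ≠ ∞ := enorm_ne_top
  rw [mul_comm, ← ENNReal.div_le_iff (by simp [hc]) (by finiteness)]
  refine le_of_forall_gt_imp_ge_of_dense fun d hd => ?_
  rw [ENNReal.div_le_iff (by simp [hc]) (by finiteness)]
  refine cheegerEnergy_le_of_forall_exists fun ε hε => ?_
  obtain ⟨u, hu, hug, hE⟩ := exists_of_cheegerEnergy_lt hd (ENNReal.div_pos hε.ne' hcT)
  refine ⟨c • u, hu.smul c, ?_, ?_⟩
  · rw [eLpNorm_smul_sub_smul, mul_comm]
    rwa [← ENNReal.lt_div_iff_mul_lt (Or.inl hc0) (Or.inl hcT)]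
  · refine (slopeEnergy_smul_le c u).trans ?_
    rw [mul_comm]
    gcongr

/-- Subadditivity of the slope with Young's inequality. Keeping `t` free encodes the triangle
inequality without square roots of possibly infinite energies; `t` is optimized in
`sobolevNorm_add_le`. -/
theorem slopeEnergy_add_le {u v : X → ℝ} (hu : Continuous u) {t : ℝ≥0} (ht : 0 < t) :
    slopeEnergy μ (u + v) ≤ (1 + t) * slopeEnergy μ u + (1 + t⁻¹ : ℝ≥0) * slopeEnergy μ v := by
  unfold slopeEnergy
  rw [← lintegral_const_mul' _ _ (by finiteness), ← lintegral_const_mul' _ _ (by finiteness),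
    ← lintegral_add_left (((measurable_lipSlope hu).pow_const 2).const_mul _)]
  refine lintegral_mono fun x => (pow_le_pow_left' (lipSlope_add_le u v x) 2).trans ?_
  generalize lipSlope u x = a
  generalize lipSlope v x = b
  have h1 : (t⁻¹ : ℝ≥0) + 1 ≠ 0 := by positivity
  induction a with
  | top =>
    have : (1 + (t : ℝ≥0∞)) * ∞ ^ 2 = ∞ := by simp [ENNReal.mul_top]
    simp only [this, top_add, le_top]
  | coe a =>
    induction b with
    | top =>
      have : ((1 + t⁻¹ : ℝ≥0) : ℝ≥0∞) * ∞ ^ 2 = ∞ := by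
        simp [ENNReal.mul_top]
      simp only [this, add_top, le_top]
    | coe b =>
      norm_cast
      rw [← NNReal.coe_le_coe]
      push_cast
      have ht' : (0 : ℝ) < t := ht
      have h2 : 0 ≤ (t : ℝ)⁻¹ * (t * a - b) ^ 2 := by positivity
      have h3 : (t : ℝ)⁻¹ * (t * a - b) ^ 2 = t * a ^ 2 - 2 * a * b + (t : ℝ)⁻¹ * b ^ 2 := by
        field_simp
        ring
      nlinarith

theorem cheegerEnergy_add_le (f g : Lp ℝ 2 μ) {t : ℝ≥0} (ht : 0 < t) :
    cheegerEnergy μ (f + g) ≤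
      (1 + t) * cheegerEnergy μ f + (1 + t⁻¹ : ℝ≥0) * cheegerEnergy μ g := by
  rcases eq_or_ne (cheegerEnergy μ f) ∞ with hf | hf
  · have : (1 + (t : ℝ≥0∞)) * ∞ = ∞ := by simp [ENNReal.mul_top]
    simp only [hf, this, top_add, le_top]
  rcases eq_or_ne (cheegerEnergy μ g) ∞ with hg | hg
  · have : ((1 + t⁻¹ : ℝ≥0) : ℝ≥0∞) * ∞ = ∞ := by simp [ENNReal.mul_top]
    simp only [hg, this, add_top, le_top]
  have hlim : Tendsto (fun δ : ℝ≥0∞ => (1 + t) * (cheegerEnergy μ f + δ) +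
      (1 + t⁻¹ : ℝ≥0) * (cheegerEnergy μ g + δ)) (𝓝[>] 0)
      (𝓝 ((1 + t) * cheegerEnergy μ f + (1 + t⁻¹ : ℝ≥0) * cheegerEnergy μ g)) := by
    have : Continuous (fun δ : ℝ≥0∞ => (1 + (t : ℝ≥0∞)) * (cheegerEnergy μ f + δ) +
      (1 + t⁻¹ : ℝ≥0) * (cheegerEnergy μ g + δ)) := by
      refine Continuous.add ?_ ?_
      · exact (ENNReal.continuous_const_mul (by finiteness)).comp (by fun_prop)
      · exact (ENNReal.continuous_const_mul (by finiteness)).comp (by fun_prop)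
    simpa using (this.tendsto 0).mono_left nhdsWithin_le_nhds
  refine ge_of_tendsto hlim ?_
  filter_upwards [self_mem_nhdsWithin] with δ hδ
  refine cheegerEnergy_le_of_forall_exists fun ε hε => ?_
  have hε2 : 0 < ε / 2 := ENNReal.half_pos hε.ne'
  obtain ⟨u, hu, huf, hEu⟩ :=
    exists_of_cheegerEnergy_lt (ENNReal.lt_add_right hf (ne_of_gt hδ)) hε2
  obtain ⟨v, hv, hvg, hEv⟩ :=
    exists_of_cheegerEnergy_lt (ENNReal.lt_add_right hg (ne_of_gt hδ)) hε2
  refine ⟨u + v, hu.add hv, ?_, ?_⟩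
  · exact (eLpNorm_add_sub_add_le hu hv f g).trans_lt
      ((ENNReal.add_lt_add huf hvg).trans_eq (ENNReal.add_halves _))
  · exact (slopeEnergy_add_le hu.continuous ht).trans (by gcongr)

/-- The parallelogram inequality passes from the slope energy to the relaxed energy. -/
theorem cheegerEnergy_parallelogram_le
    (hE : ∀ u v : X → ℝ, IsBddSuppLipschitz u → IsBddSuppLipschitz v →
      slopeEnergy μ (u + v) + slopeEnergy μ (u - v) ≤ 2 * slopeEnergy μ u + 2 * slopeEnergy μ v)
    (f g : Lp ℝ 2 μ) :
    cheegerEnergy μ (f + g) + cheegerEnergy μ (f - g) ≤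
      2 * cheegerEnergy μ f + 2 * cheegerEnergy μ g := by
  refine le_of_forall_gt_imp_ge_of_dense fun c hc => ?_
  have hf : cheegerEnergy μ f ≠ ∞ := by rintro h; simp [h] at hc
  have hg : cheegerEnergy μ g ≠ ∞ := by rintro h; simp [h] at hc
  obtain ⟨δ, hδ, hδc⟩ : ∃ δ : ℝ≥0∞, δ ≠ 0 ∧
      2 * (cheegerEnergy μ f + δ) + 2 * (cheegerEnergy μ g + δ) < c := by
    have : Continuous (fun δ : ℝ≥0∞ => 2 * (cheegerEnergy μ f + δ) +
        2 * (cheegerEnergy μ g + δ)) := by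
      refine Continuous.add ?_ ?_
      · exact (ENNReal.continuous_const_mul (by finiteness)).comp (by fun_prop)
      · exact (ENNReal.continuous_const_mul (by finiteness)).comp (by fun_prop)
    have h1 := (this.tendsto 0).eventually_lt_const (u := c) (by simpa using hc)
    obtain ⟨δ, h2, h3⟩ := ((h1.filter_mono nhdsWithin_le_nhds).and
      (self_mem_nhdsWithin (s := Set.Ioi (0 : ℝ≥0∞)))).exists
    exact ⟨δ, ne_of_gt h3, h2⟩
  refine le_of_forall_lt_imp_le_of_dense fun d hd => ?_
  -- A sum of two energies is approached from below summand by summand; the alternative `= 0` covers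
  -- an energy that vanishes, below which nothing lies.
  obtain ⟨a, b, ha, hb, hab⟩ : ∃ a b, (a < cheegerEnergy μ (f + g) ∨ a = 0) ∧
      (b < cheegerEnergy μ (f - g) ∨ b = 0) ∧ d ≤ a + b := by
    rcases eq_or_ne (cheegerEnergy μ (f + g)) 0 with h1 | h1
    · rw [h1, zero_add] at hd
      exact ⟨0, d, Or.inr rfl, Or.inl hd, by simp⟩
    rcases eq_or_ne (cheegerEnergy μ (f - g)) 0 with h2 | h2
    · rw [h2, add_zero] at hd
      exact ⟨d, 0, Or.inl hd, Or.inr rfl, by simp⟩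
    obtain ⟨a, ha, b, hb, hab⟩ := ENNReal.exists_lt_add_of_lt_add hd h1 h2
    exact ⟨a, b, Or.inl ha, Or.inl hb, hab.le⟩
  obtain ⟨ε₁, hε₁, H₁⟩ : ∃ ε : ℝ≥0∞, 0 < ε ∧ ∀ u : X → ℝ, IsBddSuppLipschitz u →
      eLpNorm (fun x => u x - (f + g : Lp ℝ 2 μ) x) 2 μ < ε → a ≤ slopeEnergy μ u := by
    rcases ha with ha | rfl
    · obtain ⟨ε, h1, h2⟩ := exists_of_lt_cheegerEnergy ha
      exact ⟨ε, h1, fun u h3 h4 => (h2 u h3 h4).le⟩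
    · exact ⟨1, one_pos, fun _ _ _ => bot_le⟩
  obtain ⟨ε₂, hε₂, H₂⟩ : ∃ ε : ℝ≥0∞, 0 < ε ∧ ∀ u : X → ℝ, IsBddSuppLipschitz u →
      eLpNorm (fun x => u x - (f - g : Lp ℝ 2 μ) x) 2 μ < ε → b ≤ slopeEnergy μ u := by
    rcases hb with hb | rfl
    · obtain ⟨ε, h1, h2⟩ := exists_of_lt_cheegerEnergy hb
      exact ⟨ε, h1, fun u h3 h4 => (h2 u h3 h4).le⟩
    · exact ⟨1, one_pos, fun _ _ _ => bot_le⟩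
  -- The errors of `u` and `v` add up in both `u + v` and `u - v`, hence the half of the smaller
  -- tolerance.
  have hε : 0 < min ε₁ ε₂ / 2 := ENNReal.half_pos (lt_min hε₁ hε₂).ne'
  obtain ⟨u, hu, huf, hEu⟩ := exists_of_cheegerEnergy_lt (ENNReal.lt_add_right hf hδ) hε
  obtain ⟨v, hv, hvg, hEv⟩ := exists_of_cheegerEnergy_lt (ENNReal.lt_add_right hg hδ) hε
  have hsum := (ENNReal.add_lt_add huf hvg).trans_eq (ENNReal.add_halves _)
  calc d ≤ a + b := hab
    _ ≤ slopeEnergy μ (u + v) + slopeEnergy μ (u - v) := add_le_add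
        (H₁ _ (hu.add hv)
          ((eLpNorm_add_sub_add_le hu hv f g).trans_lt (hsum.trans_le (min_le_left _ _))))
        (H₂ _ (hu.sub hv)
          ((eLpNorm_sub_sub_sub_le hu hv f g).trans_lt (hsum.trans_le (min_le_right _ _))))
    _ ≤ 2 * slopeEnergy μ u + 2 * slopeEnergy μ v := hE u v hu hv
    _ ≤ 2 * (cheegerEnergy μ f + δ) + 2 * (cheegerEnergy μ g + δ) := by gcongr
    _ ≤ c := hδc.le

/-- The converse inequality is the first one applied to `f + g` and `f - g`, together with the
quadratic homogeneity of the energy. -/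
theorem cheegerEnergy_parallelogram
    (hE : ∀ u v : X → ℝ, IsBddSuppLipschitz u → IsBddSuppLipschitz v →
      slopeEnergy μ (u + v) + slopeEnergy μ (u - v) ≤ 2 * slopeEnergy μ u + 2 * slopeEnergy μ v)
    (f g : Lp ℝ 2 μ) :
    cheegerEnergy μ (f + g) + cheegerEnergy μ (f - g) =
      2 * cheegerEnergy μ f + 2 * cheegerEnergy μ g := by
  refine le_antisymm (cheegerEnergy_parallelogram_le hE f g) ?_
  have h := cheegerEnergy_parallelogram_le hE (f + g) (f - g)
  have h1 : f + g + (f - g) = (2 : ℝ) • f := by rw [two_smul]; abel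
  have h2 : f + g - (f - g) = (2 : ℝ) • g := by rw [two_smul]; abel
  rw [h1, h2] at h
  have key : ∀ k : Lp ℝ 2 μ, 4 * cheegerEnergy μ k ≤ cheegerEnergy μ ((2 : ℝ) • k) := fun k => by
    have h3 := cheegerEnergy_smul_le (2⁻¹ : ℝ) ((2 : ℝ) • k)
    rw [smul_smul, inv_mul_cancel₀ two_ne_zero, one_smul] at h3
    have h4 : ‖(2⁻¹ : ℝ)‖ₑ ^ 2 = 4⁻¹ := by
      rw [← ofReal_norm, Real.norm_of_nonneg (by norm_num),
        ENNReal.ofReal_inv_of_pos (by norm_num), ← ENNReal.inv_pow]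
      norm_num
    rw [h4] at h3
    calc 4 * cheegerEnergy μ k ≤ 4 * (4⁻¹ * cheegerEnergy μ ((2 : ℝ) • k)) := by gcongr
      _ = _ := by
        rw [← mul_assoc, ENNReal.mul_inv_cancel (by norm_num) (by norm_num), one_mul]
  have h5 := (add_le_add (key f) (key g)).trans h
  have h6 : 2 * (2 * cheegerEnergy μ f + 2 * cheegerEnergy μ g) ≤
      2 * (cheegerEnergy μ (f + g) + cheegerEnergy μ (f - g)) := by
    calc 2 * (2 * cheegerEnergy μ f + 2 * cheegerEnergy μ g)
        = 4 * cheegerEnergy μ f + 4 * cheegerEnergy μ g := by ring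
      _ ≤ _ := h5
      _ = _ := by ring
  exact (ENNReal.mul_le_mul_iff_right (by norm_num) (by norm_num)).1 h6

end Cheeger

/-! ### Hilbert structure from a quadratic energy -/

section Hilbert

/-- A complete norm satisfying the parallelogram law comes from a Hilbert space. -/
theorem exists_hilbert_of_parallelogram {V : Type u} [AddCommGroup V] [Module ℝ V] (N : V → ℝ)
    (h0 : N 0 = 0) (hadd : ∀ x y, N (x + y) ≤ N x + N y) (hsmul : ∀ (c : ℝ) x, N (c • x) ≤ |c| * N x)
    (heq : ∀ x, N x = 0 → x = 0)
    (hpar : ∀ x y, N (x + y) ^ 2 + N (x - y) ^ 2 = 2 * (N x ^ 2 + N y ^ 2))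
    (hcomplete : ∀ s : ℕ → V, (∀ ε > 0, ∃ n₀, ∀ m ≥ n₀, ∀ n ≥ n₀, N (s m - s n) < ε) →
      ∃ x, Tendsto (fun n => N (s n - x)) atTop (𝓝 0)) :
    ∃ (H : Type u) (_ : NormedAddCommGroup H) (_ : InnerProductSpace ℝ H) (e : H ≃ₗ[ℝ] V),
      CompleteSpace H ∧ ∀ h, ‖h‖ = N (e h) := by
  have hneg : ∀ x, N (-x) = N x := fun x => by
    have h1 := hsmul (-1) x
    have h2 := hsmul (-1) (-x)
    simp only [neg_smul, one_smul, abs_neg, abs_one, one_mul, neg_neg] at h1 h2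
    exact le_antisymm h1 h2
  let nrm : AddGroupNorm V :=
    { toFun := N, map_zero' := h0, add_le' := hadd, neg' := hneg, eq_zero_of_map_eq_zero' := heq }
  let i1 : NormedAddCommGroup V := nrm.toNormedAddCommGroup
  let i2 : NormedSpace ℝ V := { norm_smul_le := hsmul }
  let i3 : InnerProductSpace ℝ V := InnerProductSpace.ofNorm ℝ fun x y => by
    have h := hpar x y
    simp only [sq] at h
    exact h
  refine ⟨V, i1, i3, LinearEquiv.refl ℝ V, ?_, fun h => rfl⟩
  refine Metric.complete_of_cauchySeq_tendsto fun s hs => ?_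
  obtain ⟨x, hx⟩ := hcomplete s fun ε hε => by
    obtain ⟨n₀, hn⟩ := Metric.cauchySeq_iff.1 hs ε hε
    exact ⟨n₀, fun m hm n hn' => by
      have h := hn m hm n hn'
      rw [dist_eq_norm] at h
      exact h⟩
  exact ⟨x, tendsto_iff_norm_sub_tendsto_zero.2 hx⟩

variable {X : Type u} [MetricSpace X] [MeasurableSpace X] [BorelSpace X] {μ : Measure X}

/-- The Sobolev space as a subspace of `L²`. -/
def sobolevSubmodule (μ : Measure X) : Submodule ℝ (Lp ℝ 2 μ) where
  carrier := sobolevSet μ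
  zero_mem' := mem_sobolevSet_iff.2 (by simp [cheegerEnergy_zero])
  add_mem' {f g} hf hg := by
    rw [mem_sobolevSet_iff] at *
    refine (cheegerEnergy_add_le f g one_pos).trans_lt ?_
    finiteness
  smul_mem' c f hf := by
    rw [mem_sobolevSet_iff] at *
    refine (cheegerEnergy_smul_le c f).trans_lt ?_
    finiteness

theorem cheegerEnergy_ne_top (f : sobolevSubmodule μ) : cheegerEnergy μ (f : Lp ℝ 2 μ) ≠ ∞ :=
  (mem_sobolevSet_iff.1 f.2).ne

theorem sobolevNorm_sq (f : Lp ℝ 2 μ) :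
    sobolevNorm μ f ^ 2 = ‖f‖ ^ 2 + (cheegerEnergy μ f).toReal :=
  Real.sq_sqrt (by positivity)

theorem sobolevNorm_nonneg (f : Lp ℝ 2 μ) : 0 ≤ sobolevNorm μ f := Real.sqrt_nonneg _

theorem sobolevNorm_smul_le (c : ℝ) (f : sobolevSubmodule μ) :
    sobolevNorm μ (c • f : sobolevSubmodule μ) ≤ |c| * sobolevNorm μ f := by
  refine abs_le_of_sq_le_sq' ?_ (mul_nonneg (abs_nonneg c) (sobolevNorm_nonneg _)) |>.2
  rw [mul_pow, sobolevNorm_sq, sobolevNorm_sq]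
  have h := ENNReal.toReal_mono (ENNReal.mul_ne_top (by finiteness) (cheegerEnergy_ne_top f))
    (cheegerEnergy_smul_le c (f : Lp ℝ 2 μ))
  rw [ENNReal.toReal_mul, ENNReal.toReal_pow, toReal_enorm, Real.norm_eq_abs] at h
  rw [Submodule.coe_smul, norm_smul, mul_pow, Real.norm_eq_abs]
  linarith

theorem sobolevNorm_sq_add_le (f g : sobolevSubmodule μ) {t : ℝ} (ht : 0 < t) :
    sobolevNorm μ (f + g : sobolevSubmodule μ) ^ 2 ≤
      (1 + t) * sobolevNorm μ f ^ 2 + (1 + t⁻¹) * sobolevNorm μ g ^ 2 := by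
  simp only [sobolevNorm_sq]
  lift t to ℝ≥0 using ht.le
  have hf := cheegerEnergy_ne_top f
  have hg := cheegerEnergy_ne_top g
  have h := ENNReal.toReal_mono (by finiteness)
    (cheegerEnergy_add_le (f : Lp ℝ 2 μ) (g : Lp ℝ 2 μ) (t := t) (by exact_mod_cast ht))
  rw [ENNReal.toReal_add (by finiteness) (by finiteness), ENNReal.toReal_mul,
    ENNReal.toReal_mul, ENNReal.toReal_add (by simp) (by simp)] at h
  simp only [ENNReal.toReal_one, ENNReal.coe_toReal, NNReal.coe_add, NNReal.coe_one,
    NNReal.coe_inv] at h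
  have h1 : ‖(f : Lp ℝ 2 μ) + g‖ ^ 2 ≤ (1 + t) * ‖(f : Lp ℝ 2 μ)‖ ^ 2 +
      (1 + (t : ℝ)⁻¹) * ‖(g : Lp ℝ 2 μ)‖ ^ 2 := by
    have h2 := norm_add_le (f : Lp ℝ 2 μ) g
    have h3 : ‖(f : Lp ℝ 2 μ) + g‖ ^ 2 ≤ (‖(f : Lp ℝ 2 μ)‖ + ‖(g : Lp ℝ 2 μ)‖) ^ 2 := by
      gcongr
    refine h3.trans ?_
    generalize ‖(f : Lp ℝ 2 μ)‖ = a
    generalize ‖(g : Lp ℝ 2 μ)‖ = b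
    have h4 : 0 ≤ (t : ℝ)⁻¹ * (t * a - b) ^ 2 := by positivity
    have h5 : (t : ℝ)⁻¹ * (t * a - b) ^ 2 = t * a ^ 2 - 2 * a * b + (t : ℝ)⁻¹ * b ^ 2 := by
      field_simp
      ring
    nlinarith
  rw [Submodule.coe_add]
  nlinarith

theorem sobolevNorm_add_le (f g : sobolevSubmodule μ) :
    sobolevNorm μ (f + g : sobolevSubmodule μ) ≤ sobolevNorm μ f + sobolevNorm μ g := by
  set a := sobolevNorm μ f with ha
  set b := sobolevNorm μ g with hb
  have ha0 : 0 ≤ a := sobolevNorm_nonneg _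
  have hb0 : 0 ≤ b := sobolevNorm_nonneg _
  have key : ∀ δ > 0, sobolevNorm μ (f + g : sobolevSubmodule μ) ^ 2 ≤
      a ^ 2 + b ^ 2 + a * (b + δ) + b * (a + δ) := fun δ hδ => by
    have h1 : 0 < a + δ := by linarith
    have h2 : 0 < b + δ := by linarith
    -- The optimal parameter is `b / a`; the shift by `δ` keeps it positive and finite when a norm
    -- vanishes, and is removed in the limit.
    refine (sobolevNorm_sq_add_le f g (t := (b + δ) / (a + δ)) (by positivity)).trans ?_
    rw [← ha, ← hb, inv_div]
    have h3 : (b + δ) / (a + δ) * a ^ 2 ≤ a * (b + δ) := by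
      rw [div_mul_eq_mul_div, div_le_iff₀ h1]
      have : 0 ≤ (b + δ) * a * δ := by positivity
      nlinarith
    have h4 : (a + δ) / (b + δ) * b ^ 2 ≤ b * (a + δ) := by
      rw [div_mul_eq_mul_div, div_le_iff₀ h2]
      have : 0 ≤ (a + δ) * b * δ := by positivity
      nlinarith
    nlinarith
  have hlim : Tendsto (fun δ : ℝ => a ^ 2 + b ^ 2 + a * (b + δ) + b * (a + δ)) (𝓝[>] 0)
      (𝓝 ((a + b) ^ 2)) := by
    have : Continuous (fun δ : ℝ => a ^ 2 + b ^ 2 + a * (b + δ) + b * (a + δ)) := by fun_prop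
    convert (this.tendsto 0).mono_left nhdsWithin_le_nhds using 2
    ring
  refine abs_le_of_sq_le_sq' (ge_of_tendsto hlim ?_) (by positivity) |>.2
  filter_upwards [self_mem_nhdsWithin] with δ hδ using key δ hδ

theorem norm_le_sobolevNorm (f : Lp ℝ 2 μ) : ‖f‖ ≤ sobolevNorm μ f :=
  Real.le_sqrt_of_sq_le (by simp)

theorem Lp_eLpNorm_sub (f g : Lp ℝ 2 μ) :
    eLpNorm (fun x => f x - g x) 2 μ = ENNReal.ofReal ‖f - g‖ := by
  rw [Lp.norm_def, ENNReal.ofReal_toReal (Lp.eLpNorm_ne_top _)]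
  exact (eLpNorm_congr_ae (Lp.coeFn_sub f g)).symm

/-- The `L²` limit exists since the Sobolev norm dominates the `L²` norm. The energy of `s n - f` is
bounded by lower semicontinuity, because `s n - s m` tends to `s n - f` in `L²` with small energy.
-/
theorem sobolev_complete (s : ℕ → sobolevSubmodule μ)
    (hs : ∀ ε > 0, ∃ n₀, ∀ m ≥ n₀, ∀ n ≥ n₀, sobolevNorm μ (s m - s n : sobolevSubmodule μ) < ε) :
    ∃ x : sobolevSubmodule μ,
      Tendsto (fun n => sobolevNorm μ (s n - x : sobolevSubmodule μ)) atTop (𝓝 0) := by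
  have hc : CauchySeq (fun n => (s n : Lp ℝ 2 μ)) := Metric.cauchySeq_iff.2 fun ε hε => by
    obtain ⟨n₀, h⟩ := hs ε hε
    refine ⟨n₀, fun m hm n hn => ?_⟩
    rw [dist_eq_norm]
    exact (norm_le_sobolevNorm _).trans_lt (h m hm n hn)
  obtain ⟨f, hf⟩ := cauchySeq_tendsto_of_complete hc
  have key : ∀ ε > 0, ∃ n₀, ∀ n ≥ n₀, cheegerEnergy μ ((s n : Lp ℝ 2 μ) - f) ≤
      ENNReal.ofReal (ε ^ 2) := fun ε hε => by
    obtain ⟨n₀, h⟩ := hs ε hε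
    refine ⟨n₀, fun n hn => cheegerEnergy_le_of_forall_near fun δ hδ => ?_⟩
    have h1 : ∀ᶠ m in atTop, ENNReal.ofReal ‖(s n : Lp ℝ 2 μ) - s m - (s n - f)‖ < δ := by
      have h2 : Tendsto (fun m => ENNReal.ofReal ‖(s n : Lp ℝ 2 μ) - s m - (s n - f)‖) atTop
          (𝓝 0) := by
        have : Tendsto (fun m => ‖(s n : Lp ℝ 2 μ) - s m - (s n - f)‖) atTop
            (𝓝 ‖(s n : Lp ℝ 2 μ) - f - (s n - f)‖) :=
          ((tendsto_const_nhds.sub hf).sub tendsto_const_nhds).norm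
        simpa [Function.comp_def] using (ENNReal.continuous_ofReal.tendsto _).comp this
      exact h2.eventually_lt_const hδ
    obtain ⟨m, hm, hmn⟩ := (h1.and (eventually_ge_atTop n₀)).exists
    refine ⟨(s n : Lp ℝ 2 μ) - s m, by rwa [Lp_eLpNorm_sub], ?_⟩
    have h3 := h n hn m hmn
    have h4 : (cheegerEnergy μ ((s n : Lp ℝ 2 μ) - s m)).toReal ≤ ε ^ 2 := by
      have h5 := sobolevNorm_sq (μ := μ) ((s n : Lp ℝ 2 μ) - s m)
      have h6 : sobolevNorm μ ((s n : Lp ℝ 2 μ) - s m) ^ 2 ≤ ε ^ 2 :=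
        pow_le_pow_left₀ (sobolevNorm_nonneg _) h3.le 2
      nlinarith [sq_nonneg ‖(s n : Lp ℝ 2 μ) - s m‖]
    exact (ENNReal.le_ofReal_iff_toReal_le (cheegerEnergy_ne_top (s n - s m)) (by positivity)).2 h4
  have hfmem : f ∈ sobolevSubmodule μ := by
    obtain ⟨n₀, h⟩ := key 1 one_pos
    have h1 : (s n₀ : Lp ℝ 2 μ) - f ∈ sobolevSubmodule μ :=
      mem_sobolevSet_iff.2 ((h n₀ le_rfl).trans_lt (by simp))
    have h2 := (sobolevSubmodule μ).sub_mem (s n₀).2 h1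
    simpa using h2
  refine ⟨⟨f, hfmem⟩, ?_⟩
  have h1 : Tendsto (fun n => (cheegerEnergy μ ((s n : Lp ℝ 2 μ) - f)).toReal) atTop (𝓝 0) := by
    rw [Metric.tendsto_atTop]
    intro ε hε
    obtain ⟨n₀, h⟩ := key (√(ε / 2)) (by positivity)
    refine ⟨n₀, fun n hn => ?_⟩
    have h2 := ENNReal.toReal_mono (by simp) (h n hn)
    rw [Real.sq_sqrt (by positivity), ENNReal.toReal_ofReal (by positivity)] at h2
    rw [Real.dist_eq, sub_zero, abs_of_nonneg ENNReal.toReal_nonneg]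
    linarith
  have h2 : Tendsto (fun n => ‖(s n : Lp ℝ 2 μ) - f‖ ^ 2) atTop (𝓝 0) := by
    simpa using (tendsto_iff_norm_sub_tendsto_zero.1 hf).pow 2
  simpa [sobolevNorm] using (h2.add h1).sqrt

/-- Reduces Hilbertianity to an inequality between integrals of slopes of Lipschitz functions, which
can be verified almost everywhere. -/
theorem isInfinitesimallyHilbertian_of_parallelogram
    (hE : ∀ u v : X → ℝ, IsBddSuppLipschitz u → IsBddSuppLipschitz v →
      slopeEnergy μ (u + v) + slopeEnergy μ (u - v) ≤ 2 * slopeEnergy μ u + 2 * slopeEnergy μ v) :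
    IsInfinitesimallyHilbertian μ := by
  obtain ⟨H, i1, i2, e, hc, hn⟩ := exists_hilbert_of_parallelogram
    (V := sobolevSubmodule μ) (fun f => sobolevNorm μ f)
    (by simp [sobolevNorm, cheegerEnergy_zero]) sobolevNorm_add_le sobolevNorm_smul_le
    (fun f hf => by
      have h1 := norm_le_sobolevNorm (μ := μ) f
      rw [hf] at h1
      simpa using h1)
    (fun f g => by
      simp only [sobolevNorm_sq, Submodule.coe_add, Submodule.coe_sub]
      have h := congrArg ENNReal.toReal
        (cheegerEnergy_parallelogram hE (f : Lp ℝ 2 μ) (g : Lp ℝ 2 μ))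
      have hf := cheegerEnergy_ne_top f
      have hg := cheegerEnergy_ne_top g
      have hfg : cheegerEnergy μ ((f : Lp ℝ 2 μ) + g) ≠ ∞ := cheegerEnergy_ne_top (f + g)
      have hfg' : cheegerEnergy μ ((f : Lp ℝ 2 μ) - g) ≠ ∞ := cheegerEnergy_ne_top (f - g)
      rw [ENNReal.toReal_add hfg hfg', ENNReal.toReal_add (by finiteness) (by finiteness)] at h
      simp only [ENNReal.toReal_mul, ENNReal.toReal_ofNat] at h
      have h2 := parallelogram_law_with_norm ℝ (f : Lp ℝ 2 μ) (g : Lp ℝ 2 μ)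
      linarith)
    sobolev_complete
  refine ⟨H, i1, i2, (sobolevSubmodule μ).subtype ∘ₗ e.toLinearMap, hc, ?_, ?_, hn⟩
  · exact (Submodule.injective_subtype _).comp e.injective
  · ext f
    constructor
    · rintro ⟨h, rfl⟩
      exact (e h).2
    · intro hf
      exact ⟨e.symm ⟨f, hf⟩, by simp⟩

end Hilbert

/-! ### The measure of the grid -/

section GridGeometry

theorem dist_grid (a b : Grid) : dist a b = max |a.1.1 - b.1.1| |a.1.2 - b.1.2| := rfl

theorem dist_strip (x y : GridStrip) :
    dist x y = √(dist x.fst y.fst ^ 2 + dist x.snd y.snd ^ 2) := by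
  rw [WithLp.prod_dist_eq_add (by norm_num), Real.sqrt_eq_rpow]
  norm_num

theorem dist_fst_le (x y : GridStrip) : dist x.fst y.fst ≤ dist x y := by
  rw [dist_strip]
  exact Real.le_sqrt_of_sq_le (by linarith [sq_nonneg (dist x.snd y.snd)])

theorem dist_snd_le (x y : GridStrip) : dist x.snd y.snd ≤ dist x y := by
  rw [dist_strip]
  exact Real.le_sqrt_of_sq_le (by linarith [sq_nonneg (dist x.fst y.fst)])

theorem dist_strip_le_add (x y : GridStrip) :
    dist x y ≤ dist x.fst y.fst + dist x.snd y.snd := by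
  rw [dist_strip]
  refine Real.sqrt_le_iff.2 ⟨by positivity, ?_⟩
  have : 0 ≤ dist x.fst y.fst * dist x.snd y.snd := by positivity
  nlinarith

/-- The horizontal line of the grid at height `n`. -/
def row (n : ℤ) (u : ℝ) : Grid := ⟨(u, n), Or.inr ⟨n, rfl⟩⟩

/-- The vertical line of the grid at abscissa `n`. -/
def col (n : ℤ) (u : ℝ) : Grid := ⟨(n, u), Or.inl ⟨n, rfl⟩⟩

theorem isometry_row (n : ℤ) : Isometry (row n) :=
  Isometry.of_dist_eq fun u v => by simp [dist_grid, row, Real.dist_eq]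

theorem isometry_col (n : ℤ) : Isometry (col n) :=
  Isometry.of_dist_eq fun u v => by simp [dist_grid, col, Real.dist_eq]

/-- The parametrization of all horizontal lines by the plane. -/
def rowMap (p : ℝ × ℝ) : Grid := row ⌊p.2⌋ p.1

/-- The parametrization of all vertical lines by the plane. -/
def colMap (p : ℝ × ℝ) : Grid := col ⌊p.2⌋ p.1

@[fun_prop]
theorem measurable_rowMap : Measurable rowMap := by
  refine Measurable.subtype_mk (measurable_fst.prodMk ?_)
  exact (measurable_from_top (f := fun n : ℤ => (n : ℝ))).comp (Int.measurable_floor.comp measurable_snd)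

@[fun_prop]
theorem measurable_colMap : Measurable colMap := by
  refine Measurable.subtype_mk (Measurable.prodMk ?_ measurable_fst)
  exact (measurable_from_top (f := fun n : ℤ => (n : ℝ))).comp (Int.measurable_floor.comp measurable_snd)

theorem map_floor_volume : (volume : Measure ℝ).map Int.floor = Measure.count := by
  refine Measure.ext_iff_singleton.2 fun n => ?_
  rw [Measure.map_apply Int.measurable_floor (measurableSet_singleton n),
    Int.preimage_floor_singleton, Measure.count_singleton, Real.volume_Ico]
  simp

/-- Each band of ordinates `[n, n + 1)` has height one and collapses to the line `L n`, so the image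
is the sum of the line measures with multiplicity one. A countable union of lines is thereby handled
by Fubini in the plane. -/
theorem map_line_volume {L : ℤ → ℝ → Grid} (hL : Measurable fun p : ℝ × ℝ => L ⌊p.2⌋ p.1)
    (hL' : ∀ n, Measurable (L n)) :
    (volume : Measure (ℝ × ℝ)).map (fun p => L ⌊p.2⌋ p.1) =
      Measure.sum fun n => (volume : Measure ℝ).map (L n) := by
  ext A hA
  rw [Measure.map_apply hL hA, Measure.sum_apply _ hA, Measure.volume_eq_prod,
    Measure.prod_apply_symm (hL hA)]
  have h : ∀ z : ℝ, volume ((fun x : ℝ => (x, z)) ⁻¹' ((fun p : ℝ × ℝ => L ⌊p.2⌋ p.1) ⁻¹' A)) =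
      (fun n => (volume : Measure ℝ).map (L n) A) ⌊z⌋ := fun z => by
    simp only [Measure.map_apply (hL' _) hA]
    rfl
  simp only [h]
  rw [← lintegral_map (f := fun n => (volume : Measure ℝ).map (L n) A) (measurable_of_countable _)
    Int.measurable_floor, map_floor_volume, lintegral_count]

theorem gridMeasure_restrict_range {φ : ℝ → Grid} (h : Isometry φ) :
    gridMeasure.restrict (Set.range φ) = (volume : Measure ℝ).map φ := by
  rw [gridMeasure, ← h.map_hausdorffMeasure (Or.inl zero_le_one), hausdorffMeasure_real]

/-- Hausdorff measure is intrinsic, so on each isometric line it is Lebesgue measure. Rows and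
columns overlap only in countably many points, which are null for a one-dimensional Hausdorff
measure. -/
theorem gridMeasure_eq :
    gridMeasure = (volume : Measure (ℝ × ℝ)).map rowMap + (volume : Measure (ℝ × ℝ)).map colMap := by
  have hrow : ∀ n, MeasurableSet (Set.range (row n)) := fun n =>
    (isometry_row n).isClosedEmbedding.isClosed_range.measurableSet
  have hcol : ∀ n, MeasurableSet (Set.range (col n)) := fun n =>
    (isometry_col n).isClosedEmbedding.isClosed_range.measurableSet
  have hR : MeasurableSet (⋃ n, Set.range (row n)) := MeasurableSet.iUnion hrow
  rw [← Measure.restrict_add_restrict_compl (μ := gridMeasure) hR]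
  congr 1
  · rw [Measure.restrict_iUnion ?_ hrow]
    · simp only [gridMeasure_restrict_range (isometry_row _)]
      exact (map_line_volume measurable_rowMap fun n => (isometry_row n).continuous.measurable).symm
    · intro m n hmn
      refine Set.disjoint_left.2 ?_
      rintro _ ⟨u, rfl⟩ ⟨v, hv⟩
      refine hmn ?_
      have := congrArg (fun a : Grid => a.1.2) hv
      simp only [row, Int.cast_inj] at this
      exact this.symm
  -- The complement of the rows is the union of the columns minus the crossings, which are the
  -- points `row p.1 p.2` with integer entries.
  · have hae : (⋃ n, Set.range (row n))ᶜ =ᵐ[gridMeasure] ⋃ n, Set.range (col n) := by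
      have hsub : (⋃ n, Set.range (row n))ᶜ ⊆ ⋃ n, Set.range (col n) := by
        rintro ⟨⟨a, b⟩, h⟩ hx
        rcases h with ⟨n, hn⟩ | ⟨n, hn⟩
        · simp only at hn
          subst hn
          exact Set.mem_iUnion.2 ⟨n, b, rfl⟩
        · simp only at hn
          subst hn
          exact (hx (Set.mem_iUnion.2 ⟨n, a, rfl⟩)).elim
      refine (LE.le.eventuallyLE hsub).antisymm ?_
      have hnull : gridMeasure (⋃ p : ℤ × ℤ, {row p.1 p.2}) = 0 := by
        refine measure_iUnion_null fun p => ?_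
        have : NullSingletonClass gridMeasure :=
          Measure.nullSingletonClass_hausdorff _ one_pos
        exact measure_singleton _
      have hae' : ∀ᵐ a ∂gridMeasure, a ∉ ⋃ p : ℤ × ℤ, {row p.1 p.2} :=
        measure_eq_zero_iff_ae_notMem.1 hnull
      filter_upwards [hae'] with a ha hac haR
      obtain ⟨m, v, rfl⟩ := Set.mem_iUnion.1 hac
      obtain ⟨n, u, hu⟩ := Set.mem_iUnion.1 haR
      have h1 : u = m := congrArg (fun a : Grid => a.1.1) hu
      refine ha (Set.mem_iUnion.2 ⟨(n, m), ?_⟩)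
      rw [← h1, Set.mem_singleton_iff]
      exact hu.symm
    refine (Measure.restrict_congr_set hae).trans ?_
    rw [Measure.restrict_iUnion ?_ hcol]
    · simp only [gridMeasure_restrict_range (isometry_col _)]
      exact (map_line_volume measurable_colMap fun n => (isometry_col n).continuous.measurable).symm
    · intro m n hmn
      refine Set.disjoint_left.2 ?_
      rintro _ ⟨u, rfl⟩ ⟨v, hv⟩
      refine hmn ?_
      have := congrArg (fun a : Grid => a.1.1) hv
      simp only [col, Int.cast_inj] at this
      exact this.symm

instance : SFinite gridMeasure := by
  rw [gridMeasure_eq]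
  infer_instance

/-- The parametrization of the horizontal strips. -/
def rowStrip (p : (ℝ × ℝ) × Set.Icc (0 : ℝ) 1) : GridStrip := WithLp.toLp 2 (rowMap p.1, p.2)

/-- The parametrization of the vertical strips. -/
def colStrip (p : (ℝ × ℝ) × Set.Icc (0 : ℝ) 1) : GridStrip := WithLp.toLp 2 (colMap p.1, p.2)

@[fun_prop]
theorem measurable_rowStrip : Measurable rowStrip :=
  (WithLp.measurable_toLp 2 _).comp
    ((measurable_rowMap.comp measurable_fst).prodMk measurable_snd)

@[fun_prop]
theorem measurable_colStrip : Measurable colStrip :=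
  (WithLp.measurable_toLp 2 _).comp
    ((measurable_colMap.comp measurable_fst).prodMk measurable_snd)

theorem gridStripMeasure_eq : gridStripMeasure =
    (volume : Measure ((ℝ × ℝ) × Set.Icc (0 : ℝ) 1)).map rowStrip +
      (volume : Measure ((ℝ × ℝ) × Set.Icc (0 : ℝ) 1)).map colStrip := by
  have h : ∀ {φ : ℝ × ℝ → Grid}, Measurable φ →
      (((volume : Measure (ℝ × ℝ)).map φ).prod (volume : Measure (Set.Icc (0 : ℝ) 1))).map
        (WithLp.toLp 2) = (volume : Measure ((ℝ × ℝ) × Set.Icc (0 : ℝ) 1)).map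
          (fun p => WithLp.toLp 2 (φ p.1, p.2)) := by
    intro φ hφ
    have h1 := Measure.map_prod_map (volume : Measure (ℝ × ℝ))
      (volume : Measure (Set.Icc (0 : ℝ) 1)) hφ measurable_id
    rw [Measure.map_id] at h1
    rw [h1, Measure.map_map (WithLp.measurable_toLp 2 _) (hφ.prodMap measurable_id)]
    rfl
  rw [gridStripMeasure, gridMeasure_eq, Measure.add_prod, Measure.map_add _ _
    (WithLp.measurable_toLp 2 _), h measurable_rowMap, h measurable_colMap]
  rfl

/-- The set of reals whose integer part is at distance less than `r` from `c`. -/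
def floorBall (c r : ℝ) : Set ℝ := {z | |(⌊z⌋ : ℝ) - c| < r}

theorem measurableSet_floorBall (c r : ℝ) : MeasurableSet (floorBall c r) := by
  have h : Measurable fun z : ℝ => |(⌊z⌋ : ℝ) - c| :=
    (((measurable_from_top (f := fun n : ℤ => (n : ℝ))).comp Int.measurable_floor).sub_const
      c).norm
  exact h measurableSet_Iio

theorem volume_floorBall_le (c r : ℝ) :
    volume (floorBall c r) ≤ ENNReal.ofReal (2 * r + 1) := by
  have hsub : floorBall c r ⊆ Set.Ioo (c - r) (c + r + 1) := fun z (hz : |(⌊z⌋ : ℝ) - c| < r) => by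
    rw [abs_lt] at hz
    exact ⟨by linarith [Int.floor_le z], by linarith [Int.lt_floor_add_one z]⟩
  refine (measure_mono hsub).trans ?_
  rw [Real.volume_Ioo]
  exact ENNReal.ofReal_le_ofReal (by linarith)

theorem le_volume_floorBall (c r : ℝ) :
    ENNReal.ofReal (2 * r - 1) ≤ volume (floorBall c r) := by
  have hsub : Set.Ioo (c - r + 1) (c + r) ⊆ floorBall c r := fun z hz => by
    have h1 := hz.1
    have h2 := hz.2
    have h3 := Int.lt_floor_add_one z
    have h4 := Int.floor_le z
    have h5 : |(⌊z⌋ : ℝ) - c| < r := abs_lt.2 ⟨by linarith, by linarith⟩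
    exact h5
  refine le_trans ?_ (measure_mono hsub)
  rw [Real.volume_Ioo]
  exact ENNReal.ofReal_le_ofReal (by linarith)

theorem one_le_volume_floorBall {c r : ℝ} (n : ℤ) (h : |(n : ℝ) - c| < r) :
    1 ≤ volume (floorBall c r) := by
  have hsub : Set.Ico (n : ℝ) (n + 1) ⊆ floorBall c r := fun z hz => by
    have : ⌊z⌋ = n := Int.floor_eq_iff.2 hz
    simpa [floorBall, this] using h
  refine le_trans ?_ (measure_mono hsub)
  rw [Real.volume_Ico]
  simp

theorem rowMap_preimage_ball (a : Grid) (r : ℝ) :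
    rowMap ⁻¹' Metric.ball a r = Metric.ball a.1.1 r ×ˢ floorBall a.1.2 r := by
  ext p
  simp [dist_grid, rowMap, row, floorBall, Real.dist_eq]

theorem colMap_preimage_ball (a : Grid) (r : ℝ) :
    colMap ⁻¹' Metric.ball a r = Metric.ball a.1.2 r ×ˢ floorBall a.1.1 r := by
  ext p
  simp [dist_grid, colMap, col, floorBall, Real.dist_eq, and_comm]

/-- A sup-ball pulls back to a product: an interval along the line times the set counting the lines
that meet the ball. The formula is exact; the two-sided bounds only estimate the number of lines. -/
theorem gridMeasure_ball (a : Grid) (r : ℝ) : gridMeasure (Metric.ball a r) =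
    ENNReal.ofReal (2 * r) * (volume (floorBall a.1.1 r) + volume (floorBall a.1.2 r)) := by
  rw [gridMeasure_eq, Measure.add_apply, Measure.map_apply measurable_rowMap measurableSet_ball,
    Measure.map_apply measurable_colMap measurableSet_ball, rowMap_preimage_ball,
    colMap_preimage_ball, Measure.volume_eq_prod, Measure.prod_prod, Measure.prod_prod,
    Real.volume_ball, Real.volume_ball]
  ring

theorem exists_int_floorBall (a : Grid) {r : ℝ} (hr : 0 < r) :
    (∃ n : ℤ, |(n : ℝ) - a.1.1| < r) ∨ ∃ n : ℤ, |(n : ℝ) - a.1.2| < r := by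
  rcases a.2 with ⟨n, hn⟩ | ⟨n, hn⟩
  · exact Or.inl ⟨n, by simpa [hn]⟩
  · exact Or.inr ⟨n, by simpa [hn]⟩

theorem gridMeasure_ball_le (a : Grid) {r : ℝ} (hr : 0 < r) :
    gridMeasure (Metric.ball a r) ≤ ENNReal.ofReal (4 * r * (2 * r + 1)) := by
  rw [gridMeasure_ball]
  calc _ ≤ ENNReal.ofReal (2 * r) * (ENNReal.ofReal (2 * r + 1) + ENNReal.ofReal (2 * r + 1)) := by
        gcongr <;> exact volume_floorBall_le _ r
    _ = _ := by
        rw [← ENNReal.ofReal_add (by positivity) (by positivity),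
          ← ENNReal.ofReal_mul (by positivity)]
        congr 1
        ring

/-- Lines of one direction suffice. The line through `a` gives the factor 1 for small radii; for `r
≥ 1` there are at least `2 r - 1 ≥ r` of them. -/
theorem le_gridMeasure_ball (a : Grid) {r : ℝ} (hr : 0 < r) :
    ENNReal.ofReal (2 * r * max 1 r) ≤ gridMeasure (Metric.ball a r) := by
  have key : ∀ c : ℝ, (∃ n : ℤ, |(n : ℝ) - c| < r) →
      ENNReal.ofReal (max 1 r) ≤ volume (floorBall c r) := by
    rintro c ⟨n, hn⟩
    rcases le_total r 1 with h1 | h1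
    · rw [max_eq_left h1, ENNReal.ofReal_one]
      exact one_le_volume_floorBall n hn
    · rw [max_eq_right h1]
      exact (ENNReal.ofReal_le_ofReal (by linarith)).trans (le_volume_floorBall c r)
  rw [gridMeasure_ball, ENNReal.ofReal_mul (by positivity)]
  gcongr
  rcases exists_int_floorBall a hr with h | h
  · exact (key _ h).trans le_self_add
  · exact (key _ h).trans le_add_self

theorem volume_Icc_ball_le (τ : Set.Icc (0 : ℝ) 1) (r : ℝ) :
    volume (Metric.ball τ r) ≤ ENNReal.ofReal (min 1 (2 * r)) := by
  have h : Metric.ball τ r = Subtype.val ⁻¹' Metric.ball (τ : ℝ) r := rfl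
  rw [h, volume_preimage_coe measurableSet_Icc.nullMeasurableSet measurableSet_ball]
  rcases le_total 1 (2 * r) with h1 | h1
  · rw [min_eq_left h1]
    exact (measure_mono Set.inter_subset_right).trans (by simp)
  · rw [min_eq_right h1]
    exact (measure_mono Set.inter_subset_left).trans (by simp)

/-- The centre may be an endpoint, so only the half-ball pointing to the farther endpoint is used;
it has room at least `1 / 2`. -/
theorem le_volume_Icc_ball (τ : Set.Icc (0 : ℝ) 1) {r : ℝ} (hr : 0 < r) :
    ENNReal.ofReal (min r (1 / 2)) ≤ volume (Metric.ball τ r) := by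
  have h : Metric.ball τ r = Subtype.val ⁻¹' Metric.ball (τ : ℝ) r := rfl
  rw [h, volume_preimage_coe measurableSet_Icc.nullMeasurableSet measurableSet_ball]
  obtain ⟨τ, h0, h1⟩ := τ
  have hm1 : min r (1 / 2) ≤ r := min_le_left _ _
  have hm2 : min r (1 / 2) ≤ 1 / 2 := min_le_right _ _
  have hm0 : 0 < min r (1 / 2) := by positivity
  rcases le_total τ (1 / 2) with h2 | h2
  · have hsub : Set.Ioo τ (τ + min r (1 / 2)) ⊆ Metric.ball τ r ∩ Set.Icc 0 1 := fun s hs => by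
      obtain ⟨h3, h4⟩ := hs
      rw [Real.ball_eq_Ioo]
      exact ⟨⟨by linarith, by linarith⟩, by linarith, by linarith⟩
    refine le_trans ?_ (measure_mono hsub)
    rw [Real.volume_Ioo]
    simp
  · have hsub : Set.Ioo (τ - min r (1 / 2)) τ ⊆ Metric.ball τ r ∩ Set.Icc 0 1 := fun s hs => by
      obtain ⟨h3, h4⟩ := hs
      rw [Real.ball_eq_Ioo]
      exact ⟨⟨by linarith, by linarith⟩, by linarith, by linarith⟩
    refine le_trans ?_ (measure_mono hsub)
    rw [Real.volume_Ioo]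
    simp

/-- The product of a ball of the grid and a ball of the interval. -/
def stripBox (x : GridStrip) (r : ℝ) : Set GridStrip :=
  {y | y.fst ∈ Metric.ball x.fst r ∧ y.snd ∈ Metric.ball x.snd r}

@[fun_prop]
theorem measurable_strip_fst : Measurable fun x : GridStrip => x.fst :=
  measurable_fst.comp (WithLp.measurable_ofLp 2 _)

@[fun_prop]
theorem measurable_strip_snd : Measurable fun x : GridStrip => x.snd :=
  measurable_snd.comp (WithLp.measurable_ofLp 2 _)

theorem measurableSet_stripBox (x : GridStrip) (r : ℝ) : MeasurableSet (stripBox x r) :=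
  (measurable_strip_fst measurableSet_ball).inter (measurable_strip_snd measurableSet_ball)

theorem gridStripMeasure_stripBox (x : GridStrip) (r : ℝ) : gridStripMeasure (stripBox x r) =
    gridMeasure (Metric.ball x.fst r) * volume (Metric.ball x.snd r) := by
  rw [gridStripMeasure, Measure.map_apply (WithLp.measurable_toLp 2 _) (measurableSet_stripBox x r),
    ← Measure.prod_prod]
  rfl

theorem ball_subset_stripBox (x : GridStrip) (r : ℝ) : Metric.ball x r ⊆ stripBox x r :=
  fun y hy => ⟨(dist_fst_le y x).trans_lt hy, (dist_snd_le y x).trans_lt hy⟩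

theorem stripBox_subset_ball (x : GridStrip) (r : ℝ) : stripBox x r ⊆ Metric.ball x (2 * r) :=
  fun y hy => by
    have h1 : dist y.fst x.fst < r := hy.1
    have h2 : dist y.snd x.snd < r := hy.2
    rw [Metric.mem_ball]
    linarith [dist_strip_le_add y x]

/-- For `r ≤ 1` boundedly many lines count and the interval contributes `2 r`; for `r ≥ 1` the
number of lines grows like `r` while the interval is saturated. Both regimes are quadratic, and 24
comes from `4 r · 3 · 2 r`. -/
theorem gridStripMeasure_stripBox_le (x : GridStrip) {r : ℝ} (hr : 0 < r) :
    gridStripMeasure (stripBox x r) ≤ ENNReal.ofReal (24 * r ^ 2) := by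
  rw [gridStripMeasure_stripBox]
  refine (mul_le_mul' (gridMeasure_ball_le _ hr) (volume_Icc_ball_le _ r)).trans ?_
  rw [← ENNReal.ofReal_mul (by positivity)]
  refine ENNReal.ofReal_le_ofReal ?_
  rcases le_total r 1 with h | h
  · calc 4 * r * (2 * r + 1) * min 1 (2 * r) ≤ 4 * r * (2 * 1 + 1) * (2 * r) := by
          gcongr; exact min_le_right _ _
      _ = _ := by ring
  · calc 4 * r * (2 * r + 1) * min 1 (2 * r) ≤ 4 * r * (2 * r + r) * 1 := by
          gcongr; exact min_le_left _ _
      _ ≤ _ := by nlinarith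

theorem gridStripMeasure_ball_le (x : GridStrip) {r : ℝ} (hr : 0 < r) :
    gridStripMeasure (Metric.ball x r) ≤ ENNReal.ofReal (24 * r ^ 2) :=
  (measure_mono (ball_subset_stripBox x r)).trans (gridStripMeasure_stripBox_le x hr)

theorem le_gridStripMeasure_ball (x : GridStrip) {r : ℝ} (hr : 0 < r) :
    ENNReal.ofReal (24⁻¹ * r ^ 2) ≤ gridStripMeasure (Metric.ball x r) := by
  have h : stripBox x (r / 2) ⊆ Metric.ball x r := by
    simpa [mul_div_cancel₀] using stripBox_subset_ball x (r / 2)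
  refine le_trans ?_ (measure_mono h)
  rw [gridStripMeasure_stripBox]
  refine le_trans ?_ (mul_le_mul' (le_gridMeasure_ball x.fst (half_pos hr))
    (le_volume_Icc_ball x.snd (half_pos hr)))
  rw [← ENNReal.ofReal_mul (by positivity)]
  refine ENNReal.ofReal_le_ofReal ?_
  rcases le_total r 1 with h | h
  · calc 24⁻¹ * r ^ 2 ≤ 2 * (r / 2) * 1 * (r / 2) := by nlinarith
      _ ≤ 2 * (r / 2) * max 1 (r / 2) * min (r / 2) (1 / 2) := by
        rw [min_eq_left (by linarith)]
        gcongr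
        exact le_max_left _ _
  · calc 24⁻¹ * r ^ 2 ≤ 2 * (r / 2) * (r / 2) * (1 / 2) := by nlinarith
      _ ≤ 2 * (r / 2) * max 1 (r / 2) * min (r / 2) (1 / 2) := by
        rw [min_eq_right (by linarith)]
        gcongr
        exact le_max_right _ _

theorem gridStripMeasure_isAhlforsRegular : IsAhlforsRegular 2 gridStripMeasure :=
  ⟨24, by norm_num, fun x r hr _ =>
    ⟨by exact_mod_cast le_gridStripMeasure_ball x hr,
      by exact_mod_cast gridStripMeasure_ball_le x hr⟩⟩

/-- The constant is the upper Ahlfors bound at `2 r` divided by the lower bound at `r`. -/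
theorem gridStripMeasure_isDoubling : IsDoubling gridStripMeasure := by
  refine ⟨24 * 4 * 24, by norm_num, fun x r hr => ?_⟩
  refine (gridStripMeasure_ball_le x (by positivity)).trans ?_
  refine le_trans (le_of_eq ?_) (mul_le_mul_right (le_gridStripMeasure_ball x hr) _)
  rw [← ENNReal.ofReal_mul (by norm_num)]
  congr 1
  ring

theorem isClosed_gridSet : IsClosed gridSet := by
  have h1 : IsClosed {x : ℝ | ∃ n : ℤ, x = n} := by
    have : {x : ℝ | ∃ n : ℤ, x = n} = Set.range ((↑) : ℤ → ℝ) := by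
      ext x; simp [eq_comm]
    rw [this]
    exact Int.isClosedEmbedding_coe_real.isClosed_range
  exact (h1.preimage continuous_fst).union (h1.preimage continuous_snd)

instance : CompleteSpace Grid := isClosed_gridSet.completeSpace_coe

theorem gridStripMeasure_isMetricMeasureSpace : IsMetricMeasureSpace gridStripMeasure where
  complete := inferInstance
  separable := inferInstance
  boundedly_finite s hs := by
    let x : GridStrip := WithLp.toLp 2 (row 0 0, ⟨0, by simp⟩)
    obtain ⟨r, hr, hs⟩ := hs.subset_ball_lt 0 x
    exact (measure_mono hs).trans_lt ((gridStripMeasure_ball_le x hr).trans_lt ENNReal.ofReal_lt_top)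

theorem gridStripMeasure_ball_pos (x : GridStrip) {r : ℝ} (hr : 0 < r) :
    0 < gridStripMeasure (Metric.ball x r) :=
  lt_of_lt_of_le (by simp; positivity) (le_gridStripMeasure_ball x hr)

theorem gridStripMeasure_ball_ne_top (x : GridStrip) (r : ℝ) :
    gridStripMeasure (Metric.ball x r) ≠ ∞ :=
  (gridStripMeasure_isMetricMeasureSpace.boundedly_finite _ Metric.isBounded_ball).ne

theorem mem_support_gridStripMeasure (x : GridStrip) : x ∈ gridStripMeasure.support := by
  rw [Metric.nhds_basis_ball.mem_measureSupport]
  exact fun r hr => gridStripMeasure_ball_pos x hr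

theorem lipschitz_chart {c : Grid → ℝ} (hc : ∀ a b, |c a - c b| ≤ dist a b) :
    LipschitzWith 1 fun x : GridStrip => (c x.fst, (x.snd : ℝ)) :=
  LipschitzWith.of_dist_le_mul fun x y => by
    rw [NNReal.coe_one, one_mul, Prod.dist_eq]
    exact max_le ((hc _ _).trans (dist_fst_le x y)) (dist_snd_le x y)

theorem quasiMeasurePreserving_flat : Measure.QuasiMeasurePreserving
    (fun p : (ℝ × ℝ) × Set.Icc (0 : ℝ) 1 => (p.1.1, (p.2 : ℝ))) volume volume := by
  have h2 : Measure.QuasiMeasurePreserving (Prod.fst : ℝ × ℝ → ℝ) volume volume :=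
    Measure.quasiMeasurePreserving_fst
  have h3 : Measure.QuasiMeasurePreserving (Subtype.val : Set.Icc (0 : ℝ) 1 → ℝ)
      volume volume := by
    refine ⟨measurable_subtype_coe, ?_⟩
    rw [Measure.Subtype.volume_def, map_comap_subtype_coe measurableSet_Icc]
    exact Measure.restrict_le_self.absolutelyContinuous
  exact QuasiMeasurePreserving.prodMap h2 h3

/-- The projection `(c, t)` to the plane is 1-Lipschitz, so it sends `ℋ²`-null sets to Lebesgue-null
sets. Preceded by the parametrization it only drops a coordinate, and preimages of null sets under
that are null. -/
theorem map_strip_absolutelyContinuous {φ : ℝ × ℝ → Grid} (hφ : Measurable φ) {c : Grid → ℝ}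
    (hc : ∀ a b, |c a - c b| ≤ dist a b) (hφc : ∀ p, c (φ p) = p.1) :
    (volume : Measure ((ℝ × ℝ) × Set.Icc (0 : ℝ) 1)).map (fun p => WithLp.toLp 2 (φ p.1, p.2)) ≪
      (Measure.hausdorffMeasure 2 : Measure GridStrip) := by
  have hm : Measurable fun p : (ℝ × ℝ) × Set.Icc (0 : ℝ) 1 =>
      (WithLp.toLp 2 (φ p.1, p.2) : GridStrip) :=
    (WithLp.measurable_toLp 2 _).comp ((hφ.comp measurable_fst).prodMk measurable_snd)
  refine Measure.AbsolutelyContinuous.mk fun A hA h0 => ?_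
  rw [Measure.map_apply hm hA]
  set σ : GridStrip → ℝ × ℝ := fun x => (c x.fst, (x.snd : ℝ)) with hσ
  have h1 : volume (σ '' A) = 0 := by
    rw [← hausdorffMeasure_prod_real]
    refine le_antisymm (((lipschitz_chart hc).hausdorffMeasure_image_le (by norm_num) A).trans ?_)
      bot_le
    simp [h0]
  obtain ⟨N, hAN, hN, hN0⟩ := exists_measurable_superset_of_null h1
  refine measure_mono_null ?_ (quasiMeasurePreserving_flat.preimage_null hN0)
  intro p hp
  refine hAN ⟨_, hp, ?_⟩
  simp [hσ, hφc]

theorem gridStripMeasure_absolutelyContinuous :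
    gridStripMeasure ≪ (Measure.hausdorffMeasure 2 : Measure GridStrip) := by
  rw [gridStripMeasure_eq]
  refine Measure.AbsolutelyContinuous.add_left ?_ ?_
  · exact map_strip_absolutelyContinuous measurable_rowMap (c := fun a => a.1.1)
      (fun a b => le_max_left _ _) (fun p => rfl)
  · exact map_strip_absolutelyContinuous measurable_colMap (c := fun a => a.1.2)
      (fun a b => le_max_right _ _) (fun p => rfl)

theorem isChart_of_isometric {U : Set GridStrip} (hU : MeasurableSet U) {c : Grid → ℝ}
    (hc : ∀ x ∈ U, ∀ y ∈ U, |c x.fst - c y.fst| = dist x.fst y.fst) :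
    IsChart gridStripMeasure 2 U fun x => !₂[c x.1.fst, (x.1.snd : ℝ)] := by
  have h : Isometry fun x : U => (!₂[c x.1.fst, (x.1.snd : ℝ)] : EuclideanSpace ℝ (Fin 2)) := by
    refine Isometry.of_dist_eq fun x y => ?_
    rw [EuclideanSpace.dist_eq, Fin.sum_univ_two, Subtype.dist_eq, dist_strip,
      ← hc x x.2 y y.2]
    simp [Real.dist_eq, Subtype.dist_eq]
  refine ⟨hU, ?_, ⟨1, h.lipschitz⟩, ⟨1, h.antilipschitz⟩⟩
  exact Measure.restrict_le_self.absolutelyContinuous.trans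
    (by exact_mod_cast gridStripMeasure_absolutelyContinuous)

/-- The charts are isometric: one for the strip over each row, and one for the strip over each
column with the rows removed, which makes the domains disjoint. They cover the whole space. -/
theorem gridStripMeasure_isRectifiable : IsRectifiable gridStripMeasure := by
  have hrow : ∀ n, MeasurableSet (Set.range (row n)) := fun n =>
    (isometry_row n).isClosedEmbedding.isClosed_range.measurableSet
  have hcol : ∀ n, MeasurableSet (Set.range (col n)) := fun n =>
    (isometry_col n).isClosedEmbedding.isClosed_range.measurableSet
  have hR : MeasurableSet (⋃ n, Set.range (row n)) := MeasurableSet.iUnion hrow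
  let V : ℤ ⊕ ℤ → Set GridStrip := Sum.elim (fun n => {x | x.fst ∈ Set.range (row n)})
    (fun n => {x | x.fst ∈ Set.range (col n) \ ⋃ n, Set.range (row n)})
  let c : ℤ ⊕ ℤ → Grid → ℝ := Sum.elim (fun _ a => a.1.1) (fun _ a => a.1.2)
  have hV : ∀ i, IsChart gridStripMeasure 2 (V i)
      fun x => !₂[c i x.1.fst, (x.1.snd : ℝ)] := by
    rintro (n | n)
    · refine isChart_of_isometric (measurable_strip_fst (hrow n)) ?_
      rintro x ⟨u, hu⟩ y ⟨v, hv⟩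
      simp only at hu hv
      rw [← hu, ← hv, (isometry_row n).dist_eq]
      rfl
    · refine isChart_of_isometric (measurable_strip_fst ((hcol n).diff hR)) ?_
      rintro x ⟨⟨u, hu⟩, -⟩ y ⟨⟨v, hv⟩, -⟩
      simp only at hu hv
      rw [← hu, ← hv, (isometry_col n).dist_eq]
      rfl
  have hdisj : Pairwise (Function.onFun Disjoint V) := by
    rintro (m | m) (n | n) hmn <;> refine Set.disjoint_left.2 ?_
    · rintro x ⟨u, hu⟩ ⟨v, hv⟩
      have h1 : (m : ℝ) = n := (congrArg (fun a : Grid => a.1.2) (hu.trans hv.symm) :)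
      exact hmn (congrArg _ (by exact_mod_cast h1))
    · rintro x hx ⟨-, hx'⟩
      exact hx' (Set.mem_iUnion.2 ⟨m, hx⟩)
    · rintro x ⟨-, hx'⟩ hx
      exact hx' (Set.mem_iUnion.2 ⟨n, hx⟩)
    · rintro x ⟨⟨u, hu⟩, -⟩ ⟨⟨v, hv⟩, -⟩
      have h1 : (m : ℝ) = n := (congrArg (fun a : Grid => a.1.1) (hu.trans hv.symm) :)
      exact hmn (congrArg _ (by exact_mod_cast h1))
  have huniv : ⋃ i, V i = Set.univ := by
    refine Set.eq_univ_of_forall fun x => ?_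
    by_cases hx : x.fst ∈ ⋃ n, Set.range (row n)
    · obtain ⟨n, hn⟩ := Set.mem_iUnion.1 hx
      exact Set.mem_iUnion.2 ⟨Sum.inl n, hn⟩
    · rcases hxg : x.fst with ⟨⟨a, b⟩, ⟨n, hn⟩ | ⟨n, hn⟩⟩
      · refine Set.mem_iUnion.2 ⟨Sum.inr n, ⟨b, ?_⟩, hx⟩
        rw [hxg]
        exact Subtype.ext (Prod.ext hn.symm rfl)
      · refine (hx (Set.mem_iUnion.2 ⟨n, a, ?_⟩)).elim
        rw [hxg]
        exact Subtype.ext (Prod.ext rfl hn.symm)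
  let e : ℕ ≃ ℤ ⊕ ℤ := (Denumerable.eqv (ℤ ⊕ ℤ)).symm
  refine ⟨fun _ => 2, fun i => V (e i), fun i x => !₂[c (e i) x.1.fst, (x.1.snd : ℝ)],
    fun i => hV (e i), fun i j hij => hdisj (e.injective.ne hij), ?_⟩
  rw [e.surjective.iUnion_comp V, huniv]
  simp

end GridGeometry

/-! ### The energy of the grid strip is quadratic -/

section Differentiable

variable {E : Type*} [NormedAddCommGroup E] [NormedSpace ℝ E]

theorem enorm_fderiv_le_lipSlope {f : E → ℝ} {x : E} (h : DifferentiableAt ℝ f x) :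
    ‖fderiv ℝ f x‖ₑ ≤ lipSlope f x := by
  refine le_of_forall_gt fun c hc => ?_
  obtain ⟨c', hc', hc'c⟩ := exists_between hc
  refine lt_of_le_of_lt ?_ hc'c
  lift c' to ℝ≥0 using ne_top_of_lt hc'c
  have h1 : ‖fderiv ℝ f x‖ ≤ c' := by
    refine h.hasFDerivAt.le_of_lip' c'.2 ?_
    filter_upwards [eventually_of_lipSlope_lt hc'] with y hy
    rw [edist_eq_enorm_sub, edist_eq_enorm_sub, enorm_eq_nnnorm, enorm_eq_nnnorm] at hy
    have h2 : ‖f y - f x‖₊ ≤ c' * ‖y - x‖₊ := by exact_mod_cast hy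
    exact_mod_cast h2
  have h3 : ‖fderiv ℝ f x‖₊ ≤ c' := h1
  exact_mod_cast h3

/-- Valid for every norm: the slope is the dual norm of the differential. With the Euclidean norm it
yields the parallelogram law for the strip, and with the sup norm its failure for the cone. -/
theorem lipSlope_eq_enorm_fderiv {f : E → ℝ} {x : E} (h : DifferentiableAt ℝ f x) :
    lipSlope f x = ‖fderiv ℝ f x‖ₑ := by
  refine le_antisymm ?_ (enorm_fderiv_le_lipSlope h)
  refine ENNReal.le_of_forall_pos_le_add fun ε hε _ => lipSlope_le_of_eventually ?_
  filter_upwards [h.hasFDerivAt.isLittleO.def (c := ε) hε] with y hy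
  have h1 : ‖f y - f x‖ ≤ (‖fderiv ℝ f x‖ + ε) * ‖y - x‖ := by
    calc ‖f y - f x‖ = ‖(f y - f x - fderiv ℝ f x (y - x)) + fderiv ℝ f x (y - x)‖ := by
          congr 1; ring
      _ ≤ ε * ‖y - x‖ + ‖fderiv ℝ f x‖ * ‖y - x‖ :=
        (norm_add_le _ _).trans (add_le_add hy (ContinuousLinearMap.le_opNorm _ _))
      _ = _ := by ring
  have h2 : ‖f y - f x‖₊ ≤ (‖fderiv ℝ f x‖₊ + ε) * ‖y - x‖₊ := by exact_mod_cast h1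
  rw [edist_eq_enorm_sub, edist_eq_enorm_sub, enorm_eq_nnnorm, enorm_eq_nnnorm,
    enorm_eq_nnnorm]
  exact_mod_cast h2

theorem lipSlope_parallelogram {E : Type*} [NormedAddCommGroup E] [InnerProductSpace ℝ E]
    [CompleteSpace E] {f g : E → ℝ} {x : E} (hf : DifferentiableAt ℝ f x)
    (hg : DifferentiableAt ℝ g x) :
    lipSlope (f + g) x ^ 2 + lipSlope (f - g) x ^ 2 =
      2 * lipSlope f x ^ 2 + 2 * lipSlope g x ^ 2 := by
  rw [lipSlope_eq_enorm_fderiv hf, lipSlope_eq_enorm_fderiv hg,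
    lipSlope_eq_enorm_fderiv (hf.add hg), lipSlope_eq_enorm_fderiv (hf.sub hg),
    fderiv_add hf hg, fderiv_sub hf hg]
  generalize fderiv ℝ f x = A
  generalize fderiv ℝ g x = B
  have h := parallelogram_law_with_norm ℝ ((InnerProductSpace.toDual ℝ E).symm A)
    ((InnerProductSpace.toDual ℝ E).symm B)
  rw [← map_add, ← map_sub] at h
  simp only [LinearIsometryEquiv.norm_map] at h
  have h' : ‖A + B‖₊ ^ 2 + ‖A - B‖₊ ^ 2 = 2 * ‖A‖₊ ^ 2 + 2 * ‖B‖₊ ^ 2 := by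
    rw [← NNReal.coe_inj]
    push_cast
    linarith
  simp only [enorm_eq_nnnorm]
  exact_mod_cast h'

end Differentiable

/-! ### Flat strips over the grid lines -/

section Strips

theorem eventually_notMem_range_int {Z : Type*} [TopologicalSpace Z] {c : Z → ℝ} {z : Z}
    (hc : ContinuousAt c z) (h : c z ∉ Set.range ((↑) : ℤ → ℝ)) :
    ∀ᶠ w in 𝓝 z, c w ∉ Set.range ((↑) : ℤ → ℝ) :=
  hc.eventually (Int.isClosedEmbedding_coe_real.isClosed_range.isOpen_compl.mem_nhds h)

/-- Away from the crossings no column comes near, and other rows are at distance at least one, so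
locally the grid is this single line. -/
theorem eventually_eq_row (n : ℤ) {u : ℝ} (hu : u ∉ Set.range ((↑) : ℤ → ℝ)) :
    ∀ᶠ a in 𝓝 (row n u), a = row n a.1.1 := by
  have hc : Continuous fun a : Grid => a.1.1 := continuous_fst.comp continuous_subtype_val
  filter_upwards [eventually_notMem_range_int (hc.continuousAt (x := row n u)) hu,
    Metric.ball_mem_nhds (row n u) one_pos] with a ha hb
  rcases a.2 with ⟨m, hm⟩ | ⟨m, hm⟩
  · exact (ha ⟨m, hm.symm⟩).elim
  · have h1 : |a.1.2 - n| < 1 := (le_max_right _ _).trans_lt hb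
    rw [hm] at h1
    have h2 : |m - n| < 1 := by exact_mod_cast h1
    have h3 : m = n := by rw [Int.abs_lt_one_iff] at h2; omega
    exact Subtype.ext (Prod.ext rfl (by rw [hm, h3]; rfl))

theorem eventually_eq_col (n : ℤ) {u : ℝ} (hu : u ∉ Set.range ((↑) : ℤ → ℝ)) :
    ∀ᶠ a in 𝓝 (col n u), a = col n a.1.2 := by
  have hc : Continuous fun a : Grid => a.1.2 := continuous_snd.comp continuous_subtype_val
  filter_upwards [eventually_notMem_range_int (hc.continuousAt (x := col n u)) hu,
    Metric.ball_mem_nhds (col n u) one_pos] with a ha hb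
  rcases a.2 with ⟨m, hm⟩ | ⟨m, hm⟩
  · have h1 : |a.1.1 - n| < 1 := (le_max_left _ _).trans_lt hb
    rw [hm] at h1
    have h2 : |m - n| < 1 := by exact_mod_cast h1
    have h3 : m = n := by rw [Int.abs_lt_one_iff] at h2; omega
    exact Subtype.ext (Prod.ext (by rw [hm, h3]; rfl) rfl)
  · exact (ha ⟨m, hm.symm⟩).elim

/-- The strip over a line of the grid, extended to the plane by projecting onto `[0,1]`. -/
def planeToStrip (φ : ℝ → Grid) (y : WithLp 2 (ℝ × ℝ)) : GridStrip :=
  WithLp.toLp 2 (φ y.fst, Set.projIcc 0 1 zero_le_one y.snd)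

theorem lipschitz_planeToStrip {φ : ℝ → Grid} (hφ : Isometry φ) :
    LipschitzWith 1 (planeToStrip φ) := LipschitzWith.of_dist_le_mul fun x y => by
  rw [NNReal.coe_one, one_mul, dist_strip, WithLp.prod_dist_eq_of_L2]
  have h2 : dist (planeToStrip φ x).snd (planeToStrip φ y).snd ≤ dist x.snd y.snd := by
    have := (LipschitzWith.projIcc (zero_le_one (α := ℝ))).dist_le_mul x.snd y.snd
    rwa [NNReal.coe_one, one_mul] at this
  have h1 : dist (planeToStrip φ x).fst (planeToStrip φ y).fst = dist x.fst y.fst :=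
    hφ.dist_eq _ _
  rw [h1]
  gcongr

/-- Both `planeToStrip φ` and the coordinate map `σ` are nonexpanding, and near a point off the
crossings `σ` is a right inverse, so the two slope inequalities hold. Projecting onto `[0,1]` makes
the comparison function live on the whole Euclidean plane, so that the boundary of the strip needs
no separate treatment. -/
theorem lipSlope_strip_eq {φ : ℝ → Grid} (hφ : Isometry φ) {c : Grid → ℝ}
    (hc : ∀ a b, |c a - c b| ≤ dist a b) (hcφ : ∀ u, c (φ u) = u) {u : ℝ}
    (hu : ∀ᶠ a in 𝓝 (φ u), a = φ (c a)) (t : Set.Icc (0 : ℝ) 1) (f : GridStrip → ℝ) :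
    lipSlope f (WithLp.toLp 2 (φ u, t)) =
      lipSlope (f ∘ planeToStrip φ) (WithLp.toLp 2 (u, (t : ℝ))) := by
  set y : WithLp 2 (ℝ × ℝ) := WithLp.toLp 2 (u, (t : ℝ)) with hy
  have hxy : planeToStrip φ y = WithLp.toLp 2 (φ u, t) := by
    simp [planeToStrip, hy]
  let σ : GridStrip → WithLp 2 (ℝ × ℝ) := fun x => WithLp.toLp 2 (c x.fst, (x.snd : ℝ))
  have hσ : LipschitzWith 1 σ := LipschitzWith.of_dist_le_mul fun x y => by
    rw [NNReal.coe_one, one_mul, dist_strip, WithLp.prod_dist_eq_of_L2]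
    have h1 : dist (σ x).fst (σ y).fst ≤ dist x.fst y.fst := hc _ _
    have h2 : dist (σ x).snd (σ y).snd = dist x.snd y.snd := rfl
    rw [h2]
    gcongr
  have hσy : σ (planeToStrip φ y) = y := by
    rw [hxy]
    simp [σ, hcφ, hy]
  rw [← hxy]
  refine le_antisymm ?_ (lipSlope_comp_le (Eventually.of_forall fun z => by
    simpa using lipschitz_planeToStrip hφ z y))
  have hcont : Continuous fun x : GridStrip => x.fst :=
    continuous_fst.comp (WithLp.prod_continuous_ofLp 2 _ _)
  have hloc : f =ᶠ[𝓝 (planeToStrip φ y)] (f ∘ planeToStrip φ) ∘ σ := by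
    have h1 : ∀ᶠ x in 𝓝 (planeToStrip φ y), x.fst = φ (c x.fst) := by
      have h2 : (planeToStrip φ y).fst = φ u := by rw [hxy]; rfl
      have h3 := hcont.tendsto (planeToStrip φ y)
      simp only [h2] at h3
      exact h3.eventually hu
    filter_upwards [h1] with x hx
    simp only [Function.comp_apply]
    congr 1
    change x = WithLp.toLp 2 (φ (c x.fst), Set.projIcc 0 1 zero_le_one (x.snd : ℝ))
    rw [← hx, Set.projIcc_val]
    rfl
  rw [lipSlope_congr hloc]
  calc _ ≤ lipSlope (f ∘ planeToStrip φ) (σ (planeToStrip φ y)) :=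
        lipSlope_comp_le (Eventually.of_forall fun z => by simpa using hσ z _)
    _ = _ := by rw [hσy]

/-- Rademacher's theorem is used on `ℝ × ℝ`; differentiability does not see the change to the
Euclidean norm, and the exceptional null set pulls back to a null set of parameters. -/
theorem ae_differentiableAt_planeToStrip {φ : ℝ → Grid} (hφ : Isometry φ) {f : GridStrip → ℝ}
    (hf : IsBddSuppLipschitz f) : ∀ᵐ p : (ℝ × ℝ) × Set.Icc (0 : ℝ) 1,
      DifferentiableAt ℝ (f ∘ planeToStrip φ) (WithLp.toLp 2 (p.1.1, (p.2 : ℝ))) := by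
  obtain ⟨⟨K, hK⟩, -⟩ := hf
  have h1 : LipschitzWith _ ((f ∘ planeToStrip φ) ∘ WithLp.toLp 2) :=
    (hK.comp (lipschitz_planeToStrip hφ)).comp (WithLp.prod_lipschitzWith_toLp 2 ℝ ℝ)
  have h2 := quasiMeasurePreserving_flat.ae (h1.ae_differentiableAt (μ := volume))
  filter_upwards [h2] with p hp
  let e := WithLp.prodContinuousLinearEquiv 2 ℝ ℝ ℝ
  have h3 : f ∘ planeToStrip φ = ((f ∘ planeToStrip φ) ∘ WithLp.toLp 2) ∘ e := rfl
  rw [h3]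
  exact DifferentiableAt.comp _ hp e.differentiableAt

theorem ae_notMem_range_int : ∀ᵐ p : (ℝ × ℝ) × Set.Icc (0 : ℝ) 1,
    p.1.1 ∉ Set.range ((↑) : ℤ → ℝ) := by
  have h : ∀ᵐ x : ℝ, x ∉ Set.range ((↑) : ℤ → ℝ) :=
    measure_eq_zero_iff_ae_notMem.1 ((Set.countable_range _).measure_zero volume)
  have h1 : Measure.QuasiMeasurePreserving (Prod.fst : ℝ × ℝ → ℝ) volume volume :=
    Measure.quasiMeasurePreserving_fst
  exact (h1.comp quasiMeasurePreserving_flat).ae h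

theorem slopeEnergy_gridStrip_parallelogram {u v : GridStrip → ℝ} (hu : IsBddSuppLipschitz u)
    (hv : IsBddSuppLipschitz v) :
    slopeEnergy gridStripMeasure (u + v) + slopeEnergy gridStripMeasure (u - v) =
      2 * slopeEnergy gridStripMeasure u + 2 * slopeEnergy gridStripMeasure v := by
  have hm : ∀ {w : GridStrip → ℝ}, IsBddSuppLipschitz w →
      Measurable fun x => lipSlope w x ^ 2 := fun hw =>
    (measurable_lipSlope hw.continuous).pow_const 2
  have hS : MeasurableSet {x | lipSlope (u + v) x ^ 2 + lipSlope (u - v) x ^ 2 =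
      2 * lipSlope u x ^ 2 + 2 * lipSlope v x ^ 2} :=
    measurableSet_eq_fun ((hm (hu.add hv)).add (hm (hu.sub hv)))
      (((hm hu).const_mul 2).add ((hm hv).const_mul 2))
  have hae : ∀ᵐ x ∂gridStripMeasure, lipSlope (u + v) x ^ 2 + lipSlope (u - v) x ^ 2 =
      2 * lipSlope u x ^ 2 + 2 * lipSlope v x ^ 2 := by
    rw [gridStripMeasure_eq, ae_add_measure_iff, ae_map_iff measurable_rowStrip.aemeasurable hS,
      ae_map_iff measurable_colStrip.aemeasurable hS]
    constructor
    -- The row under consideration depends on the parameter `p`, so differentiability is required on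
    -- all rows simultaneously; there are countably many.
    · filter_upwards [ae_all_iff.2 fun n => ae_differentiableAt_planeToStrip (isometry_row n) hu,
        ae_all_iff.2 fun n => ae_differentiableAt_planeToStrip (isometry_row n) hv,
        ae_notMem_range_int] with p h1 h2 h3
      have key := fun f => lipSlope_strip_eq (isometry_row ⌊p.1.2⌋) (c := fun a => a.1.1)
        (fun a b => le_max_left _ _) (fun u => rfl) (eventually_eq_row ⌊p.1.2⌋ h3) p.2 f
      simp only [rowStrip, rowMap, key]
      exact lipSlope_parallelogram (h1 _) (h2 _)
    · filter_upwards [ae_all_iff.2 fun n => ae_differentiableAt_planeToStrip (isometry_col n) hu,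
        ae_all_iff.2 fun n => ae_differentiableAt_planeToStrip (isometry_col n) hv,
        ae_notMem_range_int] with p h1 h2 h3
      have key := fun f => lipSlope_strip_eq (isometry_col ⌊p.1.2⌋) (c := fun a => a.1.2)
        (fun a b => le_max_right _ _) (fun u => rfl) (eventually_eq_col ⌊p.1.2⌋ h3) p.2 f
      simp only [colStrip, colMap, key]
      exact lipSlope_parallelogram (h1 _) (h2 _)
  unfold slopeEnergy
  rw [← lintegral_add_left (hm (hu.add hv)), lintegral_congr_ae hae,
    lintegral_add_left ((hm hu).const_mul 2), lintegral_const_mul _ (hm hu),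
    lintegral_const_mul _ (hm hv)]

theorem gridStripMeasure_isInfinitesimallyHilbertian :
    IsInfinitesimallyHilbertian gridStripMeasure :=
  isInfinitesimallyHilbertian_of_parallelogram fun _ _ hu hv =>
    (slopeEnergy_gridStrip_parallelogram hu hv).le

end Strips

/-! ### The Poincaré inequality -/

section Line

/-- Lipschitz functions on the line are absolutely continuous, so the fundamental theorem of
calculus applies, and the derivative is bounded by the slope. Order-connectedness keeps the segment
in `J`. -/
theorem enorm_sub_le_lintegral_lipSlope {k : ℝ → ℝ} {K : ℝ≥0} (hk : LipschitzWith K k)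
    {J : Set ℝ} (hJ : J.OrdConnected) {u v : ℝ} (hu : u ∈ J) (hv : v ∈ J) :
    ‖k u - k v‖ₑ ≤ ∫⁻ s in J, lipSlope k s := by
  wlog huv : u ≤ v generalizing u v
  · rw [← enorm_neg, neg_sub]
    exact this hv hu (le_of_not_ge huv)
  have h1 := (hk.lipschitzOnWith (s := Set.uIcc u v)).absolutelyContinuousOnInterval.integral_deriv_eq_sub
  rw [← enorm_neg, neg_sub, ← h1, intervalIntegral.integral_of_le huv]
  refine (enorm_integral_le_lintegral_enorm _).trans ?_
  refine (lintegral_mono_set (Set.Ioc_subset_Icc_self.trans (hJ.out hu hv))).trans ?_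
  refine lintegral_mono fun s => ?_
  by_cases hs : DifferentiableAt ℝ k s
  · refine le_trans (le_of_eq ?_) (enorm_fderiv_le_lipSlope hs)
    rw [← ofReal_norm, ← ofReal_norm, norm_deriv_eq_norm_fderiv]
  · simp [deriv_zero_of_not_differentiableAt hs]

/-- Compare `A p` and `A p'` through every `D q` and integrate over `q`; the two halves are
symmetric. -/
theorem lintegral_triangle {α β : Type*} [MeasurableSpace α] [MeasurableSpace β] {ρ : Measure α}
    {κ : Measure β} [SFinite ρ] [SFinite κ] {A : α → ℝ} {D : β → ℝ} (hA : Measurable A)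
    (hD : Measurable D) :
    κ Set.univ * ∫⁻ p, ∫⁻ p', ‖A p - A p'‖ₑ ∂ρ ∂ρ ≤
      2 * (ρ Set.univ * ∫⁻ p, ∫⁻ q, ‖A p - D q‖ₑ ∂κ ∂ρ) := by
  set I : α → ℝ≥0∞ := fun p => ∫⁻ q, ‖A p - D q‖ₑ ∂κ with hI
  have hIm : Measurable I := Measurable.lintegral_prod_right'
    (f := fun z : α × β => ‖A z.1 - D z.2‖ₑ) (by fun_prop)
  have h1 : ∀ p p', κ Set.univ * ‖A p - A p'‖ₑ ≤ I p + I p' := fun p p' => by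
    rw [hI, ← lintegral_add_left (by fun_prop), mul_comm, ← lintegral_const]
    refine lintegral_mono fun q => ?_
    simp only [← edist_eq_enorm_sub]
    exact edist_triangle_right _ _ _
  have h2 : Measurable fun p => ∫⁻ p', ‖A p - A p'‖ₑ ∂ρ := Measurable.lintegral_prod_right'
    (f := fun z : α × α => ‖A z.1 - A z.2‖ₑ) (by fun_prop)
  calc κ Set.univ * ∫⁻ p, ∫⁻ p', ‖A p - A p'‖ₑ ∂ρ ∂ρ
      = ∫⁻ p, ∫⁻ p', κ Set.univ * ‖A p - A p'‖ₑ ∂ρ ∂ρ := by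
        rw [← lintegral_const_mul _ h2]
        refine lintegral_congr fun p => ?_
        rw [← lintegral_const_mul _ (by fun_prop)]
    _ ≤ ∫⁻ p, ∫⁻ p', (I p + I p') ∂ρ ∂ρ :=
        lintegral_mono fun p => lintegral_mono fun p' => h1 p p'
    _ = _ := by
        have h3 : ∀ p, ∫⁻ p', (I p + I p') ∂ρ = I p * ρ Set.univ + ∫⁻ p', I p' ∂ρ := fun p => by
          rw [lintegral_add_left measurable_const, lintegral_const]
        simp_rw [h3]
        rw [lintegral_add_right _ measurable_const, lintegral_const, lintegral_mul_const _ hIm]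
        ring

end Line

/-! ### Oscillation on balls of the grid -/

section GridPoincare

theorem setLIntegral_box {J K : Set ℝ} {F : ℝ × ℝ → ℝ≥0∞} (hF : Measurable F) :
    ∫⁻ p in J ×ˢ K, F p = ∫⁻ z in K, ∫⁻ s in J, F (s, z) := by
  rw [Measure.volume_eq_prod, ← Measure.prod_restrict, lintegral_prod_symm _ hF.aemeasurable]

theorem setLIntegral_box_snd {J K : Set ℝ} {G : ℝ → ℝ≥0∞} (hG : Measurable G) :
    ∫⁻ p in J ×ˢ K, G p.2 = volume J * ∫⁻ z in K, G z := by
  have hG' : Measurable fun p : ℝ × ℝ => G p.2 := hG.comp measurable_snd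
  rw [setLIntegral_box hG']
  simp only [lintegral_const, Measure.restrict_apply_univ]
  rw [lintegral_mul_const _ hG, mul_comm]

theorem setLIntegral_grid_ball {F : Grid → ℝ≥0∞} (hF : Measurable F) (a : Grid) (r : ℝ) :
    ∫⁻ x in Metric.ball a r, F x ∂gridMeasure =
      (∫⁻ p in Metric.ball a.1.1 r ×ˢ floorBall a.1.2 r, F (rowMap p)) +
        ∫⁻ p in Metric.ball a.1.2 r ×ˢ floorBall a.1.1 r, F (colMap p) := by
  rw [gridMeasure_eq, Measure.restrict_add, lintegral_add_measure,
    Measure.restrict_map measurable_rowMap measurableSet_ball,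
    Measure.restrict_map measurable_colMap measurableSet_ball, rowMap_preimage_ball,
    colMap_preimage_ball, lintegral_map hF measurable_rowMap, lintegral_map hF measurable_colMap]

variable {h : Grid → ℝ} {K : ℝ≥0}

theorem enorm_sub_line_le (hh : LipschitzWith K h) {φ : ℝ → Grid} (hφ : Isometry φ) {c r : ℝ}
    {u v : ℝ} (hu : u ∈ Metric.ball c r) (hv : v ∈ Metric.ball c r) :
    ‖h (φ u) - h (φ v)‖ₑ ≤ ∫⁻ s in Metric.ball c r, lipSlope h (φ s) := by
  have h1 : (Metric.ball c r).OrdConnected := by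
    rw [Real.ball_eq_Ioo]; exact Set.ordConnected_Ioo
  refine (enorm_sub_le_lintegral_lipSlope (hh.comp hφ.lipschitz) h1 hu hv).trans ?_
  exact lintegral_mono fun s => lipSlope_comp_le (Eventually.of_forall fun y => (hφ y s).le)

theorem measurable_line_integral (hh : LipschitzWith K h) {φ : ℝ × ℝ → Grid} (hφ : Measurable φ)
    (J : Set ℝ) : Measurable fun z : ℝ => ∫⁻ s in J, lipSlope h (φ (s, z)) :=
  ((measurable_lipSlope hh.continuous).comp hφ).lintegral_prod_left'

/-- Oscillation between the horizontal and the vertical segments in a ball of the grid. -/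
theorem lintegral_row_col_le (hh : LipschitzWith K h) (a : Grid) (r : ℝ) :
    ∫⁻ p in Metric.ball a.1.1 r ×ˢ floorBall a.1.2 r,
      ∫⁻ q in Metric.ball a.1.2 r ×ˢ floorBall a.1.1 r, ‖h (rowMap p) - h (colMap q)‖ₑ ≤
    ENNReal.ofReal (2 * r) * gridMeasure (Metric.ball a r) *
      ∫⁻ x in Metric.ball a r, lipSlope h x ∂gridMeasure := by
  set J₁ := Metric.ball a.1.1 r
  set J₂ := Metric.ball a.1.2 r
  set K₁ := floorBall a.1.1 r
  set K₂ := floorBall a.1.2 r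
  set G₁ : ℝ → ℝ≥0∞ := fun z => ∫⁻ s in J₁, lipSlope h (rowMap (s, z))
  set G₂ : ℝ → ℝ≥0∞ := fun z => ∫⁻ s in J₂, lipSlope h (colMap (s, z))
  have hG₁ : Measurable G₁ := measurable_line_integral hh measurable_rowMap J₁
  have hG₂ : Measurable G₂ := measurable_line_integral hh measurable_colMap J₂
  have hg := measurable_lipSlope hh.continuous
  have hbox : ∀ c c' : ℝ, MeasurableSet (Metric.ball c r ×ˢ floorBall c' r) := fun c c' =>
    measurableSet_ball.prod (measurableSet_floorBall c' r)
  have h1 : ∀ p ∈ J₁ ×ˢ K₂, ∀ q ∈ J₂ ×ˢ K₁,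
      ‖h (rowMap p) - h (colMap q)‖ₑ ≤ G₁ p.2 + G₂ q.2 := by
    rintro p ⟨hp1, hp2⟩ q ⟨hq1, hq2⟩
    -- The crossing of the row through `p` and the column through `q`. It lies in the ball because
    -- `hp2` and `hq2` bound its coordinates, so the path through it never leaves the ball.
    have e1 : row ⌊p.2⌋ (⌊q.2⌋ : ℝ) = col ⌊q.2⌋ (⌊p.2⌋ : ℝ) := rfl
    have h2 := enorm_sub_line_le hh (isometry_row ⌊p.2⌋) (c := a.1.1) (r := r) hp1
      (v := (⌊q.2⌋ : ℝ)) hq2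
    have h3 := enorm_sub_line_le hh (isometry_col ⌊q.2⌋) (c := a.1.2) (r := r) 
      (u := (⌊p.2⌋ : ℝ)) hp2 hq1
    rw [e1] at h2
    refine le_trans ?_ (add_le_add h2 h3)
    simp only [← edist_eq_enorm_sub]
    exact edist_triangle _ _ _
  have hS : ∫⁻ x in Metric.ball a r, lipSlope h x ∂gridMeasure =
      (∫⁻ z in K₂, G₁ z) + ∫⁻ z in K₁, G₂ z := by
    have e1 : Measurable fun p => lipSlope h (rowMap p) := hg.comp measurable_rowMap
    have e2 : Measurable fun p => lipSlope h (colMap p) := hg.comp measurable_colMap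
    rw [setLIntegral_grid_ball hg, setLIntegral_box e1, setLIntegral_box e2]
  have hJ₁ : volume J₁ = ENNReal.ofReal (2 * r) := Real.volume_ball _ _
  have hJ₂ : volume J₂ = ENNReal.ofReal (2 * r) := Real.volume_ball _ _
  calc _ ≤ ∫⁻ p in J₁ ×ˢ K₂, ∫⁻ q in J₂ ×ˢ K₁, (G₁ p.2 + G₂ q.2) :=
        setLIntegral_mono' (hbox _ _) fun p hp => setLIntegral_mono' (hbox _ _) fun q hq =>
          h1 p hp q hq
    _ = ENNReal.ofReal (2 * r) * ENNReal.ofReal (2 * r) *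
        (volume K₁ * (∫⁻ z in K₂, G₁ z) + volume K₂ * ∫⁻ z in K₁, G₂ z) := by
      have h2 : ∀ p : ℝ × ℝ, ∫⁻ q in J₂ ×ˢ K₁, (G₁ p.2 + G₂ q.2) =
          volume (J₂ ×ˢ K₁) * G₁ p.2 + ∫⁻ q in J₂ ×ˢ K₁, G₂ q.2 := fun p => by
        rw [lintegral_add_left measurable_const, lintegral_const, Measure.restrict_apply_univ,
          mul_comm]
      simp_rw [h2]
      have hG₁' : Measurable fun p : ℝ × ℝ => G₁ p.2 := hG₁.comp measurable_snd
      rw [lintegral_add_right _ measurable_const, lintegral_const, Measure.restrict_apply_univ,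
        lintegral_const_mul _ hG₁', setLIntegral_box_snd hG₁,
        setLIntegral_box_snd hG₂, Measure.volume_eq_prod, Measure.prod_prod, Measure.prod_prod,
        hJ₁, hJ₂]
      ring
    _ ≤ ENNReal.ofReal (2 * r) * ENNReal.ofReal (2 * r) *
        ((volume K₁ + volume K₂) * ((∫⁻ z in K₂, G₁ z) + ∫⁻ z in K₁, G₂ z)) := by
      gcongr
      rw [mul_add]
      gcongr
      · exact le_self_add
      · exact le_add_self
    _ = _ := by
      rw [hS, gridMeasure_ball]
      ring

/-- Rows and columns in a ball are comparable in number once the second family is nonempty: for `r ≤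
1` compare 3 with 1, and for `r ≥ 1` compare `2 r + 1` with `2 r - 1`. -/
theorem volume_floorBall_le_three_mul {c c' r : ℝ} (n : ℤ) (hn : |(n : ℝ) - c'| < r) :
    volume (floorBall c r) ≤ 3 * volume (floorBall c' r) := by
  refine (volume_floorBall_le c r).trans ?_
  rcases le_total r 1 with h1 | h1
  · calc ENNReal.ofReal (2 * r + 1) ≤ ENNReal.ofReal 3 := ENNReal.ofReal_le_ofReal (by linarith)
      _ = 3 * 1 := by simp
      _ ≤ _ := by gcongr; exact one_le_volume_floorBall n hn
  · calc ENNReal.ofReal (2 * r + 1) ≤ ENNReal.ofReal (3 * (2 * r - 1)) :=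
          ENNReal.ofReal_le_ofReal (by linarith)
      _ = 3 * ENNReal.ofReal (2 * r - 1) := by
          rw [ENNReal.ofReal_mul (by norm_num)]; simp
      _ ≤ _ := by gcongr; exact le_volume_floorBall c' r

theorem volume_floorBall_ne_top (c r : ℝ) : volume (floorBall c r) ≠ ∞ :=
  ((volume_floorBall_le c r).trans_lt ENNReal.ofReal_lt_top).ne

/-- Oscillation along the lines in one direction, through the lines in the other direction. -/
theorem lintegral_same_le {A D : ℝ × ℝ → ℝ} (hA : Measurable A) (hD : Measurable D) (c c' : ℝ)
    {r : ℝ} (hr : 0 < r) (n : ℤ) (hn : |(n : ℝ) - c| < r) :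
    ∫⁻ p in Metric.ball c r ×ˢ floorBall c' r, ∫⁻ p' in Metric.ball c r ×ˢ floorBall c' r,
      ‖A p - A p'‖ₑ ≤
    6 * ∫⁻ p in Metric.ball c r ×ˢ floorBall c' r,
      ∫⁻ q in Metric.ball c' r ×ˢ floorBall c r, ‖A p - D q‖ₑ := by
  have h1 := lintegral_triangle (ρ := volume.restrict (Metric.ball c r ×ˢ floorBall c' r))
    (κ := volume.restrict (Metric.ball c' r ×ˢ floorBall c r)) hA hD
  simp only [Measure.restrict_apply_univ] at h1
  set X := ∫⁻ p in Metric.ball c r ×ˢ floorBall c' r,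
    ∫⁻ p' in Metric.ball c r ×ˢ floorBall c' r, ‖A p - A p'‖ₑ
  set Z := ∫⁻ p in Metric.ball c r ×ˢ floorBall c' r,
      ∫⁻ q in Metric.ball c' r ×ˢ floorBall c r, ‖A p - D q‖ₑ
  rw [Measure.volume_eq_prod, Measure.prod_prod, Measure.prod_prod, Real.volume_ball,
    Real.volume_ball] at h1
  have hk0 : volume (floorBall c r) ≠ 0 :=
    (zero_lt_one.trans_le (one_le_volume_floorBall n hn)).ne'
  have hJ0 : ENNReal.ofReal (2 * r) ≠ 0 := by simpa using hr
  refine (ENNReal.mul_le_mul_iff_right (mul_ne_zero hJ0 hk0)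
    (ENNReal.mul_ne_top ENNReal.ofReal_ne_top (volume_floorBall_ne_top c r))).1 (h1.trans ?_)
  calc 2 * (ENNReal.ofReal (2 * r) * volume (floorBall c' r) * Z)
      ≤ 2 * (ENNReal.ofReal (2 * r) * (3 * volume (floorBall c r)) * Z) := by
        gcongr
        exact volume_floorBall_le_three_mul n hn
    _ = _ := by ring

/-- At radius at most `1 / 2` an open ball meets at most one line of a given direction, so any two
points are joined along it. -/
theorem lintegral_single_line_le (hh : LipschitzWith K h) {L : ℤ → ℝ → Grid}
    (hL : ∀ n, Isometry (L n)) (hLm : Measurable fun p : ℝ × ℝ => L ⌊p.2⌋ p.1) (c c' r : ℝ)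
    (hr : r ≤ 1 / 2) :
    ∫⁻ p in Metric.ball c r ×ˢ floorBall c' r, ∫⁻ p' in Metric.ball c r ×ˢ floorBall c' r,
      ‖h (L ⌊p.2⌋ p.1) - h (L ⌊p'.2⌋ p'.1)‖ₑ ≤
    ENNReal.ofReal (2 * r) * volume (Metric.ball c r ×ˢ floorBall c' r) *
      ∫⁻ p in Metric.ball c r ×ˢ floorBall c' r, lipSlope h (L ⌊p.2⌋ p.1) := by
  have hg := measurable_lipSlope hh.continuous
  set G : ℝ → ℝ≥0∞ := fun z => ∫⁻ s in Metric.ball c r, lipSlope h (L ⌊z⌋ s) 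
  have hG : Measurable G := measurable_line_integral hh hLm _
  have hbox : MeasurableSet (Metric.ball c r ×ˢ floorBall c' r) :=
    measurableSet_ball.prod (measurableSet_floorBall c' r)
  calc _ ≤ ∫⁻ p in Metric.ball c r ×ˢ floorBall c' r,
        ∫⁻ p' in Metric.ball c r ×ˢ floorBall c' r, G p.2 := by
        refine setLIntegral_mono' hbox fun p hp => setLIntegral_mono' hbox fun q hq => ?_
        have h1 : |(⌊p.2⌋ : ℝ) - c'| < r := hp.2
        have h2 : |(⌊q.2⌋ : ℝ) - c'| < r := hq.2
        have h3 : ⌊q.2⌋ = ⌊p.2⌋ := by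
          have h4 : |((⌊q.2⌋ - ⌊p.2⌋ : ℤ) : ℝ)| < 1 := by
            rw [abs_lt] at *
            push_cast
            constructor <;> linarith
          have h5 : |⌊q.2⌋ - ⌊p.2⌋| < 1 := by exact_mod_cast h4
          rw [Int.abs_lt_one_iff] at h5
          omega
        rw [h3]
        exact enorm_sub_line_le hh (hL _) hp.1 hq.1
    _ = _ := by
      simp only [lintegral_const, Measure.restrict_apply_univ]
      have hG' : Measurable fun p : ℝ × ℝ => G p.2 := hG.comp measurable_snd
      have hgL : Measurable fun p : ℝ × ℝ => lipSlope h (L ⌊p.2⌋ p.1) := hg.comp hLm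
      rw [lintegral_mul_const _ hG', setLIntegral_box_snd hG, setLIntegral_box hgL,
        Real.volume_ball]
      ring

/-- Splitting into rows and columns gives four double integrals: two mixed ones equal to `Z`, and
two pure ones bounded by `6 Z`, in total `14 Z`. If one direction is absent, the ball is so small
that it contains a single segment. -/
theorem grid_poincare (hh : LipschitzWith K h) (a : Grid) {r : ℝ} (hr : 0 < r) :
    ∫⁻ x in Metric.ball a r, ∫⁻ y in Metric.ball a r, ‖h x - h y‖ₑ ∂gridMeasure ∂gridMeasure ≤
      14 * (ENNReal.ofReal (2 * r) * gridMeasure (Metric.ball a r) *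
        ∫⁻ x in Metric.ball a r, lipSlope h x ∂gridMeasure) := by
  have hc := hh.continuous.measurable
  have hg := measurable_lipSlope hh.continuous
  have hm : ∀ x, Measurable fun y => ‖h x - h y‖ₑ := fun x => by fun_prop
  have hm2 : Measurable fun x => ∫⁻ y in Metric.ball a r, ‖h x - h y‖ₑ ∂gridMeasure :=
    Measurable.lintegral_prod_right' (f := fun z : Grid × Grid => ‖h z.1 - h z.2‖ₑ)
      (by fun_prop)
  have hr' : Measurable fun p => h (rowMap p) := hc.comp measurable_rowMap
  have hc' : Measurable fun p => h (colMap p) := hc.comp measurable_colMap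
  rw [setLIntegral_grid_ball hm2]
  simp_rw [setLIntegral_grid_ball (hm _)]
  by_cases h1 : ∃ n : ℤ, |(n : ℝ) - a.1.1| < r
  · by_cases h2 : ∃ n : ℤ, |(n : ℝ) - a.1.2| < r
    · obtain ⟨m, hm⟩ := h1
      obtain ⟨n, hn⟩ := h2
      have e1 := lintegral_same_le hr' hc' a.1.1 a.1.2 hr m hm
      have e2 := lintegral_same_le hc' hr' a.1.2 a.1.1 hr n hn
      have e3 := lintegral_row_col_le hh a r
      have e4 : ∫⁻ q in Metric.ball a.1.2 r ×ˢ floorBall a.1.1 r,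
          ∫⁻ p in Metric.ball a.1.1 r ×ˢ floorBall a.1.2 r, ‖h (colMap q) - h (rowMap p)‖ₑ =
          ∫⁻ p in Metric.ball a.1.1 r ×ˢ floorBall a.1.2 r,
          ∫⁻ q in Metric.ball a.1.2 r ×ˢ floorBall a.1.1 r, ‖h (rowMap p) - h (colMap q)‖ₑ := by
        rw [lintegral_lintegral_swap (Measurable.aemeasurable (by fun_prop))]
        simp_rw [← edist_eq_enorm_sub, edist_comm]
      rw [lintegral_add_left (Measurable.lintegral_prod_right'
          (f := fun z : (ℝ × ℝ) × (ℝ × ℝ) => ‖h (rowMap z.1) - h (rowMap z.2)‖ₑ) (by fun_prop)),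
        lintegral_add_left (Measurable.lintegral_prod_right'
          (f := fun z : (ℝ × ℝ) × (ℝ × ℝ) => ‖h (colMap z.1) - h (rowMap z.2)‖ₑ) (by fun_prop)),
        e4]
      rw [e4] at e2
      set Z := ∫⁻ p in Metric.ball a.1.1 r ×ˢ floorBall a.1.2 r,
          ∫⁻ q in Metric.ball a.1.2 r ×ˢ floorBall a.1.1 r, ‖h (rowMap p) - h (colMap q)‖ₑ
      calc _ ≤ 6 * Z + Z + (Z + 6 * Z) := by gcongr
        _ = 14 * Z := by ring
        _ ≤ _ := by gcongr
    · have hK : floorBall a.1.2 r = ∅ := by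
        ext z
        simpa [floorBall] using not_lt.1 fun h => h2 ⟨⌊z⌋, h⟩
      have hr2 : r ≤ 1 / 2 := by
        have := le_volume_floorBall a.1.2 r
        rw [hK, measure_empty, nonpos_iff_eq_zero, ENNReal.ofReal_eq_zero] at this
        linarith
      have e1 := lintegral_single_line_le hh isometry_col measurable_colMap a.1.2 a.1.1 r hr2
      rw [gridMeasure_ball, setLIntegral_grid_ball hg]
      simp only [hK, Set.prod_empty, Measure.restrict_empty, lintegral_zero_measure, zero_add,
        measure_empty, add_zero] at e1 ⊢
      refine e1.trans ?_
      rw [Measure.volume_eq_prod, Measure.prod_prod, Real.volume_ball]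
      exact le_mul_of_one_le_left bot_le (by norm_num)
  · have hK : floorBall a.1.1 r = ∅ := by
      ext z
      simpa [floorBall] using not_lt.1 fun h => h1 ⟨⌊z⌋, h⟩
    have hr2 : r ≤ 1 / 2 := by
      have := le_volume_floorBall a.1.1 r
      rw [hK, measure_empty, nonpos_iff_eq_zero, ENNReal.ofReal_eq_zero] at this
      linarith
    have e1 := lintegral_single_line_le hh isometry_row measurable_rowMap a.1.1 a.1.2 r hr2
    rw [gridMeasure_ball, setLIntegral_grid_ball hg]
    simp only [hK, Set.prod_empty, Measure.restrict_empty, lintegral_zero_measure, zero_add,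
      measure_empty, add_zero] at e1 ⊢
    refine e1.trans ?_
    rw [Measure.volume_eq_prod, Measure.prod_prod, Real.volume_ball]
    exact le_mul_of_one_le_left bot_le (by norm_num)

end GridPoincare

/-! ### Oscillation on boxes of the strip -/

section StripPoincare

theorem setLIntegral_stripBox {F : GridStrip → ℝ≥0∞} (hF : Measurable F) (x : GridStrip) (r : ℝ) :
    ∫⁻ y in stripBox x r, F y ∂gridStripMeasure =
      ∫⁻ a in Metric.ball x.fst r, (∫⁻ t in Metric.ball x.snd r, F (WithLp.toLp 2 (a, t)))
        ∂gridMeasure := by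
  have h1 : (WithLp.toLp 2 : Grid × Set.Icc (0 : ℝ) 1 → GridStrip) ⁻¹' stripBox x r =
      Metric.ball x.fst r ×ˢ Metric.ball x.snd r := rfl
  rw [gridStripMeasure, Measure.restrict_map (WithLp.measurable_toLp 2 _)
    (measurableSet_stripBox x r), lintegral_map hF (WithLp.measurable_toLp 2 _), h1,
    ← Measure.prod_restrict]
  exact lintegral_prod _ (hF.comp (WithLp.measurable_toLp 2 _)).aemeasurable

theorem isometry_strip_fst (t : Set.Icc (0 : ℝ) 1) :
    Isometry fun a : Grid => (WithLp.toLp 2 (a, t) : GridStrip) :=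
  Isometry.of_dist_eq fun a b => by simp [dist_strip]

theorem isometry_strip_snd (a : Grid) :
    Isometry fun t : Set.Icc (0 : ℝ) 1 => (WithLp.toLp 2 (a, t) : GridStrip) :=
  Isometry.of_dist_eq fun s t => by simp [dist_strip]

theorem enorm_sub_interval_le {f : GridStrip → ℝ} {K : ℝ≥0} (hf : LipschitzWith K f) (a : Grid)
    (τ : Set.Icc (0 : ℝ) 1) (r : ℝ) {s t : Set.Icc (0 : ℝ) 1} (hs : s ∈ Metric.ball τ r)
    (ht : t ∈ Metric.ball τ r) :
    ‖f (WithLp.toLp 2 (a, s)) - f (WithLp.toLp 2 (a, t))‖ₑ ≤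
      ∫⁻ w in Metric.ball τ r, lipSlope f (WithLp.toLp 2 (a, w)) := by
  set φ : ℝ → GridStrip := fun w => WithLp.toLp 2 (a, Set.projIcc 0 1 zero_le_one w) with hφ
  have hφ1 : LipschitzWith 1 φ := by
    have := (isometry_strip_snd a).lipschitz.comp
      (LipschitzWith.projIcc (zero_le_one (α := ℝ)))
    rwa [one_mul] at this
  set J : Set ℝ := Subtype.val '' Metric.ball τ r with hJ
  have hJ' : J = Metric.ball (τ : ℝ) r ∩ Set.Icc 0 1 := by
    have : Metric.ball τ r = Subtype.val ⁻¹' Metric.ball (τ : ℝ) r := rfl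
    rw [hJ, this, Set.image_preimage_eq_inter_range, Subtype.range_coe]
  have hJo : J.OrdConnected := by
    rw [hJ', Real.ball_eq_Ioo]
    exact Set.ordConnected_Ioo.inter Set.ordConnected_Icc
  have h1 := enorm_sub_le_lintegral_lipSlope (hf.comp hφ1) hJo (Set.mem_image_of_mem _ hs)
    (Set.mem_image_of_mem _ ht)
  simp only [Function.comp_apply, hφ, Set.projIcc_val] at h1
  refine h1.trans ?_
  have h2 : ∫⁻ w in Metric.ball τ r, lipSlope f (WithLp.toLp 2 (a, w)) =
      ∫⁻ w in J, lipSlope f (φ w) := by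
    rw [hJ, ← setLIntegral_subtype measurableSet_Icc (Metric.ball τ r)
      (fun w => lipSlope f (φ w))]
    simp only [hφ, Set.projIcc_val]
    rfl
  rw [h2]
  exact lintegral_mono fun w => lipSlope_comp_le (Eventually.of_forall fun y => by
    simpa using hφ1 y w)

/-- The constant is `15 · 2`: one unit for moving in the interval factor and 14 for moving in the
grid at a fixed height, each over length `2 r`. -/
theorem stripBox_poincare {f : GridStrip → ℝ} {K : ℝ≥0} (hf : LipschitzWith K f) (x : GridStrip)
    {r : ℝ} (hr : 0 < r) :
    ∫⁻ y in stripBox x r, ∫⁻ z in stripBox x r, ‖f y - f z‖ₑ ∂gridStripMeasure ∂gridStripMeasure ≤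
      ENNReal.ofReal (30 * r) * gridStripMeasure (stripBox x r) *
        ∫⁻ y in stripBox x r, lipSlope f y ∂gridStripMeasure := by
  have hfc := hf.continuous.measurable
  have hg := measurable_lipSlope hf.continuous
  set B := Metric.ball x.fst r with hB
  set I := Metric.ball x.snd r with hI
  have hto : Measurable (WithLp.toLp 2 : Grid × Set.Icc (0 : ℝ) 1 → GridStrip) :=
    WithLp.measurable_toLp 2 _
  set F : Grid × Set.Icc (0 : ℝ) 1 → ℝ := fun p => f (WithLp.toLp 2 p) with hFdef
  have hF : Measurable F := hfc.comp hto
  set g : Grid × Set.Icc (0 : ℝ) 1 → ℝ≥0∞ := fun p => lipSlope f (WithLp.toLp 2 p) with hgdef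
  have hgm : Measurable g := hg.comp hto
  have hnorm : ∀ y, Measurable fun z => ‖f y - f z‖ₑ := fun y => by fun_prop
  have hinner : Measurable fun y => ∫⁻ z in stripBox x r, ‖f y - f z‖ₑ ∂gridStripMeasure := by
    have : SFinite gridStripMeasure := by rw [gridStripMeasure]; infer_instance
    exact Measurable.lintegral_prod_right' (f := fun z : GridStrip × GridStrip => ‖f z.1 - f z.2‖ₑ)
      (by fun_prop)
  rw [setLIntegral_stripBox hinner, setLIntegral_stripBox hg]
  simp_rw [setLIntegral_stripBox (hnorm _)]
  change ∫⁻ a in B, (∫⁻ t in I, ∫⁻ b in B, (∫⁻ s in I, ‖F (a, t) - F (b, s)‖ₑ) ∂gridMeasure)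
    ∂gridMeasure ≤ _ * ∫⁻ a in B, (∫⁻ t in I, g (a, t)) ∂gridMeasure
  set W : Grid → ℝ≥0∞ := fun a => ∫⁻ t in I, g (a, t) with hW
  have hWm : Measurable W := hgm.lintegral_prod_right'
  set S := ∫⁻ a in B, W a ∂gridMeasure with hS
  set V : Grid → ℝ≥0∞ := fun a => ∫⁻ b in B, (∫⁻ s in I, ‖F (a, s) - F (b, s)‖ₑ) ∂gridMeasure with hV
  have hVm : Measurable V := Measurable.lintegral_prod_right'
    (f := fun z : Grid × Grid => ∫⁻ s in I, ‖F (z.1, s) - F (z.2, s)‖ₑ)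
    (Measurable.lintegral_prod_right'
      (f := fun z : (Grid × Grid) × Set.Icc (0 : ℝ) 1 => ‖F (z.1.1, z.2) - F (z.1.2, z.2)‖ₑ)
      (by fun_prop))
  -- The intermediate point is `(a, s)`: first change the height above `a`, then move in the grid at
  -- height `s`.
  have h1 : ∀ a, ∀ t ∈ I, ∫⁻ b in B, (∫⁻ s in I, ‖F (a, t) - F (b, s)‖ₑ) ∂gridMeasure ≤
      gridMeasure B * volume I * W a + V a := fun a t ht => by
    calc _ ≤ ∫⁻ b in B, (∫⁻ s in I, (W a + ‖F (a, s) - F (b, s)‖ₑ)) ∂gridMeasure := by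
          refine lintegral_mono fun b => setLIntegral_mono' measurableSet_ball fun s hs => ?_
          refine le_trans ?_ (add_le_add_left (enorm_sub_interval_le hf a x.snd r ht hs) _)
          simp only [← edist_eq_enorm_sub]
          exact edist_triangle _ _ _
      _ = ∫⁻ b in B, (W a * volume I + ∫⁻ s in I, ‖F (a, s) - F (b, s)‖ₑ) ∂gridMeasure := by
          refine lintegral_congr fun b => ?_
          rw [lintegral_add_left measurable_const, lintegral_const, Measure.restrict_apply_univ]
      _ = _ := by
          rw [lintegral_add_left measurable_const, lintegral_const, Measure.restrict_apply_univ]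
          ring
  have h2 : ∫⁻ a in B, V a ∂gridMeasure ≤
      14 * (ENNReal.ofReal (2 * r) * gridMeasure B * S) := by
    have e1 : ∀ a, V a = ∫⁻ s in I, ∫⁻ b in B, ‖F (a, s) - F (b, s)‖ₑ ∂gridMeasure := fun a =>
      lintegral_lintegral_swap (Measurable.aemeasurable (by fun_prop))
    have e2 : S = ∫⁻ s in I, ∫⁻ a in B, g (a, s) ∂gridMeasure :=
      lintegral_lintegral_swap (Measurable.aemeasurable (by fun_prop))
    simp_rw [e1]
    rw [lintegral_lintegral_swap (Measurable.aemeasurable (Measurable.lintegral_prod_right'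
      (f := fun z : (Grid × Set.Icc (0 : ℝ) 1) × Grid => ‖F (z.1.1, z.1.2) - F (z.2, z.1.2)‖ₑ)
      (by fun_prop))), e2, ← lintegral_const_mul _ (Measurable.lintegral_prod_left' hgm),
      ← lintegral_const_mul _ ((Measurable.lintegral_prod_left' hgm).const_mul _)]
    refine lintegral_mono fun s => ?_
    refine (grid_poincare (hf.comp (isometry_strip_fst s).lipschitz) x.fst hr).trans ?_
    gcongr with a
    exact lipSlope_comp_le (Eventually.of_forall fun b => ((isometry_strip_fst s) b a).le)
  have hIr : volume I ≤ ENNReal.ofReal (2 * r) :=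
    (volume_Icc_ball_le x.snd r).trans (ENNReal.ofReal_le_ofReal (min_le_right _ _))
  calc _ ≤ ∫⁻ a in B, (∫⁻ _ in I, (gridMeasure B * volume I * W a + V a)) ∂gridMeasure :=
        lintegral_mono fun a => setLIntegral_mono' measurableSet_ball fun t ht => h1 a t ht
    _ = volume I * (gridMeasure B * volume I * S + ∫⁻ a in B, V a ∂gridMeasure) := by
        simp only [lintegral_const, Measure.restrict_apply_univ]
        rw [lintegral_mul_const _ (by fun_prop), lintegral_add_left (by fun_prop),
          lintegral_const_mul _ hWm, mul_comm]
    _ ≤ volume I * (gridMeasure B * ENNReal.ofReal (2 * r) * S +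
          14 * (ENNReal.ofReal (2 * r) * gridMeasure B * S)) := by gcongr
    _ = (15 * ENNReal.ofReal (2 * r)) * (gridMeasure B * volume I) * S := by ring
    _ = _ := by
        rw [gridStripMeasure_stripBox, ← hB, ← hI, show (30 : ℝ) * r = 15 * (2 * r) by ring,
          ENNReal.ofReal_mul (by norm_num : (0 : ℝ) ≤ 15)]
        simp

end StripPoincare

/-! ### From double integrals to averages -/

section MeanOscillation

variable {X : Type u} [MetricSpace X] [MeasurableSpace X] [BorelSpace X] {μ : Measure X}

theorem ofReal_meanOscillation_le {f : X → ℝ} {K : ℝ≥0} (hf : LipschitzWith K f) (x : X) {r : ℝ}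
    (h0 : μ (Metric.ball x r) ≠ 0) (hT : μ (Metric.ball x r) ≠ ∞) :
    ENNReal.ofReal (⨍ y in Metric.ball x r, |f y - ⨍ z in Metric.ball x r, f z ∂μ| ∂μ) ≤
      (μ (Metric.ball x r))⁻¹ * ((μ (Metric.ball x r))⁻¹ *
        ∫⁻ y in Metric.ball x r, ∫⁻ z in Metric.ball x r, ‖f y - f z‖ₑ ∂μ ∂μ) := by
  set B := Metric.ball x r
  set ν : Measure X := (μ B)⁻¹ • μ.restrict B with hν
  have hprob : IsProbabilityMeasure ν := ⟨by
    rw [hν, Measure.smul_apply, Measure.restrict_apply_univ, smul_eq_mul,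
      ENNReal.inv_mul_cancel h0 hT]⟩
  have hav : ∀ g : X → ℝ, ⨍ y in B, g y ∂μ = ∫ y, g y ∂ν := fun g => by
    rw [average, Measure.restrict_apply_univ]
  have hint : Integrable f ν := by
    refine Integrable.smul_measure ?_ (by simpa using h0)
    refine Measure.integrableOn_of_bounded (M := |f x| + K * r) hT
      hf.continuous.aestronglyMeasurable ?_
    filter_upwards [ae_restrict_mem measurableSet_ball] with y hy
    have h1 : dist (f y) (f x) ≤ K * r :=
      (hf.dist_le_mul y x).trans (mul_le_mul_of_nonneg_left (le_of_lt hy) K.2)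
    rw [Real.dist_eq] at h1
    rw [Real.norm_eq_abs]
    linarith [abs_sub_abs_le_abs_sub (f y) (f x)]
  rw [hav, hav]
  have h1 : ∀ y, ‖f y - ∫ z, f z ∂ν‖ₑ ≤ ∫⁻ z, ‖f y - f z‖ₑ ∂ν := fun y => by
    have : f y - ∫ z, f z ∂ν = ∫ z, (f y - f z) ∂ν := by
      rw [integral_sub (integrable_const _) hint]
      simp
    rw [this]
    exact enorm_integral_le_lintegral_enorm _
  have h2 := ofReal_integral_norm_eq_lintegral_enorm (hint.sub (integrable_const (∫ z, f z ∂ν)))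
  simp only [Pi.sub_apply, Real.norm_eq_abs] at h2
  rw [h2]
  refine (lintegral_mono h1).trans (le_of_eq ?_)
  rw [hν, lintegral_smul_measure, smul_eq_mul]
  simp_rw [lintegral_smul_measure, smul_eq_mul]
  rw [lintegral_const_mul' _ _ (ENNReal.inv_ne_top.2 h0)]

theorem setLAverage_le_sqrt {g : X → ℝ≥0∞} (hg : Measurable g) {B : Set X} (h0 : μ B ≠ 0)
    (hT : μ B ≠ ∞) : ⨍⁻ y in B, g y ∂μ ≤ (⨍⁻ y in B, g y ^ 2 ∂μ) ^ (1 / 2 : ℝ) := by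
  rw [laverage, laverage, Measure.restrict_apply_univ]
  set ν : Measure X := (μ B)⁻¹ • μ.restrict B with hν
  have huniv : ν Set.univ = 1 := by
    rw [hν, Measure.smul_apply, Measure.restrict_apply_univ, smul_eq_mul,
      ENNReal.inv_mul_cancel h0 hT]
  have h := ENNReal.lintegral_mul_le_Lp_mul_Lq ν Real.HolderConjugate.two_two hg.aemeasurable
    (aemeasurable_const (b := (1 : ℝ≥0∞)))
  simpa [huniv] using h

end MeanOscillation

/-- The dilation factor 2 appears because a box of radius `r` fits only into a ball of radius `2 r`.
The doubling constant enters twice, from the mass in the box estimate and from turning the slope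
integral into an average; Jensen's inequality then passes to the square. -/
theorem gridStripMeasure_supportsWeakPoincare : SupportsWeakPoincare gridStripMeasure := by
  refine ⟨30 * (24 * 4 * 24) * (24 * 4 * 24), 2, by norm_num, by norm_num, ?_⟩
  rintro f ⟨⟨K, hK⟩, -⟩ x r hr
  set μ := gridStripMeasure
  set B := Metric.ball x r
  set B₂ := Metric.ball x (2 * r)
  set D : ℝ≥0∞ := ENNReal.ofReal (24 * 4 * 24) with hD
  have hdoub : μ B₂ ≤ D * μ B := by
    refine (gridStripMeasure_ball_le x (by positivity)).trans ?_
    refine le_trans (le_of_eq ?_) (mul_le_mul_right (le_gridStripMeasure_ball x hr) _)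
    rw [← ENNReal.ofReal_mul (by norm_num)]
    congr 1
    ring
  have hB0 : μ B ≠ 0 := (gridStripMeasure_ball_pos x hr).ne'
  have hBT : μ B ≠ ∞ := gridStripMeasure_ball_ne_top x r
  have hB₂0 : μ B₂ ≠ 0 := (gridStripMeasure_ball_pos x (by positivity)).ne'
  have hB₂T : μ B₂ ≠ ∞ := gridStripMeasure_ball_ne_top x _
  have hg := measurable_lipSlope hK.continuous
  have h1 : ∫⁻ y in B, ∫⁻ z in B, ‖f y - f z‖ₑ ∂μ ∂μ ≤
      ENNReal.ofReal (30 * r) * μ B₂ * ∫⁻ y in B₂, lipSlope f y ∂μ := by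
    calc _ ≤ ∫⁻ y in stripBox x r, ∫⁻ z in stripBox x r, ‖f y - f z‖ₑ ∂μ ∂μ :=
          (lintegral_mono_set (ball_subset_stripBox x r)).trans
            (lintegral_mono fun y => lintegral_mono_set (ball_subset_stripBox x r))
      _ ≤ _ := stripBox_poincare hK x hr
      _ ≤ _ := by
          gcongr
          · exact stripBox_subset_ball x r
          · exact stripBox_subset_ball x r
  have h2 : ∫⁻ y in B₂, lipSlope f y ∂μ = μ B₂ * ⨍⁻ y in B₂, lipSlope f y ∂μ := by
    rw [measure_mul_setLAverage _ hB₂T]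
  refine (ofReal_meanOscillation_le hK x hB0 hBT).trans ?_
  calc (μ B)⁻¹ * ((μ B)⁻¹ * ∫⁻ y in B, ∫⁻ z in B, ‖f y - f z‖ₑ ∂μ ∂μ)
      ≤ (μ B)⁻¹ * ((μ B)⁻¹ * (ENNReal.ofReal (30 * r) * (D * μ B) *
          ((D * μ B) * ⨍⁻ y in B₂, lipSlope f y ∂μ))) := by
        rw [h2] at h1
        gcongr
        refine h1.trans ?_
        gcongr
    _ = ((μ B)⁻¹ * μ B) * ((μ B)⁻¹ * μ B) * (ENNReal.ofReal (30 * r) * D * D *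
          ⨍⁻ y in B₂, lipSlope f y ∂μ) := by ring
    _ = ENNReal.ofReal (30 * (24 * 4 * 24) * (24 * 4 * 24) * r) *
          ⨍⁻ y in B₂, lipSlope f y ∂μ := by
        rw [ENNReal.inv_mul_cancel hB0 hBT, one_mul, one_mul, hD,
          ← ENNReal.ofReal_mul (by positivity), ← ENNReal.ofReal_mul (by positivity)]
        congr 2
        ring
    _ ≤ _ := by
        gcongr
        exact setLAverage_le_sqrt hg hB₂0 hB₂T

theorem gridStripMeasure_isPI : IsPI gridStripMeasure :=
  ⟨gridStripMeasure_isDoubling, gridStripMeasure_supportsWeakPoincare⟩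

/-! ### Convergence of the rescaled grid strip to the plane -/

section Convergence

/-- The projection of the grid strip, rescaled around `p` by the factor `ρ⁻¹`, to the plane. -/
def rescale (p : GridStrip) (ρ : ℝ) (x : GridStrip) : ℝ × ℝ := ρ⁻¹ • (x.fst.1 - p.fst.1)

@[fun_prop]
theorem measurable_rescale (p : GridStrip) (ρ : ℝ) : Measurable (rescale p ρ) := by
  have h : Measurable fun x : GridStrip => x.fst.1 - p.fst.1 :=
    (measurable_subtype_coe.comp measurable_strip_fst).sub_const _
  exact h.const_smul ρ⁻¹

theorem rescale_self (p : GridStrip) (ρ : ℝ) : rescale p ρ p = 0 := by simp [rescale]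

theorem dist_rescale (p : GridStrip) {ρ : ℝ} (hρ : 0 < ρ) (x y : GridStrip) :
    ρ * dist (rescale p ρ x) (rescale p ρ y) = dist x.fst y.fst := by
  rw [rescale, rescale, dist_smul₀, dist_sub_right, Real.norm_of_nonneg (by positivity),
    mul_inv_cancel_left₀ hρ.ne']
  rfl

theorem dist_snd_le_one (x y : GridStrip) : dist x.snd y.snd ≤ 1 := by
  have hx := x.snd.2
  have hy := y.snd.2
  rw [Subtype.dist_eq, Real.dist_eq, abs_le]
  exact ⟨by linarith [hx.1, hy.2], by linarith [hx.2, hy.1]⟩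

/-- Only the interval factor, of diameter one, is forgotten. The error does not grow with `ρ`, so it
disappears after rescaling. -/
theorem abs_dist_sub_dist_rescale_le (p : GridStrip) {ρ : ℝ} (hρ : 0 < ρ) (x y : GridStrip) :
    |dist x y - ρ * dist (rescale p ρ x) (rescale p ρ y)| ≤ 1 := by
  rw [dist_rescale p hρ, abs_le]
  have h1 := dist_fst_le x y
  have h2 := dist_strip_le_add x y
  have h3 := dist_snd_le_one x y
  constructor <;> linarith

theorem norm_rescale_lt (p : GridStrip) {ρ R : ℝ} (hρ : 0 < ρ) {x : GridStrip}
    (hx : x ∈ Metric.ball p (R * ρ)) : ‖rescale p ρ x‖ < R := by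
  have h1 := dist_rescale p hρ x p
  rw [rescale_self, dist_zero_right] at h1
  have h2 : dist x p < R * ρ := hx
  have h3 := dist_fst_le x p
  refine lt_of_mul_lt_mul_left ?_ hρ.le
  linarith

theorem dist_le_rescale (p : GridStrip) {ρ : ℝ} (hρ : 0 < ρ) (x : GridStrip) :
    dist x p ≤ ρ * ‖rescale p ρ x‖ + 1 := by
  have h1 := abs_dist_sub_dist_rescale_le p hρ x p
  rw [rescale_self, dist_zero_right, abs_le] at h1
  linarith

theorem abs_floor_rescale (c w : ℝ) {ρ : ℝ} (hρ : 0 < ρ) :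
    |ρ⁻¹ * ((⌊c + ρ * w⌋ : ℝ) - c) - w| ≤ ρ⁻¹ := by
  have h1 : ρ⁻¹ * ((⌊c + ρ * w⌋ : ℝ) - c) - w = ρ⁻¹ * ((⌊c + ρ * w⌋ : ℝ) - (c + ρ * w)) := by
    field_simp
    ring
  rw [h1, abs_mul, abs_of_pos (inv_pos.2 hρ)]
  refine mul_le_of_le_one_right (inv_pos.2 hρ).le ?_
  rw [abs_le]
  constructor
  · linarith [Int.lt_floor_add_one (c + ρ * w)]
  · linarith [Int.floor_le (c + ρ * w)]

/-- The point of the grid strip which approximates `y` after rescaling. -/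
def approxPoint (p : GridStrip) (ρ : ℝ) (y : ℝ × ℝ) : GridStrip :=
  WithLp.toLp 2 (rowMap (p.fst.1 + ρ • y), p.snd)

theorem dist_rescale_approxPoint (p : GridStrip) {ρ : ℝ} (hρ : 0 < ρ) (y : ℝ × ℝ) :
    dist (rescale p ρ (approxPoint p ρ y)) y ≤ ρ⁻¹ := by
  rw [Prod.dist_eq]
  refine max_le ?_ ?_
  · have : (rescale p ρ (approxPoint p ρ y)).1 = y.1 := by
      simp [rescale, approxPoint, rowMap, row, hρ.ne']
    rw [this, dist_self]
    positivity
  · exact abs_floor_rescale p.fst.1.2 y.2 hρ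

theorem approxPoint_mem_ball (p : GridStrip) {ρ R : ℝ} (hρ : 0 < ρ) {y : ℝ × ℝ}
    (hy : ρ * ‖y‖ + 2 < R * ρ) : approxPoint p ρ y ∈ Metric.ball p (R * ρ) := by
  have h1 := dist_le_rescale p hρ (approxPoint p ρ y)
  have h2 := dist_rescale_approxPoint p hρ y
  have h3 : ‖rescale p ρ (approxPoint p ρ y)‖ ≤ ρ⁻¹ + ‖y‖ := by
    have := norm_le_norm_add_norm_sub' (rescale p ρ (approxPoint p ρ y)) y
    rw [← dist_eq_norm] at this
    linarith
  have h4 : ρ * (ρ⁻¹ + ‖y‖) = 1 + ρ * ‖y‖ := by field_simp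
  have h5 := mul_le_mul_of_nonneg_left h3 hρ.le
  rw [Metric.mem_ball]
  linarith

theorem integral_plane_scale (c : ℝ × ℝ) {ρ : ℝ} (hρ : 0 < ρ)
    {h : (ℝ × ℝ) × Set.Icc (0 : ℝ) 1 → ℝ} (hh : Measurable h) :
    ∫ p : (ℝ × ℝ) × Set.Icc (0 : ℝ) 1, h (c + ρ • p.1, p.2) = (ρ ^ 2)⁻¹ * ∫ p, h p := by
  have hT : Measurable fun y : ℝ × ℝ => c + ρ • y := by fun_prop
  have h1 : (volume : Measure (ℝ × ℝ)).map (fun y => c + ρ • y) =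
      ENNReal.ofReal (ρ ^ 2)⁻¹ • volume := by
    have h2 : (fun y : ℝ × ℝ => c + ρ • y) = (fun y => c + y) ∘ fun y => ρ • y := rfl
    rw [h2, ← Measure.map_map (by fun_prop) (by fun_prop), Measure.map_addHaar_smul _ hρ.ne']
    simp only [Module.finrank_prod, Module.finrank_self, Nat.reduceAdd]
    rw [abs_of_pos (by positivity), Measure.map_smul, map_add_left_eq_self]
  have h3 : (volume : Measure ((ℝ × ℝ) × Set.Icc (0 : ℝ) 1)).map
      (fun p : (ℝ × ℝ) × Set.Icc (0 : ℝ) 1 => (c + ρ • p.1, p.2)) = ENNReal.ofReal (ρ ^ 2)⁻¹ • volume := by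
    have h4 := Measure.map_prod_map (volume : Measure (ℝ × ℝ))
      (volume : Measure (Set.Icc (0 : ℝ) 1)) hT measurable_id
    rw [Measure.map_id, h1, Measure.prod_smul_left] at h4
    exact h4.symm
  have h5 : Measurable fun p : (ℝ × ℝ) × Set.Icc (0 : ℝ) 1 => (c + ρ • p.1, p.2) := by fun_prop
  rw [← integral_map h5.aemeasurable hh.aestronglyMeasurable, h3, integral_smul_measure,
    ENNReal.toReal_ofReal (by positivity), smul_eq_mul]

/-- Dominated convergence, stated with `θ` so that it serves the rows (`θ` the identity) and the
columns (`θ` the swap). For `ρ ≥ 1` the parameters involved stay in the ball of radius `R + 1`,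
which gives the dominating function. -/
theorem tendsto_integral_rescale_line (p : GridStrip) {F : ℝ × ℝ → ℝ} (hF : Continuous F)
    {C : ℝ} (hC : ∀ y, |F y| ≤ C) (R : ℝ) (θ : (ℝ × ℝ) ≃ᵐ (ℝ × ℝ))
    (hθ : MeasurePreserving θ) (hθn : ∀ y, ‖θ y‖ = ‖y‖) (l : ℝ → ℝ × ℝ → Grid)
    (hl : ∀ ρ, Measurable (l ρ))
    (hlθ : ∀ ρ > 0, ∀ y t, dist (rescale p ρ (WithLp.toLp 2 (l ρ y, t))) (θ y) ≤ ρ⁻¹) :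
    Tendsto (fun ρ : ℝ => ∫ q : (ℝ × ℝ) × Set.Icc (0 : ℝ) 1,
      (Metric.ball p (R * ρ)).indicator (fun x => F (rescale p ρ x)) (WithLp.toLp 2 (l ρ q.1, q.2)))
      atTop (𝓝 (∫ y in Metric.ball 0 R, F y)) := by
  have hlim : ∫ q : (ℝ × ℝ) × Set.Icc (0 : ℝ) 1,
      (Metric.ball (0 : ℝ × ℝ) R).indicator F (θ q.1) = ∫ y in Metric.ball 0 R, F y := by
    rw [Measure.volume_eq_prod, integral_fun_fst
      (fun y => (Metric.ball (0 : ℝ × ℝ) R).indicator F (θ y)),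
      hθ.integral_comp' (g := (Metric.ball (0 : ℝ × ℝ) R).indicator F),
      integral_indicator measurableSet_ball]
    simp [Measure.real]
  have hC0 : 0 ≤ C := (abs_nonneg _).trans (hC 0)
  rw [← hlim]
  refine tendsto_integral_filter_of_dominated_convergence
    (fun q => (Metric.ball (0 : ℝ × ℝ) (R + 1)).indicator (fun _ => C) q.1) ?_ ?_ ?_ ?_
  · refine Eventually.of_forall fun ρ => Measurable.aestronglyMeasurable ?_
    have h1 : Measurable fun q : (ℝ × ℝ) × Set.Icc (0 : ℝ) 1 =>
        (WithLp.toLp 2 (l ρ q.1, q.2) : GridStrip) :=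
      (WithLp.measurable_toLp 2 _).comp (((hl ρ).comp measurable_fst).prodMk measurable_snd)
    exact ((hF.measurable.comp (measurable_rescale p ρ)).indicator measurableSet_ball).comp h1
  · filter_upwards [eventually_ge_atTop 1] with ρ hρ
    refine Eventually.of_forall fun q => ?_
    have hρ0 : 0 < ρ := by linarith
    by_cases hq : (WithLp.toLp 2 (l ρ q.1, q.2) : GridStrip) ∈ Metric.ball p (R * ρ)
    · have h1 := norm_rescale_lt p hρ0 hq
      have h2 := hlθ ρ hρ0 q.1 q.2
      have h3 : ρ⁻¹ ≤ 1 := inv_le_one_of_one_le₀ hρ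
      have h4 : q.1 ∈ Metric.ball (0 : ℝ × ℝ) (R + 1) := by
        rw [mem_ball_zero_iff, ← hθn]
        rw [dist_comm, dist_eq_norm] at h2
        have := norm_le_norm_add_norm_sub' (θ q.1) (rescale p ρ (WithLp.toLp 2 (l ρ q.1, q.2)))
        linarith
      rw [Set.indicator_of_mem hq, Set.indicator_of_mem h4]
      exact hC _
    · rw [Set.indicator_of_notMem hq, norm_zero]
      exact Set.indicator_nonneg (fun _ _ => hC0) _
  · have h1 : Integrable ((Metric.ball (0 : ℝ × ℝ) (R + 1)).indicator (fun _ => C)) :=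
      (integrable_indicator_iff measurableSet_ball).2 (integrableOn_const measure_ball_lt_top.ne)
    exact h1.comp_fst _
  -- The indicators converge except on the limit sphere, which is null; hence no radius has to be
  -- excluded.
  · have h1 : ∀ᵐ q : (ℝ × ℝ) × Set.Icc (0 : ℝ) 1, ‖θ q.1‖ ≠ R := by
      have h2 : ∀ᵐ y : ℝ × ℝ, ‖θ y‖ ≠ R := by
        have h3 : ∀ᵐ y : ℝ × ℝ, y ∉ Metric.sphere (0 : ℝ × ℝ) R :=
          measure_eq_zero_iff_ae_notMem.1 (Measure.addHaar_sphere _ _ _)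
        filter_upwards [h3] with y hy h4
        rw [hθn] at h4
        exact hy (by simpa using h4)
      exact Measure.quasiMeasurePreserving_fst.ae h2
    filter_upwards [h1] with q hq
    have hres : Tendsto (fun ρ => rescale p ρ (WithLp.toLp 2 (l ρ q.1, q.2))) atTop (𝓝 (θ q.1)) := by
      rw [tendsto_iff_dist_tendsto_zero]
      refine tendsto_of_tendsto_of_tendsto_of_le_of_le' tendsto_const_nhds tendsto_inv_atTop_zero
        (Eventually.of_forall fun _ => dist_nonneg) ?_
      filter_upwards [eventually_gt_atTop 0] with ρ hρ using hlθ ρ hρ _ _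
    rcases lt_or_gt_of_ne hq with hlt | hgt
    · have hin : θ q.1 ∈ Metric.ball (0 : ℝ × ℝ) R := by simpa using hlt
      rw [Set.indicator_of_mem hin]
      refine ((hF.tendsto _).comp hres).congr' ?_
      have h2 : Tendsto (fun ρ => ‖rescale p ρ (WithLp.toLp 2 (l ρ q.1, q.2))‖ + ρ⁻¹) atTop
          (𝓝 (‖θ q.1‖ + 0)) := hres.norm.add tendsto_inv_atTop_zero
      rw [add_zero] at h2
      filter_upwards [h2.eventually_lt_const hlt, eventually_gt_atTop 0] with ρ hρ hρ0
      have h3 : (WithLp.toLp 2 (l ρ q.1, q.2) : GridStrip) ∈ Metric.ball p (R * ρ) := by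
        rw [Metric.mem_ball]
        refine (dist_le_rescale p hρ0 _).trans_lt ?_
        have h4 := mul_lt_mul_of_pos_left hρ hρ0
        rw [mul_add, mul_inv_cancel₀ hρ0.ne'] at h4
        linarith
      rw [Set.indicator_of_mem h3]
      rfl
    · have hin : θ q.1 ∉ Metric.ball (0 : ℝ × ℝ) R := by simpa using hgt.le
      rw [Set.indicator_of_notMem hin]
      refine tendsto_const_nhds.congr' ?_
      filter_upwards [hres.norm.eventually_const_lt hgt, eventually_gt_atTop 0] with ρ hρ hρ0
      rw [Set.indicator_of_notMem]
      exact fun h => (norm_rescale_lt p hρ0 h).not_gt hρ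

theorem tendsto_integral_rescale (p : GridStrip) {F : ℝ × ℝ → ℝ} (hF : Continuous F)
    {C : ℝ} (hC : ∀ y, |F y| ≤ C) (R : ℝ) :
    Tendsto (fun ρ : ℝ => (ρ ^ 2)⁻¹ *
      ∫ x in Metric.ball p (R * ρ), F (rescale p ρ x) ∂gridStripMeasure)
      atTop (𝓝 (2 * ∫ y in Metric.ball 0 R, F y)) := by
  set c : ℝ × ℝ := p.fst.1 with hc
  have h1 := tendsto_integral_rescale_line p hF hC R (MeasurableEquiv.refl _)
    (MeasurePreserving.id _) (fun y => rfl) (fun ρ y => rowMap (c + ρ • y))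
    (fun ρ => measurable_rowMap.comp (by fun_prop)) (fun ρ hρ y t =>
      dist_rescale_approxPoint p hρ y)
  have h2 := tendsto_integral_rescale_line p hF hC R MeasurableEquiv.prodComm
    (Measure.measurePreserving_swap) (fun y => max_comm ‖y.2‖ ‖y.1‖)
    (fun ρ y => colMap (c.swap + ρ • y))
    (fun ρ => measurable_colMap.comp (by fun_prop)) (fun ρ hρ y t => by
      rw [Prod.dist_eq]
      refine max_le (abs_floor_rescale c.1 y.2 hρ) ?_
      have : (rescale p ρ (WithLp.toLp 2 (colMap (c.swap + ρ • y), t))).2 = y.1 := by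
        simp [rescale, colMap, col, hρ.ne', hc]
      rw [this, show (MeasurableEquiv.prodComm y).2 = y.1 from rfl, dist_self]
      exact (inv_pos.2 hρ).le)
  rw [two_mul]
  refine (h1.add h2).congr' ?_
  filter_upwards [eventually_gt_atTop 0] with ρ hρ
  set g : GridStrip → ℝ := (Metric.ball p (R * ρ)).indicator (fun x => F (rescale p ρ x)) with hg
  have hgm : Measurable g :=
    (hF.measurable.comp (measurable_rescale p ρ)).indicator measurableSet_ball
  have hint : Integrable g gridStripMeasure := by
    refine (integrable_indicator_iff measurableSet_ball).2 ?_
    refine Measure.integrableOn_of_bounded (M := C) (gridStripMeasure_ball_ne_top _ _)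
      (hF.measurable.comp (measurable_rescale p ρ)).aestronglyMeasurable ?_
    exact Eventually.of_forall fun x => hC _
  have e1 := integral_plane_scale c hρ (hgm.comp measurable_rowStrip)
  have e2 := integral_plane_scale c.swap hρ (hgm.comp measurable_colStrip)
  rw [← integral_indicator measurableSet_ball, ← hg]
  have e3 : ∫ x, g x ∂gridStripMeasure = (∫ q, g (rowStrip q)) + ∫ q, g (colStrip q) := by
    rw [gridStripMeasure_eq] at hint ⊢
    rw [integral_add_measure (hint.mono_measure (Measure.le_add_right le_rfl))
      (hint.mono_measure (Measure.le_add_left le_rfl)),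
      integral_map measurable_rowStrip.aemeasurable hgm.aestronglyMeasurable,
      integral_map measurable_colStrip.aemeasurable hgm.aestronglyMeasurable]
  rw [e3, mul_add]
  exact congrArg₂ (· + ·) e1 e2

/-- The unit ball of the sup norm has area 4, counted once for rows and once for columns. -/
theorem tendsto_measure_ball (p : GridStrip) :
    Tendsto (fun ρ : ℝ => (ρ ^ 2)⁻¹ * (gridStripMeasure (Metric.ball p ρ)).toReal) atTop (𝓝 8) := by
  have h := tendsto_integral_rescale p (F := fun _ => 1) continuous_const (C := 1) (by simp) 1
  have h1 : (2 * ∫ y in Metric.ball (0 : ℝ × ℝ) 1, (1 : ℝ)) = 8 := by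
    have h2 : Metric.ball (0 : ℝ × ℝ) 1 = Metric.ball (0 : ℝ) 1 ×ˢ Metric.ball (0 : ℝ) 1 := by
      rw [ball_prod_same]; rfl
    rw [setIntegral_const, h2, measureReal_def, Measure.volume_eq_prod, Measure.prod_prod,
      Real.volume_ball]
    norm_num
  rw [h1] at h
  simpa [measureReal_def] using h

theorem tendsto_integral_normalized (p : GridStrip) {F : ℝ × ℝ → ℝ} (hF : Continuous F)
    {C : ℝ} (hC : ∀ y, |F y| ≤ C) (R : ℝ) :
    Tendsto (fun ρ : ℝ => ∫ y, F y ∂((gridStripMeasure (Metric.ball p ρ))⁻¹ •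
      (gridStripMeasure.restrict (Metric.ball p (R * ρ))).map (rescale p ρ)))
      atTop (𝓝 (∫ y, F y ∂(planeMeasure.restrict (Metric.ball 0 R)))) := by
  have h := (tendsto_integral_rescale p hF hC R).div (tendsto_measure_ball p) (by norm_num)
  have h1 : (2 * ∫ y in Metric.ball 0 R, F y) / 8 =
      ∫ y, F y ∂(planeMeasure.restrict (Metric.ball 0 R)) := by
    rw [planeMeasure, Measure.restrict_smul]
    have h2 : ∫ y, F y ∂((4 : ℝ≥0∞)⁻¹ • volume.restrict (Metric.ball (0 : ℝ × ℝ) R)) =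
        ((4 : ℝ≥0∞)⁻¹).toReal • ∫ y in Metric.ball 0 R, F y := integral_smul_measure _ _
    change _ = ∫ y, F y ∂((4 : ℝ≥0∞)⁻¹ • volume.restrict (Metric.ball (0 : ℝ × ℝ) R))
    rw [h2, smul_eq_mul, ENNReal.toReal_inv]
    norm_num
    ring
  rw [h1] at h
  refine h.congr' ?_
  filter_upwards [eventually_gt_atTop 0] with ρ hρ
  rw [integral_smul_measure, integral_map (measurable_rescale p ρ).aemeasurable
    hF.measurable.aestronglyMeasurable, ENNReal.toReal_inv, smul_eq_mul]
  have h2 : (ρ ^ 2)⁻¹ ≠ 0 := by positivity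
  simp only [Pi.div_apply]
  rw [mul_div_mul_left _ _ h2, div_eq_inv_mul]

theorem rescalingsConverge_plane (p : GridStrip) {rad : ℕ → ℝ} (hrad : Tendsto rad atTop atTop) :
    RescalingsConverge gridStripMeasure p rad planeMeasure (0 : ℝ × ℝ) := by
  intro ε hε hε1
  refine Eventually.of_forall fun R hR => ?_
  -- The bound `3 ≤ ε * rad k` pays for the distance error 1, the margin 2 in
  -- `approxPoint_mem_ball`, and the approximation error `(rad k)⁻¹ < ε`.
  obtain ⟨k₀, hk₀⟩ := eventually_atTop.1 (hrad.eventually_ge_atTop (3 / ε))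
  refine ⟨k₀, fun k => rescale p (rad k), fun k hk => ?_, ?_⟩
  · have h1 := hk₀ k hk
    have h3 : 3 ≤ ε * rad k := by rwa [div_le_iff₀' hε] at h1
    have h0 : 0 < rad k := lt_of_lt_of_le (by positivity) h1
    refine ⟨measurable_rescale p _, rescale_self p _, fun x _ y _ => ?_, fun y hy => ?_⟩
    · exact (abs_dist_sub_dist_rescale_le p h0 x y).trans (by linarith)
    · rw [Metric.mem_thickening_iff]
      rw [mem_ball_zero_iff] at hy
      refine ⟨_, ⟨approxPoint p (rad k) y, approxPoint_mem_ball p h0 ?_, rfl⟩, ?_⟩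
      · have := mul_lt_mul_of_pos_left hy h0
        linarith
      · rw [dist_comm]
        refine (dist_rescale_approxPoint p h0 y).trans_lt ?_
        rw [inv_lt_iff_one_lt_mul₀ h0]
        linarith
  · rintro f hf ⟨C, hC⟩ -
    exact (tendsto_integral_normalized p hf hC R).comp hrad

theorem planeMeasure_isPointedMetricMeasureSpace :
    IsPointedMetricMeasureSpace planeMeasure (0 : ℝ × ℝ) := by
  refine ⟨⟨inferInstance, inferInstance, fun s hs => ?_⟩, ?_⟩
  · rw [planeMeasure, Measure.smul_apply, smul_eq_mul]
    exact ENNReal.mul_lt_top (by simp) hs.measure_lt_top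
  · rw [Metric.nhds_basis_ball.mem_measureSupport]
    intro r hr
    rw [planeMeasure, Measure.smul_apply, smul_eq_mul]
    exact ENNReal.mul_pos (by simp) (Metric.measure_ball_pos _ _ hr).ne'

theorem plane_isAsymptoticCone : IsAsymptoticCone gridStripMeasure planeMeasure (0 : ℝ × ℝ) := by
  refine ⟨planeMeasure_isPointedMetricMeasureSpace, fun k => (k : ℝ), Nat.mono_cast,
    tendsto_natCast_atTop_atTop, ?_⟩
  let x : GridStrip := WithLp.toLp 2 (row 0 0, ⟨0, by simp⟩)
  exact ⟨x, mem_support_gridStripMeasure x, rescalingsConverge_plane x tendsto_natCast_atTop_atTop⟩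

end Convergence

/-! ### Uniqueness of the asymptotic cone -/

section Uniqueness

/-- Two complete pointed limits of one family of sets are isometric. -/
theorem exists_isometryEquiv_of_common_approximation {I X Y Z : Type*} [MetricSpace Y]
    [CompleteSpace Y] [MetricSpace Z] [ProperSpace Z] (𝓥 : Ultrafilter I) (B : I → Set X) (p : X)
    (q : Y) (o : Z) (Ψ : I → X → Y) (φ : I → X → Z) (δ : I → ℝ) (hδ : Tendsto δ 𝓥 (𝓝 0))
    (ha : ∀ᶠ i in 𝓥, ∀ x ∈ B i, ∀ y ∈ B i,
      |dist (φ i x) (φ i y) - dist (Ψ i x) (Ψ i y)| ≤ δ i)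
    (hb : ∀ᶠ i in 𝓥, p ∈ B i ∧ Ψ i p = q ∧ φ i p = o)
    (hc : ∀ y, ∀ᶠ i in 𝓥, ∃ x ∈ B i, dist y (Ψ i x) ≤ δ i)
    (hd : ∀ z, ∀ᶠ i in 𝓥, ∃ x ∈ B i, dist z (φ i x) ≤ δ i) :
    ∃ e : Y ≃ᵢ Z, e q = o ∧ ∀ L, ∀ η > 0, ∀ᶠ i in 𝓥, ∀ x ∈ B i, dist (φ i x) o ≤ L →
      dist (e (Ψ i x)) (φ i x) ≤ η := by
  have hδ1 : ∀ᶠ i in 𝓥, δ i < 1 := hδ.eventually_lt_const one_pos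
  have choose_seq : ∀ (P : I → X → Prop), (∀ᶠ i in 𝓥, ∃ x, P i x) →
      ∃ w : I → X, ∀ᶠ i in 𝓥, P i (w i) := fun P hP => by
    classical
    refine ⟨fun i => if h : ∃ x, P i x then h.choose else p, ?_⟩
    filter_upwards [hP] with i hi
    rw [dif_pos hi]
    exact hi.choose_spec
  have hx : ∀ y : Y, ∃ w : I → X, ∀ᶠ i in 𝓥, w i ∈ B i ∧ dist y (Ψ i (w i)) ≤ δ i :=
    fun y => choose_seq _ (hc y)
  choose x hx using hx
  have hxlim : ∀ y, Tendsto (fun i => Ψ i (x y i)) 𝓥 (𝓝 y) := fun y => by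
    rw [tendsto_iff_dist_tendsto_zero]
    refine tendsto_of_tendsto_of_tendsto_of_le_of_le' tendsto_const_nhds hδ
      (Eventually.of_forall fun _ => dist_nonneg) ?_
    filter_upwards [hx y] with i hi
    rw [dist_comm]
    exact hi.2
  have hdist : ∀ w w' : I → X, (∀ᶠ i in 𝓥, w i ∈ B i) → (∀ᶠ i in 𝓥, w' i ∈ B i) →
      Tendsto (fun i => dist (φ i (w i)) (φ i (w' i)) - dist (Ψ i (w i)) (Ψ i (w' i))) 𝓥 (𝓝 0) :=
    fun w w' hw hw' => by
      refine squeeze_zero_norm' ?_ hδ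
      filter_upwards [ha, hw, hw'] with i h1 h2 h3 using h1 _ h2 _ h3
  -- The isometry is the ultralimit of `φ` along points whose `Ψ`-images approach `y`. These images
  -- stay bounded, so properness of `Z` provides the limit with no extraction of subsequences.
  have hS : ∀ y, ∃ z, Tendsto (fun i => φ i (x y i)) 𝓥 (𝓝 z) := fun y => by
    have hmem : ∀ᶠ i in 𝓥, φ i (x y i) ∈ Metric.closedBall o (dist y q + 2) := by
      filter_upwards [hx y, hb, ha, hδ1] with i ⟨h1, h2⟩ ⟨h3, h4, h5⟩ h6 h7
      have h8 := abs_le.1 (h6 _ h1 _ h3)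
      rw [h4, h5] at h8
      have h9 := dist_triangle_left (Ψ i (x y i)) q y
      rw [Metric.mem_closedBall]
      linarith [h8.2]
    obtain ⟨z, -, hz⟩ := (isCompact_closedBall o (dist y q + 2)).ultrafilter_le_nhds'
      (𝓥.map fun i => φ i (x y i)) hmem
    exact ⟨z, hz⟩
  choose S hS using hS
  have hSiso : Isometry S := Isometry.of_dist_eq fun y y' => by
    have h1 := (hS y).dist (hS y')
    have h2 := (hxlim y).dist (hxlim y')
    have h3 := hdist (x y) (x y') ((hx y).mono fun _ h => h.1) ((hx y').mono fun _ h => h.1)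
    have h4 := h3.add h2
    simp only [sub_add_cancel, zero_add] at h4
    exact tendsto_nhds_unique h1 h4
  have hP : ∀ (w : I → X) (y : Y), (∀ᶠ i in 𝓥, w i ∈ B i) →
      Tendsto (fun i => Ψ i (w i)) 𝓥 (𝓝 y) → Tendsto (fun i => φ i (w i)) 𝓥 (𝓝 (S y)) :=
    fun w y hw hwy => by
      have h1 := hdist w (x y) hw ((hx y).mono fun _ h => h.1)
      have h2 := h1.add (hwy.dist (hxlim y))
      simp only [sub_add_cancel, dist_self, zero_add] at h2
      rw [tendsto_iff_dist_tendsto_zero]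
      have h3 := h2.add (tendsto_iff_dist_tendsto_zero.1 (hS y))
      rw [add_zero] at h3
      exact squeeze_zero (fun _ => dist_nonneg) (fun i => dist_triangle _ _ _) h3
  have hSq : S q = o := by
    have h1 := hP (fun _ => p) q (hb.mono fun _ h => h.1)
      (tendsto_const_nhds.congr' (hb.mono fun i h => h.2.1.symm))
    refine tendsto_nhds_unique h1 (tendsto_const_nhds.congr' (hb.mono fun i h => h.2.2.symm))
  -- Properness of `Y` is not assumed: it is inherited through `S`, a closed embedding because `Y`
  -- is complete.
  have hcomp : ∀ r, IsCompact (Metric.closedBall q r) := fun r => by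
    have h1 := hSiso.isClosedEmbedding.isCompact_preimage (isCompact_closedBall o r)
    rwa [← hSq, hSiso.preimage_closedBall] at h1
  have hlimY : ∀ (w : I → X) (L : ℝ), (∀ᶠ i in 𝓥, w i ∈ B i ∧ dist (φ i (w i)) o ≤ L) →
      ∃ y, Tendsto (fun i => Ψ i (w i)) 𝓥 (𝓝 y) := fun w L hw => by
    have hmem : ∀ᶠ i in 𝓥, Ψ i (w i) ∈ Metric.closedBall q (L + 1) := by
      filter_upwards [hw, hb, ha, hδ1] with i ⟨h1, h2⟩ ⟨h3, h4, h5⟩ h6 h7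
      have h8 := abs_le.1 (h6 _ h1 _ h3)
      rw [h4, h5] at h8
      rw [Metric.mem_closedBall]
      linarith [h8.1]
    obtain ⟨z, -, hz⟩ := (hcomp (L + 1)).ultrafilter_le_nhds' (𝓥.map fun i => Ψ i (w i)) hmem
    exact ⟨z, hz⟩
  have hsurj : Function.Surjective S := fun z => by
    obtain ⟨w, hw⟩ := choose_seq _ (hd z)
    have hwz : Tendsto (fun i => φ i (w i)) 𝓥 (𝓝 z) := by
      rw [tendsto_iff_dist_tendsto_zero]
      refine tendsto_of_tendsto_of_tendsto_of_le_of_le' tendsto_const_nhds hδ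
        (Eventually.of_forall fun _ => dist_nonneg) ?_
      filter_upwards [hw] with i hi
      rw [dist_comm]
      exact hi.2
    obtain ⟨y, hy⟩ := hlimY w (dist z o + 1) (by
      filter_upwards [hw, hδ1] with i h1 h2
      refine ⟨h1.1, (dist_triangle_left _ _ z).trans ?_⟩
      linarith [h1.2])
    exact ⟨y, tendsto_nhds_unique (hP w y (hw.mono fun _ h => h.1) hy) hwz⟩
  refine ⟨⟨Equiv.ofBijective S ⟨hSiso.injective, hsurj⟩, hSiso⟩, hSq, fun L η hη => ?_⟩
  -- Uniformity comes from a worst point: a bad choice of `x` for almost all `i` would stay bounded,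
  -- hence have limits on both sides matched by `S`.
  by_contra hcon
  have hcon' : ∀ᶠ i in 𝓥, ∃ x, x ∈ B i ∧ dist (φ i x) o ≤ L ∧ η < dist (S (Ψ i x)) (φ i x) := by
    rw [Ultrafilter.eventually_not.symm] at hcon
    filter_upwards [hcon] with i hi
    push Not at hi
    exact hi
  obtain ⟨w, hw⟩ := choose_seq _ hcon'
  obtain ⟨y, hy⟩ := hlimY w L (hw.mono fun _ h => ⟨h.1, h.2.1⟩)
  have h1 := hP w y (hw.mono fun _ h => h.1) hy
  have h2 := ((hSiso.continuous.tendsto y).comp hy).dist h1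
  rw [dist_self] at h2
  obtain ⟨i, h3, h4⟩ := ((h2.eventually_lt_const hη).and hw).exists
  exact absurd h3 (not_lt.2 h4.2.2.le)

theorem integral_smul_map_restrict {X Y : Type*} [MeasurableSpace X] [TopologicalSpace Y]
    [MeasurableSpace Y] [BorelSpace Y] {μ : Measure X} {S : Set X} {ψ : X → Y} (hψ : Measurable ψ)
    (c : ℝ≥0∞) {F : Y → ℝ} (hF : Continuous F) :
    ∫ y, F y ∂(c • (μ.restrict S).map ψ) = c.toReal * ∫ x in S, F (ψ x) ∂μ := by
  rw [integral_smul_measure, integral_map hψ.aemeasurable hF.measurable.aestronglyMeasurable,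
    smul_eq_mul]

theorem pointedIsomorphic_plane_of_rescalingsConverge {Y : Type*} [MetricSpace Y]
    [MeasurableSpace Y] [BorelSpace Y] {ν : Measure Y} {q : Y}
    (hν : IsPointedMetricMeasureSpace ν q) {rad : ℕ → ℝ} (hrad : Tendsto rad atTop atTop)
    {p : GridStrip} (hconv : RescalingsConverge gridStripMeasure p rad ν q) :
    PointedIsomorphic ν q planeMeasure (0 : ℝ × ℝ) := by
  have := hν.1.complete
  have := hν.1.separable
  set μ := gridStripMeasure with hμ
  set ε : ℕ → ℝ := fun j => 1 / ((j : ℝ) + 2) with hε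
  have hε0 : ∀ j, 0 < ε j := fun j => by positivity
  have hε1 : ∀ j, ε j < 1 := fun j => by
    rw [hε]
    simp only
    rw [div_lt_one (by positivity)]
    linarith [(Nat.cast_nonneg j : (0 : ℝ) ≤ j)]
  have hεlim : Tendsto ε atTop (𝓝 0) := by
    have h1 : Tendsto (fun j : ℕ => (j : ℝ) + 2) atTop atTop :=
      tendsto_atTop_add_const_right _ _ tendsto_natCast_atTop_atTop
    exact (tendsto_inv_atTop_zero.comp h1).congr fun j => by simp [hε]
  have hex : ∀ j : ℕ, ∃ R : ℝ, (j : ℝ) + 2 < R ∧ ∃ (k₀ : ℕ) (ψ : ℕ → GridStrip → Y),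
      (∀ k, k₀ ≤ k → Measurable (ψ k) ∧ ψ k p = q ∧
        (∀ x ∈ Metric.ball p (R * rad k), ∀ y ∈ Metric.ball p (R * rad k),
          |dist x y - rad k * dist (ψ k x) (ψ k y)| ≤ ε j * rad k) ∧
        Metric.ball q (R - ε j) ⊆
          Metric.thickening (ε j) (ψ k '' Metric.ball p (R * rad k))) ∧
      ∀ f : Y → ℝ, Continuous f → (∃ C, ∀ y, |f y| ≤ C) →
        Bornology.IsBounded (Function.support f) →
        Tendsto
          (fun k => ∫ y, f y ∂((μ (Metric.ball p (rad k)))⁻¹ •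
            (μ.restrict (Metric.ball p (R * rad k))).map (ψ k)))
          atTop (𝓝 (∫ y, f y ∂(ν.restrict (Metric.ball q R)))) := fun j => by
    -- Convergence is given only for almost every radius; such radii are dense, so one is found
    -- between `j + 2` and `j + 3`.
    have h1 := Measure.dense_of_ae (hconv (ε j) (hε0 j) (hε1 j))
    obtain ⟨R, hR, hR1, -⟩ := h1.exists_between (lt_add_one ((j : ℝ) + 2))
    exact ⟨R, hR1, hR (by linarith [(Nat.cast_nonneg j : (0 : ℝ) ≤ j)])⟩
  choose R hR k₀ ψ hψ hint using hex
  have hRlim : Tendsto R atTop atTop :=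
    tendsto_atTop_mono (fun j => by linarith [hR j]) (tendsto_natCast_atTop_atTop (R := ℝ))
  -- The maps exist only for `k` beyond a threshold depending on the precision index `j`, so the
  -- limit is iterated: `k` to infinity for fixed `j`, then `j`. An ultrafilter refining this filter
  -- avoids diagonal sequences.
  have hne : ((atTop : Filter ℕ).curry (atTop : Filter ℕ)).NeBot := ⟨fun h => by
    have h1 : ∀ᶠ _ in (atTop : Filter ℕ).curry (atTop : Filter ℕ), False := by rw [h]; simp
    obtain ⟨j, hj⟩ := (eventually_curry_iff.1 h1).exists
    exact hj.exists.elim fun _ h => h⟩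
  set 𝓥 : Ultrafilter (ℕ × ℕ) := Ultrafilter.of ((atTop : Filter ℕ).curry (atTop : Filter ℕ))
  have h𝓥 : ∀ {P : ℕ × ℕ → Prop}, (∀ᶠ j in atTop, ∀ᶠ k in atTop, P (j, k)) → ∀ᶠ i in 𝓥, P i :=
    fun h => Ultrafilter.of_le _ (eventually_curry_iff.2 h)
  have hfst : Tendsto (fun i : ℕ × ℕ => i.1) 𝓥 atTop := fun s hs => h𝓥 (P := fun i => i.1 ∈ s) (by
    filter_upwards [hs] with j hj using Eventually.of_forall fun _ => hj)
  have hsnd : Tendsto (fun i : ℕ × ℕ => i.2) 𝓥 atTop := fun s hs => h𝓥 (P := fun i => i.2 ∈ s) 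
    (Eventually.of_forall fun _ => hs)
  have hradV : Tendsto (fun i : ℕ × ℕ => rad i.2) 𝓥 atTop := hrad.comp hsnd
  set B : ℕ × ℕ → Set GridStrip := fun i => Metric.ball p (R i.1 * rad i.2) with hB
  set Ψ : ℕ × ℕ → GridStrip → Y := fun i => ψ i.1 i.2 with hΨ
  set φ : ℕ × ℕ → GridStrip → ℝ × ℝ := fun i => rescale p (rad i.2) with hφ
  set δ : ℕ × ℕ → ℝ := fun i => ε i.1 + (rad i.2)⁻¹ with hδ
  have hδlim : Tendsto δ 𝓥 (𝓝 0) := by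
    simpa using (hεlim.comp hfst).add (tendsto_inv_atTop_zero.comp hradV)
  have hk : ∀ᶠ i : ℕ × ℕ in 𝓥, k₀ i.1 ≤ i.2 :=
    h𝓥 (Eventually.of_forall fun j => eventually_ge_atTop (k₀ j))
  have hpos : ∀ᶠ i : ℕ × ℕ in 𝓥, 1 ≤ rad i.2 := hradV.eventually_ge_atTop 1
  have hR2 : ∀ j, 2 < R j := fun j => by linarith [hR j, (Nat.cast_nonneg j : (0 : ℝ) ≤ j)]
  have ha : ∀ᶠ i in 𝓥, ∀ x ∈ B i, ∀ y ∈ B i,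
      |dist (φ i x) (φ i y) - dist (Ψ i x) (Ψ i y)| ≤ δ i := by
    filter_upwards [hk, hpos] with i hi hi1 x hx y hy
    have h0 : 0 < rad i.2 := by linarith
    have h1 := abs_le.1 ((hψ i.1 i.2 hi).2.2.1 x hx y hy)
    have h2 := abs_le.1 (abs_dist_sub_dist_rescale_le p h0 x y)
    have h3 : rad i.2 * δ i = ε i.1 * rad i.2 + 1 := by
      simp only [hδ]
      field_simp
    rw [abs_le]
    constructor
    · refine le_of_mul_le_mul_left ?_ h0
      rw [mul_sub, mul_neg, h3]
      linarith [h1.1, h2.2]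
    · refine le_of_mul_le_mul_left ?_ h0
      rw [mul_sub, h3]
      linarith [h1.2, h2.1]
  have hb : ∀ᶠ i in 𝓥, p ∈ B i ∧ Ψ i p = q ∧ φ i p = 0 := by
    filter_upwards [hk, hpos] with i hi hi1
    refine ⟨Metric.mem_ball_self ?_, (hψ i.1 i.2 hi).2.1, rescale_self p _⟩
    have := hR2 i.1
    positivity
  have hc : ∀ y, ∀ᶠ i in 𝓥, ∃ x ∈ B i, dist y (Ψ i x) ≤ δ i := fun y => by
    filter_upwards [hk, hpos, (hRlim.comp hfst).eventually_gt_atTop (dist y q + 1)]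
      with i hi hi1 hi2
    have h1 : y ∈ Metric.ball q (R i.1 - ε i.1) := by
      rw [Metric.mem_ball]
      have := hε1 i.1
      simp only [Function.comp_apply] at hi2
      linarith
    obtain ⟨_, ⟨x, hx, rfl⟩, hxy⟩ := Metric.mem_thickening_iff.1 ((hψ i.1 i.2 hi).2.2.2 h1)
    refine ⟨x, hx, hxy.le.trans ?_⟩
    have : 0 ≤ (rad i.2)⁻¹ := by positivity
    simp only [hδ]
    linarith
  have hd : ∀ z, ∀ᶠ i in 𝓥, ∃ x ∈ B i, dist z (φ i x) ≤ δ i := fun z => by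
    filter_upwards [hpos, (hRlim.comp hfst).eventually_gt_atTop (‖z‖ + 2)] with i hi1 hi2
    have h0 : 0 < rad i.2 := by linarith
    simp only [Function.comp_apply] at hi2
    refine ⟨approxPoint p (rad i.2) z, approxPoint_mem_ball p h0 ?_, ?_⟩
    · have := mul_lt_mul_of_pos_right hi2 h0
      nlinarith
    · rw [dist_comm]
      refine (dist_rescale_approxPoint p h0 z).trans ?_
      simp only [hδ]
      linarith [hε0 i.1]
  obtain ⟨e, he, hclose⟩ := exists_isometryEquiv_of_common_approximation 𝓥 B p q (0 : ℝ × ℝ)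
    Ψ φ δ hδlim ha hb hc hd
  refine ⟨e, he, ?_⟩
  have hem : Measurable e := e.continuous.measurable
  have : IsLocallyFiniteMeasure (ν.map e) := by
    refine ⟨fun z => ⟨Metric.ball z 1, Metric.ball_mem_nhds z one_pos, ?_⟩⟩
    rw [Measure.map_apply hem measurableSet_ball, e.preimage_ball]
    exact hν.1.boundedly_finite _ Metric.isBounded_ball
  -- On the plane two regular measures agree if they agree on compactly supported continuous
  -- functions. The rest compares the same rescaled integrals through `Ψ` and through `φ`.
  have : planeMeasure.Regular := Measure.Regular.smul (by simp)
  refine Measure.ext_of_integral_eq_on_compactlySupported fun f => ?_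
  have hfc : Continuous f := f.continuous
  rw [integral_map hem.aemeasurable hfc.measurable.aestronglyMeasurable]
  obtain ⟨C, hC⟩ := hfc.bounded_above_of_compact_support f.hasCompactSupport
  obtain ⟨L, hL0, hL⟩ := f.hasCompactSupport.isBounded.subset_ball_lt 0 (0 : ℝ × ℝ)
  have hfz : ∀ z : ℝ × ℝ, L ≤ ‖z‖ → f z = 0 := fun z hz => by
    by_contra h
    have := hL (subset_tsupport _ h)
    rw [mem_ball_zero_iff] at this
    linarith
  set F : Y → ℝ := fun y => f (e y) with hF
  have hFc : Continuous F := hfc.comp e.continuous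
  have hnorm : ∀ y, ‖e y‖ = dist y q := fun y => by
    rw [← dist_zero_right, ← he, e.dist_eq]
  have hFz : ∀ y, L ≤ dist y q → F y = 0 := fun y hy => hfz _ (by rwa [hnorm])
  have hRL : ∀ᶠ j in atTop, L ≤ R j := hRlim.eventually_ge_atTop L
  have T1 : Tendsto (fun i : ℕ × ℕ => ∫ y, F y ∂((μ (Metric.ball p (rad i.2)))⁻¹ •
      (μ.restrict (B i)).map (Ψ i))) 𝓥 (𝓝 (∫ y, F y ∂ν)) := by
    refine fun s hs => h𝓥 (P := fun i => ∫ y, F y ∂((μ (Metric.ball p (rad i.2)))⁻¹ •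
      (μ.restrict (B i)).map (Ψ i)) ∈ s) ?_
    filter_upwards [hRL] with j hj
    have h1 : ∫ y, F y ∂(ν.restrict (Metric.ball q (R j))) = ∫ y, F y ∂ν :=
      setIntegral_eq_integral_of_forall_compl_eq_zero fun y hy =>
        hFz y (hj.trans (not_lt.1 hy))
    have hsupp : Function.support F ⊆ Metric.ball q L := fun y hy => by
      by_contra h
      exact hy (hFz y (not_lt.1 h))
    have h2 := hint j F hFc ⟨C, fun y => hC _⟩ (Metric.isBounded_ball.subset hsupp)
    rw [h1] at h2
    exact h2 hs
  have T2 : Tendsto (fun i : ℕ × ℕ => ∫ y, f y ∂((μ (Metric.ball p (rad i.2)))⁻¹ •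
      (μ.restrict (B i)).map (φ i))) 𝓥 (𝓝 (∫ y, f y ∂planeMeasure)) := by
    refine fun s hs => h𝓥 (P := fun i => ∫ y, f y ∂((μ (Metric.ball p (rad i.2)))⁻¹ •
      (μ.restrict (B i)).map (φ i)) ∈ s) ?_
    filter_upwards [hRL] with j hj
    have h1 : ∫ y, f y ∂(planeMeasure.restrict (Metric.ball 0 (R j))) = ∫ y, f y ∂planeMeasure :=
      setIntegral_eq_integral_of_forall_compl_eq_zero fun y hy =>
        hfz y (hj.trans (by simpa using hy))
    have h2 := (tendsto_integral_normalized p hfc hC (R j)).comp hrad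
    rw [h1] at h2
    exact h2 hs
  have T3 : Tendsto (fun i : ℕ × ℕ => (∫ y, F y ∂((μ (Metric.ball p (rad i.2)))⁻¹ •
      (μ.restrict (B i)).map (Ψ i))) - ∫ y, f y ∂((μ (Metric.ball p (rad i.2)))⁻¹ •
      (μ.restrict (B i)).map (φ i))) 𝓥 (𝓝 0) := by
    -- Upper Ahlfors bound on the ball of radius `(L + 4) * rad` over the lower bound on the ball of
    -- radius `rad`; this bounds the normalized mass of the region where the integrands can differ.
    set M : ℝ := 24 * 24 * (L + 4) ^ 2 with hM
    have hM0 : 0 < M := by positivity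
    rw [Metric.tendsto_nhds]
    intro η hη
    have huc := f.hasCompactSupport.uniformContinuous_of_continuous hfc
    obtain ⟨θ, hθ, hθf⟩ := Metric.uniformContinuous_iff.1 huc (η / (2 * M)) (by positivity)
    filter_upwards [hk, hpos, ha, hb, hδlim.eventually_lt_const one_pos,
      hclose (L + 2) (θ / 2) (half_pos hθ)] with i hi hi1 hai hbi hδi hci
    have h0 : 0 < rad i.2 := by linarith
    have hmΨ := (hψ i.1 i.2 hi).1
    have hmφ : Measurable (φ i) := measurable_rescale p _
    rw [integral_smul_map_restrict hmΨ _ hFc, integral_smul_map_restrict hmφ _ hfc, ← mul_sub]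
    have hfin : μ (B i) ≠ ∞ := gridStripMeasure_ball_ne_top p _
    have i1 : IntegrableOn (fun x => F (Ψ i x)) (B i) μ :=
      Measure.integrableOn_of_bounded (M := C) hfin
        (hFc.measurable.comp hmΨ).aestronglyMeasurable (Eventually.of_forall fun x => hC _)
    have i2 : IntegrableOn (fun x => f (φ i x)) (B i) μ :=
      Measure.integrableOn_of_bounded (M := C) hfin
        (hfc.measurable.comp hmφ).aestronglyMeasurable (Eventually.of_forall fun x => hC _)
    rw [← integral_sub i1 i2]
    set B' := Metric.ball p ((L + 4) * rad i.2) with hB'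
    -- If `φ i x` lies within `L + 2`, uniform continuity applies to the nearby points `e (Ψ i x)`
    -- and `φ i x`. Otherwise both values vanish, as the two distances to the base points differ by
    -- less than 1.
    have hpt : ∀ x ∈ B i, ‖F (Ψ i x) - f (φ i x)‖ ≤ B'.indicator (fun _ => η / (2 * M)) x := by
      intro x hx
      by_cases hxL : dist (φ i x) 0 ≤ L + 2
      · have h1 := hci x hx hxL
        have h2 := hθf (lt_of_le_of_lt h1 (half_lt_self hθ))
        have h3 : x ∈ B' := by
          rw [hB', Metric.mem_ball]
          refine (dist_le_rescale p h0 x).trans_lt ?_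
          rw [dist_zero_right] at hxL
          have := mul_le_mul_of_nonneg_left hxL h0.le
          simp only [hφ] at this
          linarith
        rw [Set.indicator_of_mem h3, ← dist_eq_norm]
        exact h2.le
      · push Not at hxL
        have h1 := abs_le.1 (hai x hx p hbi.1)
        rw [hbi.2.1, hbi.2.2] at h1
        rw [hFz _ (by linarith [h1.2]), hfz _ (by rw [← dist_zero_right]; linarith), sub_zero,
          norm_zero]
        exact Set.indicator_nonneg (fun _ _ => by positivity) _
    have hB'fin : μ B' ≠ ∞ := gridStripMeasure_ball_ne_top p _
    have hind : Integrable (B'.indicator fun _ => η / (2 * M)) μ :=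
      (integrable_indicator_iff measurableSet_ball).2 (integrableOn_const hB'fin)
    have h2 : ‖∫ x in B i, (F (Ψ i x) - f (φ i x)) ∂μ‖ ≤ (μ B').toReal * (η / (2 * M)) := by
      calc _ ≤ ∫ x in B i, B'.indicator (fun _ => η / (2 * M)) x ∂μ := by
            refine norm_integral_le_of_norm_le hind.integrableOn ?_
            filter_upwards [ae_restrict_mem measurableSet_ball] with x hx using hpt x hx
        _ ≤ ∫ x, B'.indicator (fun _ => η / (2 * M)) x ∂μ :=
            setIntegral_le_integral hind (Eventually.of_forall fun x =>
              Set.indicator_nonneg (fun _ _ => by positivity) _)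
        _ = _ := by
            rw [integral_indicator measurableSet_ball, setIntegral_const, smul_eq_mul,
              measureReal_def]
    have h3 : 24⁻¹ * rad i.2 ^ 2 ≤ (μ (Metric.ball p (rad i.2))).toReal :=
      (ENNReal.ofReal_le_iff_le_toReal (gridStripMeasure_ball_ne_top p _)).1
        (le_gridStripMeasure_ball p h0)
    have h4 : (μ B').toReal ≤ 24 * ((L + 4) * rad i.2) ^ 2 :=
      ENNReal.toReal_le_of_le_ofReal (by positivity) (gridStripMeasure_ball_le p (by positivity))
    have h5 : 0 < (μ (Metric.ball p (rad i.2))).toReal := lt_of_lt_of_le (by positivity) h3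
    rw [dist_zero_right, norm_mul, ENNReal.toReal_inv, norm_inv, Real.norm_of_nonneg h5.le,
      inv_mul_lt_iff₀ h5]
    refine h2.trans_lt ?_
    calc (μ B').toReal * (η / (2 * M)) ≤ 24 * ((L + 4) * rad i.2) ^ 2 * (η / (2 * M)) := by
          gcongr
      _ = (24⁻¹ * rad i.2 ^ 2) * (η / 2) := by
          rw [hM]
          field_simp
      _ ≤ (μ (Metric.ball p (rad i.2))).toReal * (η / 2) := by gcongr
      _ < _ := by
          have := mul_pos h5 hη
          linarith
  have T4 := T1.sub T2
  exact sub_eq_zero.1 (tendsto_nhds_unique T4 T3)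

end Uniqueness

/-! ### Directional derivatives bound the energy from below -/

section DirectionalEnergy

variable {E : Type u} [NormedAddCommGroup E] [NormedSpace ℝ E] [FiniteDimensional ℝ E]

theorem IsBddSuppLipschitz.hasCompactSupport {f : E → ℝ} (hf : IsBddSuppLipschitz f) :
    HasCompactSupport f := by
  have := FiniteDimensional.proper ℝ E
  exact Metric.isCompact_of_isClosed_isBounded (isClosed_tsupport f) hf.2.closure

theorem hasCompactSupport_lineDeriv {f : E → ℝ} (hf : HasCompactSupport f) (v : E) :
    HasCompactSupport fun z => lineDeriv ℝ f z v := by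
  refine hf.mono' fun z hz => ?_
  by_contra h
  have h1 : f =ᶠ[𝓝 z] fun _ => 0 := notMem_tsupport_iff_eventuallyEq.1 h
  exact hz (h1.lineDeriv_eq.trans (by simp [lineDeriv]))

variable [MeasurableSpace E] [BorelSpace E] {μ : Measure E} [μ.IsAddHaarMeasure]

theorem memLp_lineDeriv {f : E → ℝ} {K : ℝ≥0} (hf : LipschitzWith K f)
    (hfc : HasCompactSupport f) (v : E) : MemLp (fun z => lineDeriv ℝ f z v) 2 μ :=
  (hasCompactSupport_lineDeriv hfc v).memLp_of_bound
    (aestronglyMeasurable_lineDeriv hf.continuous μ) (K * ‖v‖)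
    (Eventually.of_forall fun _ => norm_lineDeriv_le_of_lipschitz ℝ hf)

theorem IsBddSuppLipschitz.memLp {f : E → ℝ} (hf : IsBddSuppLipschitz f) : MemLp f 2 μ :=
  hf.continuous.memLp_of_hasCompactSupport hf.hasCompactSupport

theorem IsBddSuppLipschitz.slopeEnergy_lt_top {f : E → ℝ} (hf : IsBddSuppLipschitz f) :
    slopeEnergy μ f < ∞ := by
  obtain ⟨K, hK⟩ := hf.1
  have h1 : ∀ z, lipSlope f z ^ 2 ≤ (tsupport f).indicator (fun _ => (K : ℝ≥0∞) ^ 2) z :=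
    fun z => by
      by_cases hz : z ∈ tsupport f
      · rw [Set.indicator_of_mem hz]
        exact pow_le_pow_left' (lipSlope_le_of_lipschitz hK z) 2
      · have h2 : f =ᶠ[𝓝 z] fun _ => 0 := notMem_tsupport_iff_eventuallyEq.1 hz
        rw [Set.indicator_of_notMem hz, lipSlope_congr h2]
        simpa using lipSlope_le_of_lipschitz (LipschitzWith.const (0 : ℝ)) z
  refine (lintegral_mono h1).trans_lt ?_
  rw [lintegral_indicator_const (isClosed_tsupport f).measurableSet]
  exact ENNReal.mul_lt_top (by finiteness) hf.hasCompactSupport.measure_lt_top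

theorem inner_toLp_toLp {f g : E → ℝ} (hf : MemLp f 2 μ) (hg : MemLp g 2 μ) :
    inner ℝ (hf.toLp f) (hg.toLp g) = ∫ z, f z * g z ∂μ := by
  rw [L2.inner_def]
  refine integral_congr_ae ?_
  filter_upwards [hf.coeFn_toLp, hg.coeFn_toLp] with z h1 h2
  simp [h1, h2, mul_comm]

theorem enorm_toLp_sq {f : E → ℝ} (hf : MemLp f 2 μ) :
    ‖hf.toLp f‖ₑ ^ 2 = ∫⁻ z, ‖f z‖ₑ ^ 2 ∂μ := by
  rw [Lp.enorm_toLp]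
  have := eLpNorm_nnreal_pow_eq_lintegral (f := f) (μ := μ) (p := 2) (by norm_num)
  simpa using this

theorem lintegral_lineDeriv_sq_le_slopeEnergy {f : E → ℝ} (hf : IsBddSuppLipschitz f) {v : E}
    (hv : ‖v‖ ≤ 1) : ∫⁻ z, ‖lineDeriv ℝ f z v‖ₑ ^ 2 ∂μ ≤ slopeEnergy μ f := by
  obtain ⟨K, hK⟩ := hf.1
  refine lintegral_mono_ae ?_
  filter_upwards [hK.ae_differentiableAt_of_real (μ := μ)] with z hz
  refine pow_le_pow_left' (le_trans ?_ (enorm_fderiv_le_lipSlope hz)) 2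
  rw [hz.lineDeriv_eq_fderiv, enorm_le_iff_norm_le]
  exact ((fderiv ℝ f z).le_opNorm v).trans (mul_le_of_le_one_right (norm_nonneg _) hv)

/-- A lower bound by duality. Tested against a smooth `w`, the derivative of `f` along `v` moves to
`w`; there `f` may be replaced by a competitor `u`, and moving the derivative back bounds the
pairing by the energy of `u`. Thus only weak convergence of the derivatives is needed. -/
theorem lintegral_lineDeriv_sq_le_cheegerEnergy {f : E → ℝ} (hf : IsBddSuppLipschitz f) {v : E}
    (hv : ‖v‖ ≤ 1) {φ : Lp ℝ 2 μ} (hφ : φ =ᵐ[μ] f) :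
    ∫⁻ z, ‖lineDeriv ℝ f z v‖ₑ ^ 2 ∂μ ≤ cheegerEnergy μ φ := by
  obtain ⟨K, hK⟩ := hf.1
  have hF := memLp_lineDeriv (μ := μ) hK hf.hasCompactSupport v
  have hφf : φ = hf.memLp.toLp f := Lp.ext (hφ.trans hf.memLp.coeFn_toLp.symm)
  refine le_of_forall_gt_imp_ge_of_dense fun c hc => ?_
  rcases eq_or_ne c ∞ with rfl | hcT
  · exact le_top
  rw [← enorm_toLp_sq hF]
  set F := hF.toLp (fun z => lineDeriv ℝ f z v)
  have hdense : ∀ W : Lp ℝ 2 μ, inner ℝ F W ≤ √c.toReal * ‖W‖ := by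
    have hcl : IsClosed {W : Lp ℝ 2 μ | inner ℝ F W ≤ √c.toReal * ‖W‖} :=
      isClosed_le (by fun_prop) (by fun_prop)
    -- The bound is closed in `W`, so smooth compactly supported test functions suffice; at the end
    -- `W` is the derivative itself.
    intro W
    refine hcl.closure_subset_iff.2 ?_
      (Lp.dense_hasCompactSupport_contDiff (μ := μ) (F := ℝ) (p := 2) (by simp) W)
    rintro W ⟨w, hWw, hwc, hw⟩
    obtain ⟨C, hC⟩ := ContDiff.lipschitzWith_of_hasCompactSupport hwc hw (by simp)
    have hwb : IsBddSuppLipschitz w :=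
      ⟨⟨C, hC⟩, hwc.isBounded.subset (subset_tsupport w)⟩
    have hWw : W = hwb.memLp.toLp w := Lp.ext (hWw.trans hwb.memLp.coeFn_toLp.symm)
    have hW' := memLp_lineDeriv (μ := μ) hC hwc (-v)
    set W' := hW'.toLp (fun z => lineDeriv ℝ w z (-v))
    change inner ℝ F W ≤ √c.toReal * ‖W‖
    refine le_of_forall_pos_le_add fun η hη => ?_
    obtain ⟨u, hu, hux, hE⟩ := exists_of_cheegerEnergy_lt hc
      (ε := ENNReal.ofReal (η / (‖W'‖ + 1))) (by simp; positivity)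
    obtain ⟨D, hD⟩ := hu.1
    have hU' := memLp_lineDeriv (μ := μ) hD hu.hasCompactSupport v
    have h1 : inner ℝ F W = inner ℝ φ W' := by
      rw [hWw, hφf, inner_toLp_toLp, inner_toLp_toLp, hK.integral_lineDeriv_mul_eq hC hwc]
      simp_rw [mul_comm]
    have h2 : inner ℝ (hU'.toLp _) W = inner ℝ (hu.memLp.toLp u) W' := by
      rw [hWw, inner_toLp_toLp, inner_toLp_toLp, hD.integral_lineDeriv_mul_eq hC hwc]
      simp_rw [mul_comm]
    have h3 : ‖hU'.toLp (fun z => lineDeriv ℝ u z v)‖ ≤ √c.toReal := by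
      refine Real.le_sqrt_of_sq_le ?_
      have := (lintegral_lineDeriv_sq_le_slopeEnergy (μ := μ) hu hv).trans hE.le
      rw [← enorm_toLp_sq hU'] at this
      simpa using ENNReal.toReal_mono hcT this
    have h4 : ‖φ - hu.memLp.toLp u‖ * ‖W'‖ ≤ η := by
      have h5 : ‖φ - hu.memLp.toLp u‖ₑ ≤ ENNReal.ofReal (η / (‖W'‖ + 1)) := by
        refine le_trans (le_of_eq ?_) hux.le
        rw [← enorm_neg, neg_sub, Lp.enorm_def]
        refine eLpNorm_congr_ae ?_
        filter_upwards [Lp.coeFn_sub (hu.memLp.toLp u) φ, hu.memLp.coeFn_toLp (μ := μ)]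
          with z h6 h7
        rw [h6, Pi.sub_apply, h7]
      rw [← ofReal_norm, ENNReal.ofReal_le_ofReal_iff (by positivity),
        le_div_iff₀ (by positivity)] at h5
      nlinarith [norm_nonneg (φ - hu.memLp.toLp u)]
    calc inner ℝ F W = inner ℝ (hU'.toLp _) W + inner ℝ (φ - hu.memLp.toLp u) W' := by
          rw [h1, h2, inner_sub_left]; ring
      _ ≤ √c.toReal * ‖W‖ + η := by
          refine add_le_add ((real_inner_le_norm _ _).trans ?_)
            ((real_inner_le_norm _ _).trans h4)
          gcongr
  have h1 := hdense F
  rw [real_inner_self_eq_norm_mul_norm] at h1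
  have h2 : ‖F‖ ≤ √c.toReal := by
    rcases eq_or_lt_of_le (norm_nonneg F) with h | h
    · rw [← h]; positivity
    · exact le_of_mul_le_mul_right h1 h
  have h3 : ‖F‖ ^ 2 ≤ c.toReal := (Real.le_sqrt (norm_nonneg F) ENNReal.toReal_nonneg).1 h2
  rw [← ofReal_norm, ← ENNReal.ofReal_pow (norm_nonneg F)]
  exact (ENNReal.ofReal_le_iff_le_toReal hcT).2 h3

end DirectionalEnergy

section Parallelogram

variable {X : Type u} [MetricSpace X] [MeasurableSpace X] [BorelSpace X] {μ : Measure X}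

/-- The parallelogram law of the Sobolev norm minus that of `L²`. -/
theorem IsInfinitesimallyHilbertian.cheegerEnergy_parallelogram
    (h : IsInfinitesimallyHilbertian μ) {f g : Lp ℝ 2 μ} (hf : f ∈ sobolevSet μ)
    (hg : g ∈ sobolevSet μ) :
    (cheegerEnergy μ (f + g)).toReal + (cheegerEnergy μ (f - g)).toReal =
      2 * (cheegerEnergy μ f).toReal + 2 * (cheegerEnergy μ g).toReal := by
  obtain ⟨H, _, _, ι, _, _, hr, hn⟩ := h
  rw [← hr] at hf hg
  obtain ⟨a, rfl⟩ := hf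
  obtain ⟨b, rfl⟩ := hg
  have h1 := parallelogram_law_with_norm ℝ a b
  have h2 := parallelogram_law_with_norm ℝ (ι a) (ι b)
  simp only [hn, map_add, map_sub, sobolevNorm_sq] at h1 h2
  linarith

end Parallelogram

/-! ### The plane with the supremum norm is not infinitesimally Hilbertian -/

section Plane

/-- The ridge along the line `s = 0`, cut off at distance `17`. -/
def ridge (s t : ℝ) : ℝ := max 0 (min (1 - |s|) ((17 - |t|) / 16))

theorem abs_ridge_sub_ridge_le (s t s' t' : ℝ) :
    |ridge s t - ridge s' t'| ≤ max |s - s'| (|t - t'| / 16) := by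
  unfold ridge
  refine (abs_max_sub_max_le_max _ _ _ _).trans ?_
  rw [sub_self, abs_zero]
  refine max_le (by positivity) ((abs_min_sub_min_le_max _ _ _ _).trans (max_le_max ?_ ?_))
  · rw [sub_sub_sub_cancel_left, abs_sub_comm s s']
    exact abs_abs_sub_abs_le _ _
  · rw [← sub_div, sub_sub_sub_cancel_left, abs_div, abs_of_pos (by norm_num : (0 : ℝ) < 16),
      abs_sub_comm t t']
    exact div_le_div_of_nonneg_right (abs_abs_sub_abs_le _ _) (by norm_num)

theorem ridge_nonneg (s t : ℝ) : 0 ≤ ridge s t := le_max_left _ _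

theorem ridge_eq_zero {s t : ℝ} (h : 1 ≤ |s| ∨ 17 ≤ |t|) : ridge s t = 0 := by
  refine max_eq_left (min_le_iff.2 ?_)
  rcases h with h | h
  · left; linarith
  · right; linarith

theorem ridge_of_abs_le_one {s t : ℝ} (h : |t| ≤ 1) : ridge s t = max 0 (1 - |s|) := by
  unfold ridge
  rw [min_eq_left]
  linarith [abs_nonneg s]

/-- The ridge in the coordinates given by two linear forms. -/
def linearRidge (σ τ : ℝ × ℝ →L[ℝ] ℝ) (z : ℝ × ℝ) : ℝ := ridge (σ z) (τ z)

variable {σ τ : ℝ × ℝ →L[ℝ] ℝ} {z w : ℝ × ℝ}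

theorem hasDerivAt_linearRidge (h : DifferentiableAt ℝ (linearRidge σ τ) z) (w : ℝ × ℝ) :
    HasDerivAt (fun r : ℝ => ridge (σ z + r * σ w) (τ z + r * τ w))
      (fderiv ℝ (linearRidge σ τ) z w) 0 := by
  have h1 : HasDerivAt (fun r : ℝ => linearRidge σ τ (z + r • w))
      (fderiv ℝ (linearRidge σ τ) z w) 0 := h.hasFDerivAt.hasLineDerivAt w
  simpa [linearRidge] using h1

/-- Where the nonnegative ridge vanishes it is minimal. This includes the boundary of the support,
where no neighbourhood argument would apply. -/
theorem fderiv_linearRidge_eq_zero (h : 1 ≤ |σ z| ∨ 17 ≤ |τ z|) :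
    fderiv ℝ (linearRidge σ τ) z = 0 :=
  IsLocalMin.fderiv_eq_zero (Eventually.of_forall fun y => by
    change ridge (σ z) (τ z) ≤ _
    rw [ridge_eq_zero h]
    exact ridge_nonneg _ _)

theorem eventually_abs_add_mul_lt {a b c : ℝ} (h : |a| < c) :
    ∀ᶠ r : ℝ in 𝓝 0, |a + r * b| < c := by
  have : Tendsto (fun r : ℝ => |a + r * b|) (𝓝 0) (𝓝 |a|) := by
    have h1 : Continuous fun r : ℝ => |a + r * b| := by fun_prop
    simpa using h1.tendsto 0
  exact this.eventually_lt_const h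

theorem fderiv_linearRidge_apply_eq_zero (h : DifferentiableAt ℝ (linearRidge σ τ) z)
    (hτ : |τ z| < 1) (hw : σ w = 0) : fderiv ℝ (linearRidge σ τ) z w = 0 := by
  refine (hasDerivAt_linearRidge h w).unique ?_
  refine (hasDerivAt_const (0 : ℝ) (max 0 (1 - |σ z|))).congr_of_eventuallyEq ?_
  filter_upwards [eventually_abs_add_mul_lt (b := τ w) hτ] with r hr
  rw [ridge_of_abs_le_one hr.le, hw, mul_zero, add_zero]

theorem fderiv_linearRidge_apply_eq_neg (h : DifferentiableAt ℝ (linearRidge σ τ) z)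
    (hτ : |τ z| < 1) (hσ : 0 < σ z) (hσ' : σ z < 1) :
    fderiv ℝ (linearRidge σ τ) z w = -σ w := by
  refine (hasDerivAt_linearRidge h w).unique ?_
  have h1 : HasDerivAt (fun r : ℝ => 1 - (σ z + r * σ w)) (-σ w) 0 := by
    simpa using (((hasDerivAt_id (0 : ℝ)).mul_const (σ w)).const_add (σ z)).const_sub 1
  refine h1.congr_of_eventuallyEq ?_
  have h2 : |σ z - 1 / 2| < 1 / 2 := by rw [abs_lt]; constructor <;> linarith
  filter_upwards [eventually_abs_add_mul_lt (b := τ w) hτ,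
    eventually_abs_add_mul_lt (b := σ w) h2] with r hr hr2
  rw [abs_lt] at hr2
  rw [ridge_of_abs_le_one hr.le, abs_of_nonneg (by linarith), max_eq_right (by linarith)]

theorem abs_fderiv_linearRidge_apply_le (h : DifferentiableAt ℝ (linearRidge σ τ) z)
    (hw : σ w = 0) : |fderiv ℝ (linearRidge σ τ) z w| ≤ |τ w| / 16 := by
  refine (hasDerivAt_linearRidge h w).le_of_lip' (by positivity) (Eventually.of_forall fun r => ?_)
  rw [Real.norm_eq_abs]
  refine (abs_ridge_sub_ridge_le _ _ _ _).trans (le_of_eq ?_)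
  rw [hw]
  simp only [mul_zero, add_zero, sub_self, abs_zero, zero_mul, add_sub_cancel_left, abs_mul,
    sub_zero, Real.norm_eq_abs]
  rw [max_eq_right (by positivity)]
  ring

/-- The linear form `x + y`. -/
def sumForm : ℝ × ℝ →L[ℝ] ℝ := .fst ℝ ℝ ℝ + .snd ℝ ℝ ℝ

/-- The linear form `x - y`. -/
def diffForm : ℝ × ℝ →L[ℝ] ℝ := .fst ℝ ℝ ℝ - .snd ℝ ℝ ℝ

theorem sumForm_apply (z : ℝ × ℝ) : sumForm z = z.1 + z.2 := rfl

theorem diffForm_apply (z : ℝ × ℝ) : diffForm z = z.1 - z.2 := rfl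

/-- The unit square is the convex hull of its corners, and up to sign the corners are `(1, 1)` and
`(1, -1)`. -/
theorem norm_le_max_apply (ℓ : ℝ × ℝ →L[ℝ] ℝ) : ‖ℓ‖ ≤ max |ℓ (1, 1)| |ℓ (1, -1)| := by
  refine ℓ.opNorm_le_bound (by positivity) fun z => ?_
  have h1 : z = ((z.1 + z.2) / 2) • ((1, 1) : ℝ × ℝ) + ((z.1 - z.2) / 2) • ((1, -1) : ℝ × ℝ) := by
    ext <;> simp <;> ring
  have h2 : (|z.1 + z.2| + |z.1 - z.2|) / 2 ≤ ‖z‖ := by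
    rw [Prod.norm_def, Real.norm_eq_abs, Real.norm_eq_abs]
    have := le_max_left |z.1| |z.2|
    have := le_max_right |z.1| |z.2|
    rcases abs_cases (z.1 + z.2) with h | h <;> rcases abs_cases (z.1 - z.2) with h' | h' <;>
      rcases abs_cases z.1 with h'' | h'' <;> rcases abs_cases z.2 with h''' | h''' <;> linarith
  set M := max |ℓ (1, 1)| |ℓ (1, -1)| with hM
  have hM0 : 0 ≤ M := by positivity
  calc ‖ℓ z‖ = |(z.1 + z.2) / 2 * ℓ (1, 1) + (z.1 - z.2) / 2 * ℓ (1, -1)| := by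
        conv_lhs => rw [h1]
        rw [map_add, map_smul, map_smul, Real.norm_eq_abs, smul_eq_mul, smul_eq_mul]
    _ ≤ |z.1 + z.2| / 2 * M + |z.1 - z.2| / 2 * M := by
        refine (abs_add_le _ _).trans ?_
        rw [abs_mul, abs_mul, abs_div, abs_div, abs_two]
        gcongr
        · exact le_max_left _ _
        · exact le_max_right _ _
    _ = M * ((|z.1 + z.2| + |z.1 - z.2|) / 2) := by ring
    _ ≤ M * ‖z‖ := by gcongr

theorem norm_sq_le_of_apply {ℓ : ℝ × ℝ →L[ℝ] ℝ} {c : ℝ} (h1 : ℓ (1, 1) ^ 2 ≤ c)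
    (h2 : ℓ (1, -1) ^ 2 ≤ c) : ‖ℓ‖ ^ 2 ≤ c := by
  have h := norm_le_max_apply ℓ
  have h0 : 0 ≤ c := (sq_nonneg _).trans h1
  refine (Real.le_sqrt (norm_nonneg _) h0).1 (h.trans (max_le ?_ ?_))
  · exact Real.abs_le_sqrt h1
  · exact Real.abs_le_sqrt h2

/-- The linear coordinates `(x + y, x - y)`. -/
def diagonalCoordinates : (ℝ × ℝ) ≃L[ℝ] ℝ × ℝ :=
  LinearEquiv.toContinuousLinearEquiv
    { toFun := fun z => (z.1 + z.2, z.1 - z.2)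
      invFun := fun z => ((z.1 + z.2) / 2, (z.1 - z.2) / 2)
      map_add' := fun z w => by ext <;> simp <;> ring
      map_smul' := fun c z => by ext <;> simp <;> ring
      left_inv := fun z => by ext <;> simp
      right_inv := fun z => by ext <;> simp <;> ring }

/-- The rectangle `s × t` in the coordinates `(x + y, x - y)`. -/
def diagonalRectangle (s t : Set ℝ) : Set (ℝ × ℝ) := diagonalCoordinates ⁻¹' (s ×ˢ t)

theorem mem_diagonalRectangle {s t : Set ℝ} :
    z ∈ diagonalRectangle s t ↔ sumForm z ∈ s ∧ diffForm z ∈ t := Iff.rfl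

theorem measurableSet_diagonalRectangle {s t : Set ℝ} (hs : MeasurableSet s)
    (ht : MeasurableSet t) : MeasurableSet (diagonalRectangle s t) :=
  diagonalCoordinates.continuous.measurable (hs.prod ht)

/-- At the crossing both differentials are pure: each vanishes on the other's direction, so the norm
of the sum or difference is a maximum instead of a sum, namely 2. The left energies total 8 against
16 on the right, which is the gain. Off the crossing of the two ridges one differential vanishes,
and the other exceeds its main component only through the cut-off. -/
theorem fderiv_linearRidge_energy_le
    (hf : DifferentiableAt ℝ (linearRidge sumForm diffForm) z)
    (hg : DifferentiableAt ℝ (linearRidge diffForm sumForm) z) :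
    ‖fderiv ℝ (linearRidge sumForm diffForm) z + fderiv ℝ (linearRidge diffForm sumForm) z‖ ^ 2 +
        ‖fderiv ℝ (linearRidge sumForm diffForm) z -
          fderiv ℝ (linearRidge diffForm sumForm) z‖ ^ 2 +
        (diagonalRectangle (Set.Ioo 0 1) (Set.Ioo 0 1)).indicator (fun _ => 8) z ≤
      2 * fderiv ℝ (linearRidge sumForm diffForm) z (1, 1) ^ 2 +
        2 * fderiv ℝ (linearRidge diffForm sumForm) z (1, -1) ^ 2 +
        ((diagonalRectangle (Set.Icc (-1) 1) (Set.Icc (-17) 17)).indicator (fun _ => 1 / 32) z +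
          (diagonalRectangle (Set.Icc (-17) 17) (Set.Icc (-1) 1)).indicator
            (fun _ => 1 / 32) z) := by
  -- The cut-off has slope `1 / 16` and `x - y` takes the value 2 on `(1, -1)`. The error `1 / 32`
  -- in the statement is `2 * (1 / 8) ^ 2`.
  have hf2 : |fderiv ℝ (linearRidge sumForm diffForm) z (1, -1)| ≤ 1 / 8 :=
    (abs_fderiv_linearRidge_apply_le hf (by norm_num [sumForm_apply])).trans
      (by norm_num [diffForm_apply])
  have hg2 : |fderiv ℝ (linearRidge diffForm sumForm) z (1, 1)| ≤ 1 / 8 :=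
    (abs_fderiv_linearRidge_apply_le hg (by norm_num [diffForm_apply])).trans
      (by norm_num [sumForm_apply])
  have hf0 : 1 ≤ |sumForm z| ∨ 17 ≤ |diffForm z| → fderiv ℝ (linearRidge sumForm diffForm) z = 0 :=
    fderiv_linearRidge_eq_zero
  have hg0 : 1 ≤ |diffForm z| ∨ 17 ≤ |sumForm z| → fderiv ℝ (linearRidge diffForm sumForm) z = 0 :=
    fderiv_linearRidge_eq_zero
  have hf3 : |diffForm z| < 1 → fderiv ℝ (linearRidge sumForm diffForm) z (1, -1) = 0 := fun h =>
    fderiv_linearRidge_apply_eq_zero hf h (by norm_num [sumForm_apply])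
  have hg3 : |sumForm z| < 1 → fderiv ℝ (linearRidge diffForm sumForm) z (1, 1) = 0 := fun h =>
    fderiv_linearRidge_apply_eq_zero hg h (by norm_num [diffForm_apply])
  have hQ : z ∈ diagonalRectangle (Set.Ioo 0 1) (Set.Ioo 0 1) →
      |sumForm z| < 1 ∧ |diffForm z| < 1 ∧
      fderiv ℝ (linearRidge sumForm diffForm) z (1, 1) = -2 ∧
      fderiv ℝ (linearRidge diffForm sumForm) z (1, -1) = -2 := by
    intro h
    obtain ⟨h1, h2⟩ := mem_diagonalRectangle.1 h
    have h3 : |sumForm z| < 1 := by rw [abs_of_pos h1.1]; exact h1.2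
    have h4 : |diffForm z| < 1 := by rw [abs_of_pos h2.1]; exact h2.2
    refine ⟨h3, h4, ?_, ?_⟩
    · rw [fderiv_linearRidge_apply_eq_neg hf h4 h1.1 h1.2, sumForm_apply]; norm_num
    · rw [fderiv_linearRidge_apply_eq_neg hg h3 h2.1 h2.2, diffForm_apply]; norm_num
  have hR1 : z ∉ diagonalRectangle (Set.Icc (-1) 1) (Set.Icc (-17) 17) →
      fderiv ℝ (linearRidge sumForm diffForm) z = 0 := fun h => hf0 (by
    rw [mem_diagonalRectangle, Set.mem_Icc, Set.mem_Icc, ← abs_le, ← abs_le] at h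
    by_contra! h'
    exact h ⟨h'.1.le, h'.2.le⟩)
  have hR2 : z ∉ diagonalRectangle (Set.Icc (-17) 17) (Set.Icc (-1) 1) →
      fderiv ℝ (linearRidge diffForm sumForm) z = 0 := fun h => hg0 (by
    rw [mem_diagonalRectangle, Set.mem_Icc, Set.mem_Icc, ← abs_le, ← abs_le] at h
    by_contra! h'
    exact h ⟨h'.2.le, h'.1.le⟩)
  generalize fderiv ℝ (linearRidge sumForm diffForm) z = A at *
  generalize fderiv ℝ (linearRidge diffForm sumForm) z = B at *
  have hi1 : 0 ≤ (diagonalRectangle (Set.Icc (-1) 1) (Set.Icc (-17) 17)).indicator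
      (fun _ => (1 / 32 : ℝ)) z := Set.indicator_nonneg (fun _ _ => by norm_num) _
  have hi2 : 0 ≤ (diagonalRectangle (Set.Icc (-17) 17) (Set.Icc (-1) 1)).indicator
      (fun _ => (1 / 32 : ℝ)) z := Set.indicator_nonneg (fun _ _ => by norm_num) _
  have key : ∀ C : ℝ × ℝ →L[ℝ] ℝ, ∀ a b : ℝ, |C (1, 1)| ≤ |a| → |C (1, -1)| ≤ |b| →
      ‖C‖ ^ 2 ≤ max (a ^ 2) (b ^ 2) := fun C a b h1 h2 =>
    norm_sq_le_of_apply ((sq_le_sq.2 h1).trans (le_max_left _ _))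
      ((sq_le_sq.2 h2).trans (le_max_right _ _))
  have hmax : ∀ a b : ℝ, max (a ^ 2) (b ^ 2) ≤ a ^ 2 + b ^ 2 := fun a b =>
    max_le (le_add_of_nonneg_right (sq_nonneg b)) (le_add_of_nonneg_left (sq_nonneg a))
  by_cases hs : |sumForm z| < 1
  · by_cases ht : |diffForm z| < 1
    · have h1 := key (A + B) (A (1, 1)) (B (1, -1)) (by simp [hg3 hs]) (by simp [hf3 ht])
      have h2 := key (A - B) (A (1, 1)) (B (1, -1)) (by simp [hg3 hs]) (by simp [hf3 ht])
      by_cases hz : z ∈ diagonalRectangle (Set.Ioo 0 1) (Set.Ioo 0 1)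
      · obtain ⟨-, -, h3, h4⟩ := hQ hz
        rw [Set.indicator_of_mem hz]
        rw [h3, h4, max_self] at h1 h2
        rw [h3, h4]
        linarith
      · rw [Set.indicator_of_notMem hz]
        linarith [hmax (A (1, 1)) (B (1, -1))]
    · have hz : z ∉ diagonalRectangle (Set.Ioo 0 1) (Set.Ioo 0 1) := fun h => ht (hQ h).2.1
      rw [Set.indicator_of_notMem hz, hg0 (Or.inl (not_lt.1 ht))]
      by_cases hz1 : z ∈ diagonalRectangle (Set.Icc (-1) 1) (Set.Icc (-17) 17)
      · rw [Set.indicator_of_mem hz1]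
        have h1 := key A (A (1, 1)) (1 / 8) le_rfl (hf2.trans (le_abs_self _))
        simp only [add_zero, sub_zero, zero_apply]
        linarith [hmax (A (1, 1)) (1 / 8)]
      · rw [hR1 hz1]
        simp only [add_zero, sub_zero, zero_apply, norm_zero]
        linarith
  · have hz : z ∉ diagonalRectangle (Set.Ioo 0 1) (Set.Ioo 0 1) := fun h => hs (hQ h).1
    rw [Set.indicator_of_notMem hz, hf0 (Or.inl (not_lt.1 hs))]
    by_cases hz1 : z ∈ diagonalRectangle (Set.Icc (-17) 17) (Set.Icc (-1) 1)
    · rw [Set.indicator_of_mem hz1]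
      have h1 := key B (1 / 8) (B (1, -1)) (hg2.trans (le_abs_self _)) le_rfl
      simp only [zero_add, zero_sub, zero_apply, norm_neg]
      linarith [hmax (1 / 8) (B (1, -1))]
    · rw [hR2 hz1]
      simp only [add_zero, sub_zero, zero_apply, norm_zero]
      linarith

instance : planeMeasure.IsAddHaarMeasure :=
  Measure.IsAddHaarMeasure.smul volume (by simp) (by simp)

theorem isBddSuppLipschitz_linearRidge (h1 : ∀ z, |σ z| ≤ 2 * ‖z‖) (h2 : ∀ z, |τ z| ≤ 2 * ‖z‖)
    (h3 : ∀ z, ‖z‖ ≤ |σ z| + |τ z|) : IsBddSuppLipschitz (linearRidge σ τ) := by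
  refine ⟨⟨2, LipschitzWith.of_dist_le_mul fun z z' => ?_⟩,
    (Metric.isBounded_closedBall (x := 0) (r := 18)).subset fun z hz => ?_⟩
  · rw [Real.dist_eq, dist_eq_norm]
    refine (abs_ridge_sub_ridge_le _ _ _ _).trans ?_
    rw [← map_sub, ← map_sub]
    have := h2 (z - z')
    exact max_le (h1 _) (by
      push_cast
      linarith [abs_nonneg (τ (z - z'))])
  · rw [mem_closedBall_zero_iff]
    by_contra! h
    refine hz (ridge_eq_zero ?_)
    by_contra! h'
    linarith [h3 z, h'.1, h'.2]

theorem abs_sumForm_le (z : ℝ × ℝ) : |sumForm z| ≤ 2 * ‖z‖ := by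
  rw [sumForm_apply]
  linarith [abs_add_le z.1 z.2, norm_fst_le z, norm_snd_le z, Real.norm_eq_abs z.1,
    Real.norm_eq_abs z.2]

theorem abs_diffForm_le (z : ℝ × ℝ) : |diffForm z| ≤ 2 * ‖z‖ := by
  rw [diffForm_apply]
  linarith [abs_sub z.1 z.2, norm_fst_le z, norm_snd_le z, Real.norm_eq_abs z.1,
    Real.norm_eq_abs z.2]

theorem norm_le_abs_sumForm_add_abs_diffForm (z : ℝ × ℝ) :
    ‖z‖ ≤ |sumForm z| + |diffForm z| := by
  rw [sumForm_apply, diffForm_apply, Prod.norm_def, Real.norm_eq_abs, Real.norm_eq_abs]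
  refine max_le (abs_le.2 ?_) (abs_le.2 ?_) <;>
    constructor <;>
    linarith [le_abs_self (z.1 + z.2), neg_abs_le (z.1 + z.2), le_abs_self (z.1 - z.2),
      neg_abs_le (z.1 - z.2)]

/-- Only ratios of such areas matter, so the determinant is left unevaluated. -/
theorem planeMeasure_diagonalRectangle (s t : Set ℝ) :
    planeMeasure (diagonalRectangle s t) =
      ENNReal.ofReal |(diagonalCoordinates.symm : (ℝ × ℝ) →L[ℝ] ℝ × ℝ).det| *
        (4⁻¹ * (volume s * volume t)) := by
  rw [diagonalRectangle, Measure.addHaar_preimage_continuousLinearEquiv, planeMeasure,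
    Measure.smul_apply, smul_eq_mul, Measure.volume_eq_prod, Measure.prod_prod]
  rfl

theorem isBddSuppLipschitz_linearRidge_sumForm :
    IsBddSuppLipschitz (linearRidge sumForm diffForm) :=
  isBddSuppLipschitz_linearRidge abs_sumForm_le abs_diffForm_le norm_le_abs_sumForm_add_abs_diffForm

theorem isBddSuppLipschitz_linearRidge_diffForm :
    IsBddSuppLipschitz (linearRidge diffForm sumForm) :=
  isBddSuppLipschitz_linearRidge abs_diffForm_le abs_sumForm_le fun z => by
    rw [add_comm]
    exact norm_le_abs_sumForm_add_abs_diffForm z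

theorem lintegral_lineDeriv_sq_ne_top {f : ℝ × ℝ → ℝ} (hf : IsBddSuppLipschitz f) (v : ℝ × ℝ) :
    ∫⁻ z, ‖lineDeriv ℝ f z v‖ₑ ^ 2 ∂planeMeasure ≠ ∞ := by
  obtain ⟨K, hK⟩ := hf.1
  rw [← enorm_toLp_sq (memLp_lineDeriv hK hf.hasCompactSupport v)]
  finiteness

theorem lintegral_indicator_ofReal {s : Set (ℝ × ℝ)} (hs : MeasurableSet s) (c : ℝ) :
    ∫⁻ z, ENNReal.ofReal (s.indicator (fun _ => c) z) ∂planeMeasure =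
      ENNReal.ofReal c * planeMeasure s := by
  rw [← lintegral_indicator_const hs]
  refine lintegral_congr fun z => ?_
  by_cases h : z ∈ s <;> simp [h]

/-- Balance of gain and loss: the unit square `Q` of the diagonal coordinates gains 8 times its
area, and each of the two rectangles has area `2 · 34 = 68` times that of `Q`, so the loss is `136 /
32 = 4.25` times it. The length 17 of the ridges makes the cut-off cheap enough. -/
theorem slopeEnergy_linearRidge_add_lt :
    slopeEnergy planeMeasure (linearRidge sumForm diffForm + linearRidge diffForm sumForm) +
        slopeEnergy planeMeasure (linearRidge sumForm diffForm - linearRidge diffForm sumForm) <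
      2 * ∫⁻ z, ‖lineDeriv ℝ (linearRidge sumForm diffForm) z (1, 1)‖ₑ ^ 2 ∂planeMeasure +
        2 * ∫⁻ z, ‖lineDeriv ℝ (linearRidge diffForm sumForm) z (1, -1)‖ₑ ^ 2 ∂planeMeasure := by
  have hf := isBddSuppLipschitz_linearRidge_sumForm
  have hg := isBddSuppLipschitz_linearRidge_diffForm
  have hfT := lintegral_lineDeriv_sq_ne_top hf (1, 1)
  have hgT := lintegral_lineDeriv_sq_ne_top hg (1, -1)
  have hdf := hf.1.choose_spec.ae_differentiableAt_of_real (μ := planeMeasure)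
  have hdg := hg.1.choose_spec.ae_differentiableAt_of_real (μ := planeMeasure)
  have hle := fun z => fderiv_linearRidge_energy_le (z := z)
  have hfm := measurable_lineDeriv (𝕜 := ℝ) (v := ((1, 1) : ℝ × ℝ)) hf.continuous
  have hgm := measurable_lineDeriv (𝕜 := ℝ) (v := ((1, -1) : ℝ × ℝ)) hg.continuous
  generalize linearRidge sumForm diffForm = f at *
  generalize linearRidge diffForm sumForm = g at *
  set Q := diagonalRectangle (Set.Ioo 0 1) (Set.Ioo 0 1) with hQ
  set R₁ := diagonalRectangle (Set.Icc (-1) 1) (Set.Icc (-17) 17) with hR₁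
  set R₂ := diagonalRectangle (Set.Icc (-17) 17) (Set.Icc (-1) 1) with hR₂
  have mQ : MeasurableSet Q := measurableSet_diagonalRectangle measurableSet_Ioo measurableSet_Ioo
  have mR₁ : MeasurableSet R₁ :=
    measurableSet_diagonalRectangle measurableSet_Icc measurableSet_Icc
  have mR₂ : MeasurableSet R₂ :=
    measurableSet_diagonalRectangle measurableSet_Icc measurableSet_Icc
  have hR₁Q : planeMeasure R₁ = 68 * planeMeasure Q := by
    rw [hR₁, hQ, planeMeasure_diagonalRectangle, planeMeasure_diagonalRectangle]
    simp only [Real.volume_Icc, Real.volume_Ioo]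
    rw [← ENNReal.ofReal_mul (by norm_num), ← ENNReal.ofReal_mul (by norm_num)]
    norm_num
    ring
  have hR₂Q : planeMeasure R₂ = 68 * planeMeasure Q := by
    rw [hR₂, hQ, planeMeasure_diagonalRectangle, planeMeasure_diagonalRectangle]
    simp only [Real.volume_Icc, Real.volume_Ioo]
    rw [← ENNReal.ofReal_mul (by norm_num), ← ENNReal.ofReal_mul (by norm_num)]
    norm_num
    ring
  have hQT : planeMeasure Q ≠ ∞ := by
    rw [hQ, planeMeasure_diagonalRectangle]
    simp only [Real.volume_Ioo]
    finiteness
  have hQ0 : planeMeasure Q ≠ 0 := by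
    have hopen : IsOpen Q :=
      (isOpen_Ioo.prod isOpen_Ioo).preimage diagonalCoordinates.continuous
    refine (hopen.measure_pos _ ⟨(1 / 2, 0), ?_⟩).ne'
    rw [hQ, mem_diagonalRectangle, sumForm_apply, diffForm_apply]
    norm_num
  have hm : Measurable fun z => 2 * ‖lineDeriv ℝ f z (1, 1)‖ₑ ^ 2 +
      2 * ‖lineDeriv ℝ g z (1, -1)‖ₑ ^ 2 := by fun_prop
  have key : (∫⁻ z, lipSlope (f + g) z ^ 2 ∂planeMeasure +
      ∫⁻ z, lipSlope (f - g) z ^ 2 ∂planeMeasure) + 8 * planeMeasure Q ≤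
      (2 * ∫⁻ z, ‖lineDeriv ℝ f z (1, 1)‖ₑ ^ 2 ∂planeMeasure +
        2 * ∫⁻ z, ‖lineDeriv ℝ g z (1, -1)‖ₑ ^ 2 ∂planeMeasure) +
        ENNReal.ofReal (1 / 32) * (planeMeasure R₁ + planeMeasure R₂) := by
    rw [mul_add (ENNReal.ofReal _), ← lintegral_indicator_ofReal mR₁,
      ← lintegral_indicator_ofReal mR₂, show (8 : ℝ≥0∞) = ENNReal.ofReal 8 by norm_num,
      ← lintegral_indicator_ofReal mQ,
      ← lintegral_add_left ((measurable_lipSlope (hf.add hg).continuous).pow_const 2),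
      ← lintegral_add_right _
        (measurable_const.indicator mQ).ennreal_ofReal,
      ← lintegral_const_mul _ (hfm.enorm.pow_const 2),
      ← lintegral_const_mul _ (hgm.enorm.pow_const 2),
      ← lintegral_add_right _ ((hgm.enorm.pow_const 2).const_mul 2),
      ← lintegral_add_right _ (measurable_const.indicator mR₂).ennreal_ofReal,
      ← lintegral_add_left hm]
    refine lintegral_mono_ae ?_
    filter_upwards [hdf, hdg] with z h1 h2
    have h3 := hle z h1 h2
    rw [lipSlope_eq_enorm_fderiv (h1.add h2), lipSlope_eq_enorm_fderiv (h1.sub h2),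
      fderiv_add h1 h2, fderiv_sub h1 h2, h1.lineDeriv_eq_fderiv, h2.lineDeriv_eq_fderiv]
    have hi : ∀ (S : Set (ℝ × ℝ)) {c : ℝ}, 0 ≤ c → 0 ≤ S.indicator (fun _ => c) z :=
      fun S c hc => Set.indicator_nonneg (fun _ _ => hc) _
    have h8 := hi Q (c := 8) (by norm_num)
    have hr1 := hi R₁ (c := 1 / 32) (by norm_num)
    have hr2 := hi R₂ (c := 1 / 32) (by norm_num)
    simp only [← ofReal_norm]
    rw [← ENNReal.ofReal_pow (norm_nonneg _), ← ENNReal.ofReal_pow (norm_nonneg _),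
      ← ENNReal.ofReal_pow (norm_nonneg _), ← ENNReal.ofReal_pow (norm_nonneg _),
      show (2 : ℝ≥0∞) = ENNReal.ofReal 2 by norm_num, ← ENNReal.ofReal_mul (by norm_num),
      ← ENNReal.ofReal_mul (by norm_num), ← ENNReal.ofReal_add (by positivity) (by positivity),
      ← ENNReal.ofReal_add (by positivity) h8, ← ENNReal.ofReal_add hr1 hr2,
      ← ENNReal.ofReal_add (by positivity) (by positivity),
      ← ENNReal.ofReal_add (by positivity) (by positivity)]
    refine ENNReal.ofReal_le_ofReal ?_
    simpa only [Real.norm_eq_abs, sq_abs] using h3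
  rw [hR₁Q, hR₂Q] at key
  have hRT : 2 * ∫⁻ z, ‖lineDeriv ℝ f z (1, 1)‖ₑ ^ 2 ∂planeMeasure +
      2 * ∫⁻ z, ‖lineDeriv ℝ g z (1, -1)‖ₑ ^ 2 ∂planeMeasure ≠ ∞ := by finiteness
  unfold slopeEnergy
  generalize ∫⁻ z, lipSlope (f + g) z ^ 2 ∂planeMeasure +
    ∫⁻ z, lipSlope (f - g) z ^ 2 ∂planeMeasure = L at *
  generalize 2 * ∫⁻ z, ‖lineDeriv ℝ f z (1, 1)‖ₑ ^ 2 ∂planeMeasure +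
    2 * ∫⁻ z, ‖lineDeriv ℝ g z (1, -1)‖ₑ ^ 2 ∂planeMeasure = P at *
  generalize planeMeasure Q = κ at *
  have hLT : L ≠ ∞ := by
    rintro rfl
    rw [top_add, top_le_iff] at key
    exact absurd key (by finiteness)
  have h8T : 8 * κ ≠ ∞ := by finiteness
  rw [← ENNReal.toReal_lt_toReal hLT hRT]
  have h1 := ENNReal.toReal_mono (by finiteness) key
  rw [ENNReal.toReal_add hLT h8T, ENNReal.toReal_add hRT (by finiteness), ENNReal.toReal_mul,
    ENNReal.toReal_mul, ENNReal.toReal_add (by finiteness) (by finiteness), ENNReal.toReal_mul,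
    ENNReal.toReal_ofReal (by norm_num)] at h1
  simp only [ENNReal.toReal_ofNat] at h1
  have := ENNReal.toReal_pos hQ0 hQT
  linarith

/-- Relaxed energies of the sum and difference are at most the slope energies, while those of the
single ridges are at least their directional energies. No identification of relaxed and slope energy
is needed, and the strict inequality contradicts the parallelogram law. -/
theorem not_isInfinitesimallyHilbertian_planeMeasure :
    ¬ IsInfinitesimallyHilbertian planeMeasure := by
  intro h
  have hlt := slopeEnergy_linearRidge_add_lt
  have hf := isBddSuppLipschitz_linearRidge_sumForm
  have hg := isBddSuppLipschitz_linearRidge_diffForm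
  generalize linearRidge sumForm diffForm = f at *
  generalize linearRidge diffForm sumForm = g at *
  set φ := (hf.memLp (μ := planeMeasure)).toLp f with hφ
  set γ := (hg.memLp (μ := planeMeasure)).toLp g with hγ
  have hφf : φ =ᵐ[planeMeasure] f := hf.memLp.coeFn_toLp
  have hγg : γ =ᵐ[planeMeasure] g := hg.memLp.coeFn_toLp
  have hadd : cheegerEnergy planeMeasure (φ + γ) ≤ slopeEnergy planeMeasure (f + g) :=
    cheegerEnergy_le_slopeEnergy (hf.add hg) ((Lp.coeFn_add φ γ).trans (hφf.add hγg))
  have hsub : cheegerEnergy planeMeasure (φ - γ) ≤ slopeEnergy planeMeasure (f - g) :=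
    cheegerEnergy_le_slopeEnergy (hf.sub hg) ((Lp.coeFn_sub φ γ).trans (hφf.sub hγg))
  have hφ1 := lintegral_lineDeriv_sq_le_cheegerEnergy hf (v := (1, 1)) (by simp [Prod.norm_def]) hφf
  have hγ1 := lintegral_lineDeriv_sq_le_cheegerEnergy hg (v := (1, -1)) (by simp [Prod.norm_def])
    hγg
  have hlt2 := ((add_le_add hadd hsub).trans_lt hlt).trans_le
    (add_le_add (mul_le_mul_right hφ1 2) (mul_le_mul_right hγ1 2))
  have hT : ∀ {u : ℝ × ℝ → ℝ} {ψ : Lp ℝ 2 planeMeasure}, IsBddSuppLipschitz u →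
      ψ =ᵐ[planeMeasure] u → cheegerEnergy planeMeasure ψ < ∞ := fun hu hψ =>
    (cheegerEnergy_le_slopeEnergy hu hψ).trans_lt hu.slopeEnergy_lt_top
  have h1 := h.cheegerEnergy_parallelogram (mem_sobolevSet_iff.2 (hT hf hφf))
    (mem_sobolevSet_iff.2 (hT hg hγg))
  have hφT := (hT hf hφf).ne
  have hγT := (hT hg hγg).ne
  have h2 := (ENNReal.toReal_lt_toReal hlt2.ne_top (by finiteness)).2 hlt2
  have hs := hlt2.ne_top
  rw [ENNReal.toReal_add (ENNReal.add_ne_top.1 hs).1 (ENNReal.add_ne_top.1 hs).2,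
    ENNReal.toReal_add (by finiteness) (by finiteness), ENNReal.toReal_mul,
    ENNReal.toReal_mul, ENNReal.toReal_ofNat] at h2
  linarith

end Plane

end MetricMeasure

end

theorem theoremA1 :
    IsMetricMeasureSpace gridStripMeasure ∧
    IsInfinitesimallyHilbertian gridStripMeasure ∧
    IsRectifiable gridStripMeasure ∧
    IsAhlforsRegular 2 gridStripMeasure ∧
    IsPI gridStripMeasure ∧
    -- the plane is an asymptotic cone, from every base point and along every sequence of radii
    IsAsymptoticCone gridStripMeasure planeMeasure (0 : ℝ × ℝ) ∧
    (∀ p : GridStrip, ∀ rad : ℕ → ℝ, Monotone rad → Tendsto rad atTop atTop →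
      RescalingsConverge gridStripMeasure p rad planeMeasure (0 : ℝ × ℝ)) ∧
    -- it is the only one up to isomorphism
    (∀ (Y : Type*) [MetricSpace Y] [MeasurableSpace Y] [BorelSpace Y] (ν : Measure Y) (q : Y),
      IsAsymptoticCone gridStripMeasure ν q →
        PointedIsomorphic ν q planeMeasure (0 : ℝ × ℝ)) ∧
    ¬ IsInfinitesimallyHilbertian planeMeasure := by
  refine ⟨gridStripMeasure_isMetricMeasureSpace, gridStripMeasure_isInfinitesimallyHilbertian,
    gridStripMeasure_isRectifiable, gridStripMeasure_isAhlforsRegular, gridStripMeasure_isPI,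
    plane_isAsymptoticCone, fun p rad _ h => rescalingsConverge_plane p h, ?_,
    not_isInfinitesimallyHilbertian_planeMeasure⟩
  intro Y _ _ _ ν q ⟨hν, rad, _, hrad, p, _, hconv⟩
  exact pointedIsomorphic_plane_of_rescalingsConverge hν hrad hconv
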